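/- Let $\Omega=(a,b)\times(c,d)\subset\mathbb R^2$ be a bounded open rectangle. Let $A=(a_{ij})\in[W^{1,\infty}(\Omega)]^{2\times2}$ (identified with its continuous representative, not necessarily symmetric) satisfy $C_1\,\xi^T\xi\le\xi^TA(x,y)\xi\le C_2\,\xi^T\xi$ for all $\xi\in\mathbb R^2$, $(x,y)\in\Omega$, with constants $C_1,C_2>0$, and let $c_0\in L_\infty(\Omega)$, $c_0\ge0$. Let $\gamma>0$. A rectangular mesh $T_h$ of $\Omega$ is given by subdivisions $a=x_0<\dots<x_n=b$ and $c=y_0<\dots<y_m=d$; its elements are the rectangles $K=(x_i,x_{i+1})\times(y_j,y_{j+1})$ and its nodes the points $P=(x_i,y_j)$. Let $h_K$ be the diameter of $K$, $\rho_K$ the diameter of the largest disc contained in $K$, and $h=\max_K h_K$. The mesh is regular with constant $\gamma$ if $h_K/\rho_K\le\gamma$ for all $K$. The dual element $K_P^*$ of a node $P$ is the open rectangle around $P$ bounded by the lines through the midpoints of the adjacent mesh intervals, truncated by $\partial\Omega$ if $P\in\partial\Omega$. Let $U_h$ be the space of functions that are continuous on $\overline\Omega$, bilinear on each element, and zero on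 $\partial\Omega$; let $\Pi_hu$ be the continuous piecewise bilinear function that agrees with $u$ at all nodes; and let $\Pi_h^*v=\sum_Pv(P)\chi_{K_P^*}$ for $v\in U_h$. For $w$ with piecewise continuous gradient and $z$ constant on each dual element and zero on those of the boundary nodes, put $$a_h(w,z)=\sum_{P}\Big(-\int_{\partial K_P^*}n\cdot(A\nabla w)\,z\,ds+\int_{K_P^*}c_0\,w\,z\Big),$$ where $n$ is the outward unit normal and $z$ in the boundary integral is its constant value on $K_P^*$. Let $\|\cdot\|_{m,p}$ denote the norm of the Sobolev space $W^{m,p}(\Omega)$. Theorem. There is a constant $C>0$, depending only on $\Omega$, $A$, $c_0$ and $\gamma$ (in particular not on the mesh, $h$, $p$, $u$ or $v$), such that for every rectangular mesh $T_h$ of $\Omega$ that is regular with constant $\gamma$, all $p,q$ with $2\le p\le\infty$ and $1/p+1/q=1$, every $u\in W^{3,p}(\Omega)$ (identified with its continuous representative on $\overline\Omega$) and every $v\in U_h$, $$|a_h(u-\Pi_hu,\Pi_h^*v)|\le C\,h^2\,\|u\|_{3,p}\,\|v\|_{1,q}.$$ -/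

import Mathlib

open MeasureTheory Set
open scoped ENNReal

noncomputable section

namespace FVE

/-! ### Partial derivatives, weak derivatives and Sobolev spaces on open subsets of the plane -/

/-- Classical partial derivative in the first variable. -/
def pdx (f : ℝ × ℝ → ℝ) : ℝ × ℝ → ℝ := fun z => deriv (fun t => f (t, z.2)) z.1

/-- Classical partial derivative in the second variable. -/
def pdy (f : ℝ × ℝ → ℝ) : ℝ × ℝ → ℝ := fun z => deriv (fun t => f (z.1, t)) z.2

/-- Classical derivative `∂_x^{α₁} ∂_y^{α₂} f`. -/
def pd (α : ℕ × ℕ) (f : ℝ × ℝ → ℝ) : ℝ × ℝ → ℝ := pdx^[α.1] (pdy^[α.2] f)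

/-- Test functions: smooth, with compact support contained in `Ω`. -/
def IsTestFunction (Ω : Set (ℝ × ℝ)) (φ : ℝ × ℝ → ℝ) : Prop :=
  ContDiff ℝ ((⊤ : ℕ∞) : WithTop ℕ∞) φ ∧ HasCompactSupport φ ∧ tsupport φ ⊆ Ω

/-- `g` is the weak derivative `∂^α u` on `Ω`. -/
def IsWeakDeriv (Ω : Set (ℝ × ℝ)) (α : ℕ × ℕ) (u g : ℝ × ℝ → ℝ) : Prop :=
  LocallyIntegrableOn u Ω ∧ LocallyIntegrableOn g Ω ∧
    ∀ φ, IsTestFunction Ω φ →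
      ∫ z in Ω, u z * pd α φ z = (-1) ^ (α.1 + α.2) * ∫ z in Ω, g z * φ z

/-- Multi-indices of order at most `m`. -/
def multiIndices (m : ℕ) : Finset (ℕ × ℕ) :=
  (Finset.range (m + 1) ×ˢ Finset.range (m + 1)).filter fun α => α.1 + α.2 ≤ m

/-- `u ∈ W^{m,p}(Ω)`: all weak derivatives of order at most `m` exist and lie in `L^p(Ω)`. -/
def MemSobolev (m : ℕ) (p : ℝ≥0∞) (Ω : Set (ℝ × ℝ)) (u : ℝ × ℝ → ℝ) : Prop :=
  ∀ α ∈ multiIndices m, ∃ g, IsWeakDeriv Ω α u g ∧ MemLp g p (volume.restrict Ω)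

open Classical in
/-- The weak derivative `∂^α u` on `Ω` (unique up to null sets for open `Ω`), if it exists. -/
def weakDeriv (Ω : Set (ℝ × ℝ)) (α : ℕ × ℕ) (u : ℝ × ℝ → ℝ) : ℝ × ℝ → ℝ :=
  if h : ∃ g, IsWeakDeriv Ω α u g then h.choose else 0

/-- The norm `‖u‖_{m,p,Ω}`: `(∑_{|α| ≤ m} ‖∂^α u‖_{L^p(Ω)}^p)^{1/p}` for `p < ∞`, and the
maximum of the `‖∂^α u‖_{L^∞(Ω)}` for `p = ∞`. -/
def sobolevNorm (m : ℕ) (p : ℝ≥0∞) (Ω : Set (ℝ × ℝ)) (u : ℝ × ℝ → ℝ) : ℝ :=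
  ENNReal.toReal <|
    if p = ∞ then
      (multiIndices m).sup fun α => eLpNorm (weakDeriv Ω α u) ∞ (volume.restrict Ω)
    else
      (∑ α ∈ multiIndices m,
        eLpNorm (weakDeriv Ω α u) p (volume.restrict Ω) ^ p.toReal) ^ (1 / p.toReal)

/-! ### Rectangular meshes -/

/-- The open rectangle `(a, b) × (c, d)`. -/
def rect (a b c d : ℝ) : Set (ℝ × ℝ) := Ioo a b ×ˢ Ioo c d

/-- A subdivision `a = pt 0 < pt 1 < ⋯ < pt n = b`; values of `pt` beyond `n` are never used. -/
structure Grid (a b : ℝ) where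
  n : ℕ
  pt : ℕ → ℝ
  pt_zero : pt 0 = a
  pt_last : pt n = b
  pt_lt : ∀ i < n, pt i < pt (i + 1)

namespace Grid

variable {a b : ℝ}

/-- Length of the `i`-th subinterval, `i < n`. -/
def len (X : Grid a b) (i : ℕ) : ℝ := X.pt (i + 1) - X.pt i

/-- Left end of the dual interval around `pt i`: the preceding midpoint, or `a` for `i = 0`. -/
def dualLeft (X : Grid a b) (i : ℕ) : ℝ :=
  if i = 0 then X.pt 0 else (X.pt (i - 1) + X.pt i) / 2

/-- Right end of the dual interval around `pt i`: the next midpoint, or `b` for `i = n`. -/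
def dualRight (X : Grid a b) (i : ℕ) : ℝ :=
  if i = X.n then X.pt X.n else (X.pt i + X.pt (i + 1)) / 2

/-- The continuous piecewise linear nodal function of the `i`-th grid point:
on `[a, b]` it is `1` at `pt i`, `0` at all other grid points, and affine in between. -/
def hat (X : Grid a b) (i : ℕ) (t : ℝ) : ℝ :=
  max 0 (min (if i = 0 then 1 else (t - X.pt (i - 1)) / (X.pt i - X.pt (i - 1)))
    (if i = X.n then 1 else (X.pt (i + 1) - t) / (X.pt (i + 1) - X.pt i)))

end Grid

/-- A rectangular mesh of `(a, b) × (c, d)`. The elements are the rectangles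
`K_{ij} = (x_i, x_{i+1}) × (y_j, y_{j+1})`, `i < n_x`, `j < n_y`; the nodes are the points
`(x_i, y_j)`, `i ≤ n_x`, `j ≤ n_y`. -/
structure Mesh (a b c d : ℝ) where
  X : Grid a b
  Y : Grid c d

namespace Mesh

variable {a b c d : ℝ} (T : Mesh a b c d)

/-- Index pairs of the elements. -/
abbrev Elem : Type := Fin T.X.n × Fin T.Y.n

/-- Index pairs of the nodes. -/
abbrev Node : Type := Fin (T.X.n + 1) × Fin (T.Y.n + 1)

/-- The node `P` as a point of the plane. -/
def point (P : T.Node) : ℝ × ℝ := (T.X.pt P.1, T.Y.pt P.2)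

/-- The closed element `K`. -/
def closedElem (K : T.Elem) : Set (ℝ × ℝ) :=
  Icc (T.X.pt K.1) (T.X.pt (K.1 + 1)) ×ˢ Icc (T.Y.pt K.2) (T.Y.pt (K.2 + 1))

/-- `h_K`, the (Euclidean) diameter of the rectangle `K`. -/
def diam (K : T.Elem) : ℝ := Real.sqrt (T.X.len K.1 ^ 2 + T.Y.len K.2 ^ 2)

/-- `ρ_K`, the diameter of the largest disc contained in the rectangle `K`. -/
def inDiam (K : T.Elem) : ℝ := min (T.X.len K.1) (T.Y.len K.2)

/-- The mesh size `h = max_K h_K`. -/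
def size : ℝ := ⨆ K : T.Elem, T.diam K

/-- The mesh is regular with constant `γ`. -/
def IsRegular (γ : ℝ) : Prop := ∀ K : T.Elem, T.diam K / T.inDiam K ≤ γ

/-- The trial space `U_h`: continuous on the closed rectangle, bilinear on each element and zero
on the boundary. -/
def IsTrial (v : ℝ × ℝ → ℝ) : Prop :=
  ContinuousOn v (closure (rect a b c d)) ∧
    (∀ K : T.Elem, ∃ k₀ k₁ k₂ k₃ : ℝ, ∀ z ∈ T.closedElem K,
      v z = k₀ + k₁ * z.1 + k₂ * z.2 + k₃ * (z.1 * z.2)) ∧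
    ∀ z ∈ frontier (rect a b c d), v z = 0

/-- The bilinear interpolant `Π_h u = ∑_P u(P) φ_P` with the nodal basis functions `φ_P`. -/
def interp (u : ℝ × ℝ → ℝ) : ℝ × ℝ → ℝ := fun z =>
  ∑ P : T.Node, u (T.point P) * (T.X.hat P.1 z.1 * T.Y.hat P.2 z.2)

/-- The (open) dual element `K_P^*`, bounded by the lines through the midpoints of the adjacent
edges, and by the boundary of the domain if `P` lies on it. -/
def dualElem (P : T.Node) : Set (ℝ × ℝ) :=
  rect (T.X.dualLeft P.1) (T.X.dualRight P.1) (T.Y.dualLeft P.2) (T.Y.dualRight P.2)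

/-- The centre of the dual element `K_P^*`. -/
def dualCenter (P : T.Node) : ℝ × ℝ :=
  ((T.X.dualLeft P.1 + T.X.dualRight P.1) / 2, (T.Y.dualLeft P.2 + T.Y.dualRight P.2) / 2)

/-- `Π_h^* v = ∑_P v(P) χ_P`, where `χ_P` is the characteristic function of `K_P^*`. -/
def dualInterp (v : ℝ × ℝ → ℝ) : ℝ × ℝ → ℝ := fun z =>
  ∑ P : T.Node, v (T.point P) * (T.dualElem P).indicator (fun _ => 1) z

end Mesh

/-- The flux `A ∇w`, with the pointwise gradient of `w`. -/
def flux (A : ℝ × ℝ → Matrix (Fin 2) (Fin 2) ℝ) (w : ℝ × ℝ → ℝ) (z : ℝ × ℝ) : Fin 2 → ℝ :=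
  (A z).mulVec ![pdx w z, pdy w z]

/-- The line integral `∫_{∂R} n · F ds` over the boundary of the rectangle
`R = (x₁, x₂) × (y₁, y₂)`, with `n` the outward unit normal. -/
def boundaryFlux (x₁ x₂ y₁ y₂ : ℝ) (F : ℝ × ℝ → Fin 2 → ℝ) : ℝ :=
  (∫ y in y₁..y₂, F (x₂, y) 0) - (∫ y in y₁..y₂, F (x₁, y) 0) +
    ((∫ x in x₁..x₂, F (x, y₂) 1) - ∫ x in x₁..x₂, F (x, y₁) 1)

/-- The finite volume element bilinear form
`a_h(w, v) = ∑_P (- ∫_{∂K_P^*} n · (A ∇w) v ds + ∫_{K_P^*} c w v)` for `v` constant on each dual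
element. In the line integral `v` is the boundary value taken from inside `K_P^*`, that is the
constant value of `v` on `K_P^*`, read off at the centre. -/
def fveForm {a b c d : ℝ} (T : Mesh a b c d) (A : ℝ × ℝ → Matrix (Fin 2) (Fin 2) ℝ)
    (c₀ : ℝ × ℝ → ℝ) (w v : ℝ × ℝ → ℝ) : ℝ :=
  ∑ P : T.Node,
    (-(boundaryFlux (T.X.dualLeft P.1) (T.X.dualRight P.1) (T.Y.dualLeft P.2)
        (T.Y.dualRight P.2) (flux A w) * v (T.dualCenter P)) +
      ∫ z in T.dualElem P, c₀ z * w z * v z)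

end FVE

end

/-! Write `w = u - Π_h u`. Summation by parts over the nodes turns the boundary fluxes into a sum
over elements: each half of a mid line of an element separates two neighbouring dual elements, whose
normals are opposite there, so its flux is weighted by the increment of `v` between their nodes.
Boundary nodes drop out because `v` vanishes there. On an element `K` of diameter `H` these
increments are at most `H N`, where `N` is 9 times the mean over `K` of `|v| + |∂_x v| + |∂_y v|`,
by an inverse estimate. It then suffices to bound each element by a multiple of `H² N S`, with `S`
the sum of the L¹ norms on `K` of the derivatives of `u` up to order three. Indeed `∑_K |K|⁻¹ ∫_K f
∫_K g ≤ ‖f‖_p ‖g‖_q` (`Mesh.sum_elem_mul_le`), so L¹ estimates on elements serve all exponents at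
once, with a constant independent of `p`.

On a vertical mid line the normal derivative of `w` is superconvergent: it is a central difference
error, and its integral is `O(H S)` (`IsJet.integral_abs_interp_error_dx_le`). The tangential
derivative `w_y` is one order worse, so cancellation is needed. Freeze the coefficient `a₁₂` at the
centre of the element; its Lipschitz continuity pays for the change. If `D₀`, `D₁` are the
increments of `v` along the lower and the upper edge, what remains is `(D₀ + D₁)/2` times the
integral of `w_y` over the whole mid line, which is `O(H S)`, plus `(D₁ - D₀)/2` times the second
difference `q` of `u` along the mid line, which is only `O(S)`. But `D₁ - D₀ = W₁ - W₀`, with `W₀`,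
`W₁` the increments of `v` along the left and the right edge. Moving `a₁₂ q` from the mid line to
these edges costs `O(H S)` and leaves a term `W a₁₂ q / 2` on every vertical edge, with opposite
signs from the two elements that share it. These terms telescope along a row of elements, and they
vanish at both ends because `v = 0` on the boundary (`IsJet.vertFlux_sub_edgeTerm_le`,
`Mesh.abs_sum_le_of_telescoping`). Horizontal mid lines follow by exchanging the coordinates. The
reaction term needs only the L¹ interpolation error, which is `O(H² S)`.

The element estimates are proved for smooth data (`IsJet`) and then passed to the limit. The
approximations contract the rectangle towards its centre and mollify with a radius smaller than the
gap so gained (`exists_jet_approx`). The derivatives converge in L¹, `u` converges uniformly because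
it is continuous, and `∇u` converges uniformly by a Sobolev embedding; the mid line fluxes depend on
nothing more. The same approximation shows that the entries of `A` are Lipschitz
(`exists_lipschitz_extension`). -/

open Filter Topology

namespace FVE

/-! ### One-variable difference and interpolation estimates with L¹ remainders. -/

section OneVariable

variable {a b : ℝ} {f f' f'' f''' : ℝ → ℝ}

lemma abs_sub_le_integral_abs_deriv (hf : ∀ x ∈ Icc a b, HasDerivAt f (f' x) x)
    (hc : Continuous f') {x y : ℝ} (hx : x ∈ Icc a b) (hy : y ∈ Icc a b) :
    |f x - f y| ≤ ∫ t in a..b, |f' t| := by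
  have hab : a ≤ b := hx.1.trans hx.2
  have key : ∀ x y, x ∈ Icc a b → y ∈ Icc a b → x ≤ y → |f y - f x| ≤ ∫ t in a..b, |f' t| := by
    intro x y hx hy hxy
    have h1 : ∫ t in x..y, f' t = f y - f x := by
      refine intervalIntegral.integral_eq_sub_of_hasDerivAt (fun t ht => ?_)
        (hc.intervalIntegrable _ _)
      rw [uIcc_of_le hxy] at ht
      exact hf t ⟨hx.1.trans ht.1, ht.2.trans hy.2⟩
    rw [← h1]
    refine (intervalIntegral.abs_integral_le_integral_abs hxy).trans ?_
    refine intervalIntegral.integral_mono_interval hx.1 hxy hy.2 ?_ (hc.abs.intervalIntegrable _ _)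
    exact Eventually.of_forall fun t => abs_nonneg _
  rcases le_total x y with h | h
  · rw [abs_sub_comm]; exact key x y hx hy h
  · exact key y x hy hx h

/-- The inequality `|f x| ≤ |f t| + ∫ |f'|` is integrated over `t`. Keeping the length as a factor
on the left avoids dividing by it, so degenerate intervals need no separate case. -/
lemma length_mul_abs_le (hf : ∀ x ∈ Icc a b, HasDerivAt f (f' x) x) (hcf : Continuous f)
    (hc : Continuous f') {x : ℝ} (hx : x ∈ Icc a b) :
    (b - a) * |f x| ≤ (∫ t in a..b, |f t|) + (b - a) * ∫ t in a..b, |f' t| := by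
  have hab : a ≤ b := hx.1.trans hx.2
  have : ∫ _ in a..b, |f x| ≤ ∫ t in a..b, (|f t| + ∫ t in a..b, |f' t|) := by
    refine intervalIntegral.integral_mono_on hab (by simp)
      ((hcf.abs.add continuous_const).intervalIntegrable _ _) fun t ht => ?_
    have := abs_sub_le_integral_abs_deriv hf hc hx ht
    have := abs_sub_abs_le_abs_sub (f x) (f t)
    linarith
  rw [intervalIntegral.integral_add (hcf.abs.intervalIntegrable _ _) (by simp)] at this
  simpa using this

/-- The left side is `|∫ (f' x - f' t) dt|`, and the integrand is at most `∫ |f''|` in absolute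
value. -/
lemma abs_deriv_mul_length_sub_le (hf : ∀ x ∈ Icc a b, HasDerivAt f (f' x) x)
    (hf' : ∀ x ∈ Icc a b, HasDerivAt f' (f'' x) x) (hc' : Continuous f') (hc : Continuous f'')
    {x : ℝ} (hx : x ∈ Icc a b) :
    |f' x * (b - a) - (f b - f a)| ≤ (b - a) * ∫ t in a..b, |f'' t| := by
  have hab : a ≤ b := hx.1.trans hx.2
  have h1 : ∫ t in a..b, f' t = f b - f a := by
    refine intervalIntegral.integral_eq_sub_of_hasDerivAt (fun t ht => ?_)
      (hc'.intervalIntegrable _ _)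
    rw [uIcc_of_le hab] at ht
    exact hf t ht
  have h2 : f' x * (b - a) - (f b - f a) = ∫ t in a..b, (f' x - f' t) := by
    rw [intervalIntegral.integral_sub (by simp) (hc'.intervalIntegrable _ _), h1]
    simp [mul_comm]
  rw [h2]
  refine (intervalIntegral.abs_integral_le_integral_abs hab).trans ?_
  have : ∫ t in a..b, |f' x - f' t| ≤ ∫ _ in a..b, ∫ t in a..b, |f'' t| := by
    refine intervalIntegral.integral_mono_on hab
      ((continuous_const.sub hc').abs.intervalIntegrable _ _) (by simp) fun t ht => ?_
    exact abs_sub_le_integral_abs_deriv hf' hc hx ht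
  simpa using this

/-- The derivative of `f` differs from the chord slope `s` by at most `∫ |f''|`. The mean value
inequality for `f - s t`, started at the left end where the interpolation error vanishes, gives the
bound. -/
lemma abs_sub_affine_interp_le (hab : a < b) (hf : ∀ x ∈ Icc a b, HasDerivAt f (f' x) x)
    (hf' : ∀ x ∈ Icc a b, HasDerivAt f' (f'' x) x) (hc' : Continuous f') (hc : Continuous f'')
    {x : ℝ} (hx : x ∈ Icc a b) :
    |f x - ((b - x) * f a + (x - a) * f b) / (b - a)| ≤ (b - a) * ∫ t in a..b, |f'' t| := by
  have hba : 0 < b - a := sub_pos.2 hab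
  set s := (f b - f a) / (b - a) with hs
  have hg : ∀ t ∈ Icc a b, HasDerivWithinAt (fun t => f t - t * s) (f' t - s) (Icc a b) t := by
    intro t ht
    simpa using ((hf t ht).fun_sub ((hasDerivAt_id' t).mul_const s)).hasDerivWithinAt (s := Icc a b)
  have hbd : ∀ t ∈ Icc a b, ‖f' t - s‖ ≤ ∫ t in a..b, |f'' t| := by
    intro t ht
    have := abs_deriv_mul_length_sub_le hf hf' hc' hc ht
    have e : f' t * (b - a) - (f b - f a) = (b - a) * (f' t - s) := by
      rw [hs]; field_simp
    rw [e, abs_mul, abs_of_pos hba] at this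
    exact le_of_mul_le_mul_left this hba
  have key := (convex_Icc a b).norm_image_sub_le_of_norm_hasDerivWithin_le hg hbd
    (left_mem_Icc.2 hab.le) hx
  have e : f x - ((b - x) * f a + (x - a) * f b) / (b - a) = f x - x * s - (f a - a * s) := by
    rw [hs]; field_simp; ring
  rw [e]
  refine key.trans ?_
  have h0 : 0 ≤ ∫ t in a..b, |f'' t| :=
    intervalIntegral.integral_nonneg hab.le fun t _ => abs_nonneg _
  rw [mul_comm, Real.norm_eq_abs, abs_of_nonneg (sub_nonneg.2 hx.1)]
  gcongr
  exact hx.2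

/-- The second difference is `-2` times the error of linear interpolation at the midpoint. -/
lemma abs_secondDiff_le (hab : a ≤ b) (hf : ∀ x ∈ Icc a b, HasDerivAt f (f' x) x)
    (hf' : ∀ x ∈ Icc a b, HasDerivAt f' (f'' x) x) (hc' : Continuous f') (hc : Continuous f'') :
    |f a - 2 * f ((a + b) / 2) + f b| ≤ 2 * (b - a) * ∫ t in a..b, |f'' t| := by
  rcases hab.eq_or_lt with rfl | hab
  · have : (a + a) / 2 = a := by ring
    rw [this]; simp; ring_nf
  have hm : (a + b) / 2 ∈ Icc a b := ⟨by linarith, by linarith⟩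
  have := abs_sub_affine_interp_le hab hf hf' hc' hc hm
  have hba : 0 < b - a := sub_pos.2 hab
  have e : f a - 2 * f ((a + b) / 2) + f b
      = -2 * (f ((a + b) / 2) - ((b - (a + b) / 2) * f a + ((a + b) / 2 - a) * f b) / (b - a)) := by
    field_simp; ring
  rw [e, abs_mul]
  norm_num
  linarith

/-- Superconvergence at the midpoint `m`. The function `s ↦ f (m + s) - f (m - s) - 2 s f' m`
vanishes at `0`, and its derivative is a second difference of `f'`, hence at most `2 (b - a) ∫
|f'''|`. The mean value inequality up to `s = (b - a) / 2` yields the square of the length. -/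
lemma abs_mid_deriv_mul_length_sub_le (hab : a ≤ b)
    (hf : ∀ x ∈ Icc a b, HasDerivAt f (f' x) x)
    (hf' : ∀ x ∈ Icc a b, HasDerivAt f' (f'' x) x)
    (hf'' : ∀ x ∈ Icc a b, HasDerivAt f'' (f''' x) x)
    (hc'' : Continuous f'') (hc : Continuous f''') :
    |f' ((a + b) / 2) * (b - a) - (f b - f a)| ≤ (b - a) ^ 2 * ∫ t in a..b, |f''' t| := by
  set m := (a + b) / 2 with hm
  set r := (b - a) / 2 with hr
  have hr0 : 0 ≤ r := by rw [hr]; linarith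
  have h0 : 0 ≤ ∫ t in a..b, |f''' t| :=
    intervalIntegral.integral_nonneg hab fun t _ => abs_nonneg _
  have hg : ∀ s ∈ Icc 0 r, HasDerivWithinAt (fun s => f (m + s) - f (m - s) - 2 * s * f' m)
      (f' (m + s) + f' (m - s) - 2 * f' m) (Icc 0 r) s := by
    intro s hs
    have hp : m + s ∈ Icc a b := ⟨by linarith [hs.1], by linarith [hs.2]⟩
    have hq : m - s ∈ Icc a b := ⟨by linarith [hs.2], by linarith [hs.1]⟩
    have h1 := (hf _ hp).comp_const_add m s
    have h2 := (hf _ hq).comp_const_sub m s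
    have h3 := (((hasDerivAt_id' s).const_mul 2).mul_const (f' m))
    have := ((h1.fun_sub h2).fun_sub h3).hasDerivWithinAt (s := Icc 0 r)
    exact this.congr_deriv (by ring)
  have hbd : ∀ s ∈ Icc 0 r, ‖f' (m + s) + f' (m - s) - 2 * f' m‖
      ≤ 2 * (b - a) * ∫ t in a..b, |f''' t| := by
    intro s hs
    have hsub : Icc (m - s) (m + s) ⊆ Icc a b :=
      Icc_subset_Icc (by linarith [hs.2]) (by linarith [hs.2])
    have := abs_secondDiff_le (a := m - s) (b := m + s) (by linarith [hs.1])
      (fun x hx => hf' x (hsub hx)) (fun x hx => hf'' x (hsub hx)) hc'' hc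
    have e : (m - s + (m + s)) / 2 = m := by ring
    rw [e] at this
    rw [Real.norm_eq_abs, show f' (m + s) + f' (m - s) - 2 * f' m
      = f' (m - s) - 2 * f' m + f' (m + s) by ring]
    refine this.trans ?_
    have h2 : ∫ t in (m - s)..(m + s), |f''' t| ≤ ∫ t in a..b, |f''' t| :=
      intervalIntegral.integral_mono_interval (by linarith [hs.2]) (by linarith [hs.1])
        (by linarith [hs.2]) (Eventually.of_forall fun t => abs_nonneg _)
        (hc.abs.intervalIntegrable _ _)
    have h3 : m + s - (m - s) ≤ b - a := by linarith [hs.2]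
    have h4 : 0 ≤ ∫ t in (m - s)..(m + s), |f''' t| :=
      intervalIntegral.integral_nonneg (by linarith [hs.1]) fun t _ => abs_nonneg _
    have : 0 ≤ b - a := by linarith
    gcongr
  have key := (convex_Icc 0 r).norm_image_sub_le_of_norm_hasDerivWithin_le hg hbd
    (left_mem_Icc.2 hr0) (right_mem_Icc.2 hr0)
  have e1 : m + r = b := by rw [hm, hr]; ring
  have e2 : m - r = a := by rw [hm, hr]; ring
  simp only [e1, e2, add_zero, sub_zero, sub_self, mul_zero, zero_mul, Real.norm_eq_abs] at key
  rw [abs_of_nonneg hr0, abs_sub_comm] at key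
  have e3 : 2 * r * f' m = f' m * (b - a) := by rw [hr]; ring
  rw [e3] at key
  calc _ = |f' m * (b - a) - (f b - f a)| := rfl
    _ ≤ _ := by simpa using key
    _ = _ := by rw [hr]; ring

end OneVariable

/-! ### Smooth functions on a rectangle: traces on lines and interpolation errors in L¹. -/

noncomputable section Jets

variable {x₀ x₁ y₀ y₁ : ℝ}

/-- The `L¹` norm of a function on the rectangle `(x₀, x₁) × (y₀, y₁)` as an iterated integral. -/
def rectAbs (x₀ x₁ y₀ y₁ : ℝ) (f : ℝ → ℝ → ℝ) : ℝ := ∫ y in y₀..y₁, ∫ x in x₀..x₁, |f x y|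

/-- `d i j` plays the role of `∂_x^i ∂_y^j (d 0 0)` on a closed rectangle, up to order `m`. -/
structure IsJet (m : ℕ) (x₀ x₁ y₀ y₁ : ℝ) (d : ℕ → ℕ → ℝ → ℝ → ℝ) : Prop where
  cont : ∀ i j, i + j ≤ m → Continuous (Function.uncurry (d i j))
  dx : ∀ i j, i + j + 1 ≤ m → ∀ x ∈ Icc x₀ x₁, ∀ y ∈ Icc y₀ y₁,
    HasDerivAt (fun s => d i j s y) (d (i + 1) j x y) x
  dy : ∀ i j, i + j + 1 ≤ m → ∀ x ∈ Icc x₀ x₁, ∀ y ∈ Icc y₀ y₁,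
    HasDerivAt (fun s => d i j x s) (d i (j + 1) x y) y

lemma continuous_swap_uncurry {f : ℝ → ℝ → ℝ} (hf : Continuous (Function.uncurry f)) :
    Continuous (Function.uncurry fun x y => f y x) :=
  hf.comp continuous_swap

lemma Continuous.curry_left {f : ℝ → ℝ → ℝ} (hf : Continuous (Function.uncurry f)) (x : ℝ) :
    Continuous fun y => f x y :=
  hf.comp (by fun_prop : Continuous fun y => (x, y))

lemma Continuous.curry_right {f : ℝ → ℝ → ℝ} (hf : Continuous (Function.uncurry f)) (y : ℝ) :
    Continuous fun x => f x y :=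
  hf.comp (by fun_prop : Continuous fun x => (x, y))

lemma continuous_integral_abs {f : ℝ → ℝ → ℝ} (hf : Continuous (Function.uncurry f)) (x₀ x₁ : ℝ) :
    Continuous fun y => ∫ x in x₀..x₁, |f x y| :=
  intervalIntegral.continuous_parametric_intervalIntegral_of_continuous'
    (f := fun y x => |f x y|) (continuous_swap_uncurry hf).abs x₀ x₁

lemma rectAbs_nonneg (hx : x₀ ≤ x₁) (hy : y₀ ≤ y₁) (f : ℝ → ℝ → ℝ) :
    0 ≤ rectAbs x₀ x₁ y₀ y₁ f :=
  intervalIntegral.integral_nonneg hy fun _ _ =>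
    intervalIntegral.integral_nonneg hx fun _ _ => abs_nonneg _

lemma rectAbs_swap {f : ℝ → ℝ → ℝ} (hf : Continuous (Function.uncurry f)) :
    rectAbs y₀ y₁ x₀ x₁ (fun x y => f y x) = rectAbs x₀ x₁ y₀ y₁ f := by
  unfold rectAbs
  rw [intervalIntegral_intervalIntegral_swap]
  have : IntegrableOn (Function.uncurry fun x y => |f x y|) (uIcc x₀ x₁ ×ˢ uIcc y₀ y₁) :=
    hf.abs.continuousOn.integrableOn_compact (isCompact_uIcc.prod isCompact_uIcc)
  exact this.mono_set (prod_mono uIoc_subset_uIcc uIoc_subset_uIcc)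

lemma IsJet.swap {m : ℕ} {d : ℕ → ℕ → ℝ → ℝ → ℝ} (hd : IsJet m x₀ x₁ y₀ y₁ d) :
    IsJet m y₀ y₁ x₀ x₁ fun i j x y => d j i y x where
  cont i j h := continuous_swap_uncurry (hd.cont j i (by omega))
  dx i j h x hx y hy := hd.dy j i (by omega) y hy x hx
  dy i j h x hx y hy := hd.dx j i (by omega) y hy x hx

lemma IsJet.mono {m : ℕ} {d : ℕ → ℕ → ℝ → ℝ → ℝ} (hd : IsJet m x₀ x₁ y₀ y₁ d)
    {x₀' x₁' y₀' y₁' : ℝ} (hx : Icc x₀' x₁' ⊆ Icc x₀ x₁) (hy : Icc y₀' y₁' ⊆ Icc y₀ y₁) :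
    IsJet m x₀' x₁' y₀' y₁' d where
  cont := hd.cont
  dx i j h x h1 y h2 := hd.dx i j h x (hx h1) y (hy h2)
  dy i j h x h1 y h2 := hd.dy i j h x (hx h1) y (hy h2)

lemma IsJet.sub {m : ℕ} {d e : ℕ → ℕ → ℝ → ℝ → ℝ} (hd : IsJet m x₀ x₁ y₀ y₁ d)
    (he : IsJet m x₀ x₁ y₀ y₁ e) : IsJet m x₀ x₁ y₀ y₁ fun i j x y => d i j x y - e i j x y where
  cont i j h := (hd.cont i j h).sub (he.cont i j h)
  dx i j h x h1 y h2 := (hd.dx i j h x h1 y h2).fun_sub (he.dx i j h x h1 y h2)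
  dy i j h x h1 y h2 := (hd.dy i j h x h1 y h2).fun_sub (he.dy i j h x h1 y h2)

lemma integral_le_rectAbs {f : ℝ → ℝ → ℝ} {g : ℝ → ℝ} (hy : y₀ ≤ y₁)
    (hf : Continuous (Function.uncurry f)) (hg : Continuous g) {c : ℝ}
    (h : ∀ y ∈ Icc y₀ y₁, g y ≤ c * ∫ x in x₀..x₁, |f x y|) :
    ∫ y in y₀..y₁, g y ≤ c * rectAbs x₀ x₁ y₀ y₁ f := by
  unfold rectAbs
  rw [← intervalIntegral.integral_const_mul]
  exact intervalIntegral.integral_mono_on hy (hg.intervalIntegrable _ _)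
    ((continuous_const.mul (continuous_integral_abs hf _ _)).intervalIntegrable _ _) h

/-- Trace inequality on a vertical segment. -/
lemma length_mul_integral_abs_le {f fx : ℝ → ℝ → ℝ} (hy : y₀ ≤ y₁)
    (hf : Continuous (Function.uncurry f)) (hfx : Continuous (Function.uncurry fx))
    (hd : ∀ x ∈ Icc x₀ x₁, ∀ y ∈ Icc y₀ y₁, HasDerivAt (fun s => f s y) (fx x y) x)
    {x : ℝ} (hx : x ∈ Icc x₀ x₁) :
    (x₁ - x₀) * ∫ y in y₀..y₁, |f x y| ≤
      rectAbs x₀ x₁ y₀ y₁ f + (x₁ - x₀) * rectAbs x₀ x₁ y₀ y₁ fx := by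
  unfold rectAbs
  rw [← intervalIntegral.integral_const_mul, ← intervalIntegral.integral_const_mul,
    ← intervalIntegral.integral_add]
  · refine intervalIntegral.integral_mono_on hy ?_ ?_ fun y hy => ?_
    · exact (continuous_const.mul (Continuous.curry_left hf x).abs).intervalIntegrable _ _
    · exact ((continuous_integral_abs hf _ _).add
        (continuous_const.mul (continuous_integral_abs hfx _ _))).intervalIntegrable _ _
    · exact length_mul_abs_le (fun t ht => hd t ht y hy) (Continuous.curry_right hf y)
        (Continuous.curry_right hfx y) hx
  · exact (continuous_integral_abs hf _ _).intervalIntegrable _ _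
  · exact (continuous_const.mul (continuous_integral_abs hfx _ _)).intervalIntegrable _ _

/-- Sobolev embedding with dominating mixed derivatives. -/
lemma IsJet.area_mul_abs_le {d : ℕ → ℕ → ℝ → ℝ → ℝ} (hd : IsJet 2 x₀ x₁ y₀ y₁ d)
    {x y : ℝ} (hx : x ∈ Icc x₀ x₁) (hy : y ∈ Icc y₀ y₁) :
    (x₁ - x₀) * (y₁ - y₀) * |d 0 0 x y| ≤
      rectAbs x₀ x₁ y₀ y₁ (d 0 0) + (x₁ - x₀) * rectAbs x₀ x₁ y₀ y₁ (d 1 0) +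
        (y₁ - y₀) * (rectAbs x₀ x₁ y₀ y₁ (d 0 1) + (x₁ - x₀) * rectAbs x₀ x₁ y₀ y₁ (d 1 1)) := by
  have hx01 : x₀ ≤ x₁ := hx.1.trans hx.2
  have hy01 : y₀ ≤ y₁ := hy.1.trans hy.2
  -- The point value is bounded by integrals over the vertical segment through the point, and each
  -- of these by the trace inequality. Only `∂_x`, `∂_y` and `∂_x ∂_y` occur, which is why L¹
  -- integrability suffices in two dimensions.
  have h1 := length_mul_abs_le (fun t ht => hd.dy 0 0 (by omega) x hx t ht)
    (Continuous.curry_left (hd.cont 0 0 (by omega)) x)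
    (Continuous.curry_left (hd.cont 0 1 (by omega)) x) hy
  have h2 := length_mul_integral_abs_le hy01 (hd.cont 0 0 (by omega)) (hd.cont 1 0 (by omega))
    (hd.dx 0 0 (by omega)) hx
  have h3 := length_mul_integral_abs_le hy01 (hd.cont 0 1 (by omega)) (hd.cont 1 1 (by omega))
    (hd.dx 0 1 (by omega)) hx
  have h0 : 0 ≤ x₁ - x₀ := sub_nonneg.2 hx01
  have h0' : 0 ≤ y₁ - y₀ := sub_nonneg.2 hy01
  simp only [zero_add] at *
  nlinarith [mul_le_mul_of_nonneg_left h1 h0, mul_le_mul_of_nonneg_left h3 h0']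

/-- Second order difference of `f` over an interval and its midpoint. -/
def secondDiff (y₀ y₁ : ℝ) (f : ℝ → ℝ) : ℝ := f y₀ - 2 * f ((y₀ + y₁) / 2) + f y₁

section Third

variable {d : ℕ → ℕ → ℝ → ℝ → ℝ}

/-- Second differences see `u` only along a line; the trace inequality replaces this line by the
element, at the price of one more `x`-derivative and a factor `1 / (x₁ - x₀)`. -/
lemma IsJet.integral_abs_d02_le (hd : IsJet 3 x₀ x₁ y₀ y₁ d) (hy : y₀ ≤ y₁)
    {x : ℝ} (hx : x ∈ Icc x₀ x₁) :
    (x₁ - x₀) * ∫ y in y₀..y₁, |d 0 2 x y| ≤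
      rectAbs x₀ x₁ y₀ y₁ (d 0 2) + (x₁ - x₀) * rectAbs x₀ x₁ y₀ y₁ (d 1 2) :=
  length_mul_integral_abs_le hy (hd.cont 0 2 (by omega)) (hd.cont 1 2 (by omega))
    (hd.dx 0 2 (by omega)) hx

/-- A single second difference is only of order zero in the mesh size. The missing factor `x₁ - x₀`
on the left is supplied later by the variation of the Lipschitz coefficient. -/
lemma IsJet.length_mul_secondDiff_le (hd : IsJet 3 x₀ x₁ y₀ y₁ d) (hy : y₀ ≤ y₁)
    {x : ℝ} (hx : x ∈ Icc x₀ x₁) :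
    (x₁ - x₀) * |secondDiff y₀ y₁ (d 0 0 x)| ≤ 2 * (y₁ - y₀) *
      (rectAbs x₀ x₁ y₀ y₁ (d 0 2) + (x₁ - x₀) * rectAbs x₀ x₁ y₀ y₁ (d 1 2)) := by
  have h1 := abs_secondDiff_le hy (hd.dy 0 0 (by omega) x hx) (hd.dy 0 1 (by omega) x hx)
    (Continuous.curry_left (hd.cont 0 1 (by omega)) x)
    (Continuous.curry_left (hd.cont 0 2 (by omega)) x)
  have h2 := hd.integral_abs_d02_le hy hx
  have h0 : 0 ≤ x₁ - x₀ := sub_nonneg.2 (hx.1.trans hx.2)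
  have h0' : 0 ≤ y₁ - y₀ := sub_nonneg.2 hy
  unfold secondDiff
  nlinarith [mul_le_mul_of_nonneg_left h1 h0, mul_le_mul_of_nonneg_left h2 h0']

/-- `|f(x, ·) - f(x', ·)|` integrated in `y` is bounded by the `x`-derivative. -/
lemma integral_abs_sub_le_rectAbs {f fx : ℝ → ℝ → ℝ} (hy : y₀ ≤ y₁)
    (hf : Continuous (Function.uncurry f)) (hfx : Continuous (Function.uncurry fx))
    (hd : ∀ x ∈ Icc x₀ x₁, ∀ y ∈ Icc y₀ y₁, HasDerivAt (fun s => f s y) (fx x y) x)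
    {x x' : ℝ} (hx : x ∈ Icc x₀ x₁) (hx' : x' ∈ Icc x₀ x₁) :
    ∫ y in y₀..y₁, |f x y - f x' y| ≤ rectAbs x₀ x₁ y₀ y₁ fx := by
  have := integral_le_rectAbs (x₀ := x₀) (x₁ := x₁) (c := 1) hy hfx
    ((Continuous.curry_left hf x).sub (Continuous.curry_left hf x')).abs (fun y h => by
      rw [one_mul]
      exact abs_sub_le_integral_abs_deriv (fun t ht => hd t ht y h)
        (Continuous.curry_right hfx y) hx hx')
  simpa using this

/-- The one-variable bound is applied to the difference of two vertical slices, whose second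
`y`-derivative is an integral of `∂_x ∂_y²`. Compared with one second difference this gains a power
of the mesh size, so second differences can be moved from the mid line to the edges. -/
lemma IsJet.secondDiff_sub_le (hd : IsJet 3 x₀ x₁ y₀ y₁ d) (hy : y₀ ≤ y₁)
    {x x' : ℝ} (hx : x ∈ Icc x₀ x₁) (hx' : x' ∈ Icc x₀ x₁) :
    |secondDiff y₀ y₁ (d 0 0 x) - secondDiff y₀ y₁ (d 0 0 x')| ≤
      2 * (y₁ - y₀) * rectAbs x₀ x₁ y₀ y₁ (d 1 2) := by
  have h1 := abs_secondDiff_le (f := fun y => d 0 0 x y - d 0 0 x' y) hy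
    (fun t ht => (hd.dy 0 0 (by omega) x hx t ht).fun_sub (hd.dy 0 0 (by omega) x' hx' t ht))
    (fun t ht => (hd.dy 0 1 (by omega) x hx t ht).fun_sub (hd.dy 0 1 (by omega) x' hx' t ht))
    ((Continuous.curry_left (hd.cont 0 1 (by omega)) x).sub
      (Continuous.curry_left (hd.cont 0 1 (by omega)) x'))
    ((Continuous.curry_left (hd.cont 0 2 (by omega)) x).sub
      (Continuous.curry_left (hd.cont 0 2 (by omega)) x'))
  have h2 := integral_abs_sub_le_rectAbs hy (hd.cont 0 2 (by omega)) (hd.cont 1 2 (by omega))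
    (hd.dx 0 2 (by omega)) hx hx'
  have h0' : 0 ≤ y₁ - y₀ := sub_nonneg.2 hy
  unfold secondDiff
  rw [show d 0 0 x y₀ - 2 * d 0 0 x ((y₀ + y₁) / 2) + d 0 0 x y₁
    - (d 0 0 x' y₀ - 2 * d 0 0 x' ((y₀ + y₁) / 2) + d 0 0 x' y₁)
    = d 0 0 x y₀ - d 0 0 x' y₀ - 2 * (d 0 0 x ((y₀ + y₁) / 2) - d 0 0 x' ((y₀ + y₁) / 2))
      + (d 0 0 x y₁ - d 0 0 x' y₁) by ring]
  exact h1.trans (mul_le_mul_of_nonneg_left h2 (by positivity))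

/-- The derivative in `x` of the interpolation error on the vertical mid line. -/
lemma IsJet.integral_abs_interp_error_dx_le (hd : IsJet 3 x₀ x₁ y₀ y₁ d) (hx : x₀ < x₁)
    (hy : y₀ < y₁) :
    (x₁ - x₀) * ∫ y in y₀..y₁, |d 1 0 ((x₀ + x₁) / 2) y -
        ((y₁ - y) * (d 0 0 x₁ y₀ - d 0 0 x₀ y₀) + (y - y₀) * (d 0 0 x₁ y₁ - d 0 0 x₀ y₁)) /
          ((x₁ - x₀) * (y₁ - y₀))| ≤
      (x₁ - x₀) ^ 2 * rectAbs x₀ x₁ y₀ y₁ (d 3 0) +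
        (y₁ - y₀) ^ 2 * rectAbs x₀ x₁ y₀ y₁ (d 1 2) := by
  have hx0 : 0 < x₁ - x₀ := sub_pos.2 hx
  have hy0 : 0 < y₁ - y₀ := sub_pos.2 hy
  have hxl : x₀ ∈ Icc x₀ x₁ := left_mem_Icc.2 hx.le
  have hxr : x₁ ∈ Icc x₀ x₁ := right_mem_Icc.2 hx.le
  have c00 := hd.cont 0 0 (by omega)
  have c01 := hd.cont 0 1 (by omega)
  have c02 := hd.cont 0 2 (by omega)
  have c30 := hd.cont 3 0 (by omega)
  have h02 := integral_abs_sub_le_rectAbs hy.le c02 (hd.cont 1 2 (by omega))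
    (hd.dx 0 2 (by omega)) hxr hxl
  -- At height `y` the error is the midpoint error of the central difference in `x` plus the error
  -- of linear interpolation in `y` of the increment `u(x₁, ·) - u(x₀, ·)`. The second
  -- `y`-derivative of that increment is controlled by `∂_x ∂_y² u`.
  have hpt : ∀ y ∈ Icc y₀ y₁, (x₁ - x₀) * |d 1 0 ((x₀ + x₁) / 2) y -
        ((y₁ - y) * (d 0 0 x₁ y₀ - d 0 0 x₀ y₀) + (y - y₀) * (d 0 0 x₁ y₁ - d 0 0 x₀ y₁)) /
          ((x₁ - x₀) * (y₁ - y₀))| ≤ (x₁ - x₀) ^ 2 * (∫ x in x₀..x₁, |d 3 0 x y|) +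
          (y₁ - y₀) * rectAbs x₀ x₁ y₀ y₁ (d 1 2) := by
    intro y hyy
    have h1 := abs_mid_deriv_mul_length_sub_le hx.le
      (fun t ht => hd.dx 0 0 (by omega) t ht y hyy) (fun t ht => hd.dx 1 0 (by omega) t ht y hyy)
      (fun t ht => hd.dx 2 0 (by omega) t ht y hyy)
      (Continuous.curry_right (hd.cont 2 0 (by omega)) y) (Continuous.curry_right c30 y)
    have h2 := abs_sub_affine_interp_le (f := fun y => d 0 0 x₁ y - d 0 0 x₀ y) hy
      (fun t ht => (hd.dy 0 0 (by omega) x₁ hxr t ht).fun_sub (hd.dy 0 0 (by omega) x₀ hxl t ht))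
      (fun t ht => (hd.dy 0 1 (by omega) x₁ hxr t ht).fun_sub (hd.dy 0 1 (by omega) x₀ hxl t ht))
      ((Continuous.curry_left c01 x₁).sub (Continuous.curry_left c01 x₀))
      ((Continuous.curry_left c02 x₁).sub (Continuous.curry_left c02 x₀)) hyy
    have h3 := h2.trans (mul_le_mul_of_nonneg_left h02 hy0.le)
    rw [← abs_of_pos hx0, ← abs_mul, abs_of_pos hx0]
    refine le_trans (le_of_eq ?_) ((abs_add_le _ _).trans (add_le_add h1 h3))
    congr 1
    simp only [zero_add]
    field_simp
    ring
  rw [← intervalIntegral.integral_const_mul]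
  have hc : Continuous fun y => (x₁ - x₀) * |d 1 0 ((x₀ + x₁) / 2) y -
        ((y₁ - y) * (d 0 0 x₁ y₀ - d 0 0 x₀ y₀) + (y - y₀) * (d 0 0 x₁ y₁ - d 0 0 x₀ y₁)) /
          ((x₁ - x₀) * (y₁ - y₀))| := by
    have := Continuous.curry_left (hd.cont 1 0 (by omega)) ((x₀ + x₁) / 2)
    fun_prop
  have hI := continuous_integral_abs c30 x₀ x₁
  have hcI : Continuous fun y => (x₁ - x₀) ^ 2 * (∫ x in x₀..x₁, |d 3 0 x y|) + (y₁ - y₀) * rectAbs x₀ x₁ y₀ y₁ (d 1 2) := by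
    fun_prop
  refine (intervalIntegral.integral_mono_on hy.le (hc.intervalIntegrable _ _)
    (hcI.intervalIntegrable _ _) hpt).trans ?_
  rw [intervalIntegral.integral_add ((hI.const_mul _).intervalIntegrable _ _) (by simp),
    intervalIntegral.integral_const_mul]
  simp only [intervalIntegral.integral_const, smul_eq_mul]
  unfold rectAbs
  linarith

/-- The interpolation error of `y`-increments along the vertical mid line. -/
lemma IsJet.mid_increment_le (hd : IsJet 3 x₀ x₁ y₀ y₁ d) (hx : x₀ ≤ x₁) (hy : y₀ ≤ y₁) :
    |d 0 0 ((x₀ + x₁) / 2) y₁ - d 0 0 ((x₀ + x₁) / 2) y₀ -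
      ((d 0 0 x₀ y₁ - d 0 0 x₀ y₀) + (d 0 0 x₁ y₁ - d 0 0 x₁ y₀)) / 2| ≤
      (x₁ - x₀) * rectAbs x₀ x₁ y₀ y₁ (d 2 1) := by
  have hxl : x₀ ∈ Icc x₀ x₁ := left_mem_Icc.2 hx
  have hxr : x₁ ∈ Icc x₀ x₁ := right_mem_Icc.2 hx
  have hxm : (x₀ + x₁) / 2 ∈ Icc x₀ x₁ := ⟨by linarith, by linarith⟩
  have c := fun x => Continuous.curry_left (hd.cont 0 1 (by omega)) x
  -- The quantity to bound is `-1/2` times the `y`-increment of the second difference in `x`;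
  -- writing the increment as an integral of `∂_y` leads to `∂_x² ∂_y u`.
  have h1 := abs_sub_le_integral_abs_deriv
    (f := fun y => d 0 0 x₀ y - 2 * d 0 0 ((x₀ + x₁) / 2) y + d 0 0 x₁ y)
    (f' := fun y => d 0 1 x₀ y - 2 * d 0 1 ((x₀ + x₁) / 2) y + d 0 1 x₁ y)
    (fun t ht => ((hd.dy 0 0 (by omega) x₀ hxl t ht).fun_sub
      ((hd.dy 0 0 (by omega) _ hxm t ht).const_mul 2)).fun_add
        (hd.dy 0 0 (by omega) x₁ hxr t ht))
    (((c _).sub (continuous_const.mul (c _))).add (c _))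
    (right_mem_Icc.2 hy) (left_mem_Icc.2 hy)
  have h2 := integral_le_rectAbs (x₀ := x₀) (x₁ := x₁) (c := 2 * (x₁ - x₀))
    (g := fun y => |d 0 1 x₀ y - 2 * d 0 1 ((x₀ + x₁) / 2) y + d 0 1 x₁ y|) hy
    (hd.cont 2 1 (by omega))
    (((c _).sub (continuous_const.mul (c _))).add (c _)).abs (fun y hyy =>
      abs_secondDiff_le hx (fun t ht => hd.dx 0 1 (by omega) t ht y hyy)
      (fun t ht => hd.dx 1 1 (by omega) t ht y hyy)
      (Continuous.curry_right (hd.cont 1 1 (by omega)) y)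
      (Continuous.curry_right (hd.cont 2 1 (by omega)) y))
  have h3 := h1.trans h2
  rw [show d 0 0 ((x₀ + x₁) / 2) y₁ - d 0 0 ((x₀ + x₁) / 2) y₀ -
      ((d 0 0 x₀ y₁ - d 0 0 x₀ y₀) + (d 0 0 x₁ y₁ - d 0 0 x₁ y₀)) / 2
      = (-1/2) * (d 0 0 x₀ y₁ - 2 * d 0 0 ((x₀ + x₁) / 2) y₁ + d 0 0 x₁ y₁ -
        (d 0 0 x₀ y₀ - 2 * d 0 0 ((x₀ + x₁) / 2) y₀ + d 0 0 x₁ y₀)) by ring, abs_mul]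
  norm_num
  linarith

/-- The derivative in `y` of the interpolation error on the vertical mid line. -/
lemma IsJet.integral_abs_interp_error_dy_le (hd : IsJet 3 x₀ x₁ y₀ y₁ d) (hx : x₀ < x₁)
    (hy : y₀ < y₁) :
    (x₁ - x₀) * ∫ y in y₀..y₁, |d 0 1 ((x₀ + x₁) / 2) y -
        ((d 0 0 x₀ y₁ - d 0 0 x₀ y₀) + (d 0 0 x₁ y₁ - d 0 0 x₁ y₀)) / (2 * (y₁ - y₀))| ≤
      (y₁ - y₀) * (rectAbs x₀ x₁ y₀ y₁ (d 0 2) + (x₁ - x₀) * rectAbs x₀ x₁ y₀ y₁ (d 1 2)) +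
        (x₁ - x₀) ^ 2 * rectAbs x₀ x₁ y₀ y₁ (d 2 1) := by
  have hx0 : 0 < x₁ - x₀ := sub_pos.2 hx
  have hy0 : 0 < y₁ - y₀ := sub_pos.2 hy
  have hxm : (x₀ + x₁) / 2 ∈ Icc x₀ x₁ := ⟨by linarith, by linarith⟩
  set s := ((d 0 0 x₀ y₁ - d 0 0 x₀ y₀) + (d 0 0 x₁ y₁ - d 0 0 x₁ y₀)) / (2 * (y₁ - y₀)) with hs
  have h1 := hd.mid_increment_le hx.le hy.le
  have h2 := hd.integral_abs_d02_le hy.le hxm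
  -- The slope `s` of the interpolant is compared with `∂_y u` through the mean slope of `u` on the
  -- mid line. The first comparison costs `∂_y² u` and is of first order only; the second is the mid
  -- line increment error.
  have hpt : ∀ y ∈ Icc y₀ y₁, |d 0 1 ((x₀ + x₁) / 2) y - s| ≤
      (∫ y in y₀..y₁, |d 0 2 ((x₀ + x₁) / 2) y|) +
        (x₁ - x₀) * rectAbs x₀ x₁ y₀ y₁ (d 2 1) / (y₁ - y₀) := by
    intro y hyy
    have h3 := abs_deriv_mul_length_sub_le (hd.dy 0 0 (by omega) _ hxm)
      (hd.dy 0 1 (by omega) _ hxm) (Continuous.curry_left (hd.cont 0 1 (by omega)) _)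
      (Continuous.curry_left (hd.cont 0 2 (by omega)) _) hyy
    have h4 := (abs_add_le _ _).trans (add_le_add h3 h1)
    refine le_of_mul_le_mul_left (le_trans (le_of_eq ?_) (h4.trans (le_of_eq ?_))) hy0
    · rw [← abs_of_pos hy0, ← abs_mul, abs_of_pos hy0]
      congr 1
      rw [hs]
      field_simp
      ring
    · field_simp
  have hc : Continuous fun y => |d 0 1 ((x₀ + x₁) / 2) y - s| :=
    ((Continuous.curry_left (hd.cont 0 1 (by omega)) _).sub continuous_const).abs
  have h5 := intervalIntegral.integral_mono_on (μ := volume) hy.le (hc.intervalIntegrable _ _)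
    (continuous_const.intervalIntegrable _ _) hpt
  refine (mul_le_mul_of_nonneg_left h5 hx0.le).trans ?_
  simp only [intervalIntegral.integral_const, smul_eq_mul]
  have : (x₁ - x₀) * ((y₁ - y₀) * ((∫ y in y₀..y₁, |d 0 2 ((x₀ + x₁) / 2) y|) +
        (x₁ - x₀) * rectAbs x₀ x₁ y₀ y₁ (d 2 1) / (y₁ - y₀))) =
      (y₁ - y₀) * ((x₁ - x₀) * ∫ y in y₀..y₁, |d 0 2 ((x₀ + x₁) / 2) y|) +
        (x₁ - x₀) ^ 2 * rectAbs x₀ x₁ y₀ y₁ (d 2 1) := by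
    field_simp
  rw [this]
  gcongr

/-- The bilinear interpolant on a rectangle of the corner values of `u`. -/
def bilin (x₀ x₁ y₀ y₁ : ℝ) (u : ℝ → ℝ → ℝ) (x y : ℝ) : ℝ :=
  ((x₁ - x) * ((y₁ - y) * u x₀ y₀ + (y - y₀) * u x₀ y₁) +
    (x - x₀) * ((y₁ - y) * u x₁ y₀ + (y - y₀) * u x₁ y₁)) / ((x₁ - x₀) * (y₁ - y₀))

/-- Bilinear interpolation is linear interpolation in `x` between the two vertical edges, followed
by linear interpolation in `y` on each edge. The edge errors `el`, `er` enter through a convex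
combination; being traces, they cost `∂_x ∂_y²` besides `∂_y²`. -/
lemma IsJet.rectAbs_sub_bilin_le (hd : IsJet 3 x₀ x₁ y₀ y₁ d) (hx : x₀ < x₁) (hy : y₀ < y₁) :
    rectAbs x₀ x₁ y₀ y₁ (fun x y => d 0 0 x y - bilin x₀ x₁ y₀ y₁ (d 0 0) x y) ≤
      (x₁ - x₀) ^ 2 * rectAbs x₀ x₁ y₀ y₁ (d 2 0) +
      (y₁ - y₀) ^ 2 * (rectAbs x₀ x₁ y₀ y₁ (d 0 2) + (x₁ - x₀) * rectAbs x₀ x₁ y₀ y₁ (d 1 2)) := by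
  have hx0 : 0 < x₁ - x₀ := sub_pos.2 hx
  have hy0 : 0 < y₁ - y₀ := sub_pos.2 hy
  have hxl : x₀ ∈ Icc x₀ x₁ := left_mem_Icc.2 hx.le
  have hxr : x₁ ∈ Icc x₀ x₁ := right_mem_Icc.2 hx.le
  set B := rectAbs x₀ x₁ y₀ y₁ (d 0 2) + (x₁ - x₀) * rectAbs x₀ x₁ y₀ y₁ (d 1 2) with hB
  have hedge : ∀ x ∈ Icc x₀ x₁, ∀ y ∈ Icc y₀ y₁,
      |d 0 0 x y - ((y₁ - y) * d 0 0 x y₀ + (y - y₀) * d 0 0 x y₁) / (y₁ - y₀)| ≤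
        (y₁ - y₀) * B / (x₁ - x₀) := by
    intro x hxx y hyy
    have h1 := abs_sub_affine_interp_le hy (hd.dy 0 0 (by omega) x hxx)
      (hd.dy 0 1 (by omega) x hxx) (Continuous.curry_left (hd.cont 0 1 (by omega)) x)
      (Continuous.curry_left (hd.cont 0 2 (by omega)) x) hyy
    refine h1.trans ?_
    rw [mul_div_assoc]
    refine mul_le_mul_of_nonneg_left ?_ hy0.le
    rw [le_div_iff₀ hx0, mul_comm]
    exact hd.integral_abs_d02_le hy.le hxx
  have hpt : ∀ y ∈ Icc y₀ y₁, ∀ x ∈ Icc x₀ x₁,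
      |d 0 0 x y - bilin x₀ x₁ y₀ y₁ (d 0 0) x y| ≤
        (x₁ - x₀) * (∫ x in x₀..x₁, |d 2 0 x y|) + (y₁ - y₀) * B / (x₁ - x₀) := by
    intro y hyy x hxx
    have h1 := abs_sub_affine_interp_le hx (fun t ht => hd.dx 0 0 (by omega) t ht y hyy)
      (fun t ht => hd.dx 1 0 (by omega) t ht y hyy)
      (Continuous.curry_right (hd.cont 1 0 (by omega)) y)
      (Continuous.curry_right (hd.cont 2 0 (by omega)) y) hxx
    have hl := hedge x₀ hxl y hyy
    have hr := hedge x₁ hxr y hyy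
    set el := d 0 0 x₀ y - ((y₁ - y) * d 0 0 x₀ y₀ + (y - y₀) * d 0 0 x₀ y₁) / (y₁ - y₀) with hel
    set er := d 0 0 x₁ y - ((y₁ - y) * d 0 0 x₁ y₀ + (y - y₀) * d 0 0 x₁ y₁) / (y₁ - y₀) with her
    have e : d 0 0 x y - bilin x₀ x₁ y₀ y₁ (d 0 0) x y =
        (d 0 0 x y - ((x₁ - x) * d 0 0 x₀ y + (x - x₀) * d 0 0 x₁ y) / (x₁ - x₀)) +
          ((x₁ - x) * el + (x - x₀) * er) / (x₁ - x₀) := by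
      rw [hel, her, bilin]
      field_simp
      ring
    rw [e]
    refine (abs_add_le _ _).trans (add_le_add h1 ?_)
    rw [abs_div, abs_of_pos hx0, div_le_iff₀ hx0]
    refine (abs_add_le _ _).trans ?_
    rw [abs_mul, abs_mul, abs_of_nonneg (sub_nonneg.2 hxx.2), abs_of_nonneg (sub_nonneg.2 hxx.1)]
    have := mul_le_mul_of_nonneg_left hl (sub_nonneg.2 hxx.2)
    have := mul_le_mul_of_nonneg_left hr (sub_nonneg.2 hxx.1)
    linarith
  have hcb : Continuous (Function.uncurry fun x y =>
      d 0 0 x y - bilin x₀ x₁ y₀ y₁ (d 0 0) x y) := by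
    have := hd.cont 0 0 (by omega)
    refine this.sub ?_
    unfold bilin
    fun_prop
  have h2 : ∀ y ∈ Icc y₀ y₁, ∫ x in x₀..x₁, |d 0 0 x y - bilin x₀ x₁ y₀ y₁ (d 0 0) x y| ≤
      (x₁ - x₀) ^ 2 * (∫ x in x₀..x₁, |d 2 0 x y|) + (y₁ - y₀) * B := by
    intro y hyy
    refine (intervalIntegral.integral_mono_on hx.le
      ((Continuous.curry_right hcb y).abs.intervalIntegrable _ _) (by simp) (hpt y hyy)).trans ?_
    simp only [intervalIntegral.integral_const, smul_eq_mul]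
    refine le_of_eq ?_
    field_simp
  have hI := continuous_integral_abs (hd.cont 2 0 (by omega)) x₀ x₁
  have hcI : Continuous fun y => (x₁ - x₀) ^ 2 * (∫ x in x₀..x₁, |d 2 0 x y|) + (y₁ - y₀) * B := by
    fun_prop
  refine (intervalIntegral.integral_mono_on hy.le
    ((continuous_integral_abs hcb _ _).intervalIntegrable _ _)
    (hcI.intervalIntegrable _ _) h2).trans ?_
  rw [intervalIntegral.integral_add ((hI.const_mul _).intervalIntegrable _ _) (by simp),
    intervalIntegral.integral_const_mul]
  simp only [intervalIntegral.integral_const, smul_eq_mul]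
  rw [show rectAbs x₀ x₁ y₀ y₁ (d 2 0) = ∫ y in y₀..y₁, ∫ x in x₀..x₁, |d 2 0 x y| from rfl]
  linarith

end Third

end Jets

/-! ### The flux across a mid line of one element, up to a telescoping edge term. -/

noncomputable section ElementFlux

variable {x₀ x₁ y₀ y₁ : ℝ}

/-- `x`-derivative of the bilinear interpolant on the vertical mid line. -/
def bilinDx (x₀ x₁ y₀ y₁ : ℝ) (u : ℝ → ℝ → ℝ) (y : ℝ) : ℝ :=
  ((y₁ - y) * (u x₁ y₀ - u x₀ y₀) + (y - y₀) * (u x₁ y₁ - u x₀ y₁)) / ((x₁ - x₀) * (y₁ - y₀))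

/-- `y`-derivative of the bilinear interpolant on the vertical mid line. -/
def bilinDyMid (x₀ x₁ y₀ y₁ : ℝ) (u : ℝ → ℝ → ℝ) : ℝ :=
  ((u x₀ y₁ - u x₀ y₀) + (u x₁ y₁ - u x₁ y₀)) / (2 * (y₁ - y₀))

/-- Normal flux of the interpolation error on the vertical mid line of an element. -/
def midFlux (x₀ x₁ y₀ y₁ : ℝ) (a₁ a₂ u ux uy : ℝ → ℝ → ℝ) (y : ℝ) : ℝ :=
  a₁ ((x₀ + x₁) / 2) y * (ux ((x₀ + x₁) / 2) y - bilinDx x₀ x₁ y₀ y₁ u y) +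
    a₂ ((x₀ + x₁) / 2) y * (uy ((x₀ + x₁) / 2) y - bilinDyMid x₀ x₁ y₀ y₁ u)

/-- Contribution of the vertical mid line of an element to the bilinear form; `D₀`, `D₁` are the
increments of the test function along the lower and the upper edge. -/
def vertFlux (x₀ x₁ y₀ y₁ D₀ D₁ : ℝ) (a₁ a₂ u ux uy : ℝ → ℝ → ℝ) : ℝ :=
  D₀ * (∫ y in y₀..(y₀ + y₁) / 2, midFlux x₀ x₁ y₀ y₁ a₁ a₂ u ux uy y) +
    D₁ * ∫ y in (y₀ + y₁) / 2..y₁, midFlux x₀ x₁ y₀ y₁ a₁ a₂ u ux uy y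

/-- The quantity attached to a vertical edge `{x} × (y₀, y₁)`; its sum over a mesh row telescopes. -/
def edgeTerm (y₀ y₁ W : ℝ) (a₂ u : ℝ → ℝ → ℝ) (x : ℝ) : ℝ :=
  W * (a₂ x ((y₀ + y₁) / 2) * secondDiff y₀ y₁ (u x))

variable {d : ℕ → ℕ → ℝ → ℝ → ℝ}

/-- The heart of the proof. The normal part of the flux is small by superconvergence, the variation
of `a₂` by its Lipschitz bound; the frozen tangential part is small only after half the difference
of the edge terms has been removed. `D` bounds the element size from above and turns surplus powers
of `H` into constants. -/
lemma IsJet.vertFlux_sub_edgeTerm_le (hd : IsJet 3 x₀ x₁ y₀ y₁ d) (hx : x₀ < x₁) (hy : y₀ < y₁)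
    {a₁ a₂ : ℝ → ℝ → ℝ} (ha₁ : Continuous (Function.uncurry a₁))
    (ha₂ : Continuous (Function.uncurry a₂)) {M L H D N γ S D₀ D₁ W₀ W₁ : ℝ}
    (hM₁ : ∀ x ∈ Icc x₀ x₁, ∀ y ∈ Icc y₀ y₁, |a₁ x y| ≤ M)
    (hM₂ : ∀ x ∈ Icc x₀ x₁, ∀ y ∈ Icc y₀ y₁, |a₂ x y| ≤ M)
    (hL : ∀ x y x' y', |a₂ x y - a₂ x' y'| ≤ L * (|x - x'| + |y - y'|))
    (hL0 : 0 ≤ L) (hh : x₁ - x₀ ≤ H) (hk : y₁ - y₀ ≤ H) (hγ : H ≤ γ * (x₁ - x₀)) (hγ0 : 0 ≤ γ)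
    (hHD : H ≤ D) (hD₀ : |D₀| ≤ H * N) (hD₁ : |D₁| ≤ H * N) (hW₀ : |W₀| ≤ H * N)
    (hW₁ : |W₁| ≤ H * N) (hDW : D₁ - D₀ = W₁ - W₀)
    (h02 : rectAbs x₀ x₁ y₀ y₁ (d 0 2) ≤ S) (h12 : rectAbs x₀ x₁ y₀ y₁ (d 1 2) ≤ S)
    (h21 : rectAbs x₀ x₁ y₀ y₁ (d 2 1) ≤ S) (h30 : rectAbs x₀ x₁ y₀ y₁ (d 3 0) ≤ S) :
    |vertFlux x₀ x₁ y₀ y₁ D₀ D₁ a₁ a₂ (d 0 0) (d 1 0) (d 0 1) -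
      (edgeTerm y₀ y₁ W₁ a₂ (d 0 0) x₁ - edgeTerm y₀ y₁ W₀ a₂ (d 0 0) x₀) / 2| ≤
      (M * (4 + γ) + L * (2 + 4 * D + γ)) * (H ^ 2 * N * S) := by
  have hx0 : 0 < x₁ - x₀ := sub_pos.2 hx
  have hy0 : 0 < y₁ - y₀ := sub_pos.2 hy
  have hxl : x₀ ∈ Icc x₀ x₁ := left_mem_Icc.2 hx.le
  have hxr : x₁ ∈ Icc x₀ x₁ := right_mem_Icc.2 hx.le
  have hxm : (x₀ + x₁) / 2 ∈ Icc x₀ x₁ := ⟨by linarith, by linarith⟩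
  have hym : (y₀ + y₁) / 2 ∈ Icc y₀ y₁ := ⟨by linarith, by linarith⟩
  have hH0 : 0 < H := hx0.trans_le hh
  have hHN : 0 ≤ H * N := (abs_nonneg _).trans hD₀
  have hN0 : 0 ≤ N := nonneg_of_mul_nonneg_right hHN hH0
  have hM0 : 0 ≤ M := (abs_nonneg _).trans (hM₁ _ hxm _ hym)
  have n02 := rectAbs_nonneg hx.le hy.le (d 0 2)
  have n12 := rectAbs_nonneg hx.le hy.le (d 1 2)
  have n21 := rectAbs_nonneg hx.le hy.le (d 2 1)
  have n30 := rectAbs_nonneg hx.le hy.le (d 3 0)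
  have hS0 : 0 ≤ S := n02.trans h02
  have hD0 : 0 ≤ D := hH0.le.trans hHD
  set xm := (x₀ + x₁) / 2 with hxmdef
  set ym := (y₀ + y₁) / 2 with hymdef
  set wx : ℝ → ℝ := fun y => d 1 0 xm y - bilinDx x₀ x₁ y₀ y₁ (d 0 0) y with hwx
  set wy : ℝ → ℝ := fun y => d 0 1 xm y - bilinDyMid x₀ x₁ y₀ y₁ (d 0 0) with hwy
  set c := a₂ xm ym with hc
  have cwx : Continuous wx := by
    have := Continuous.curry_left (hd.cont 1 0 (by omega)) xm
    simp only [hwx, bilinDx]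
    fun_prop
  have cwy : Continuous wy := (Continuous.curry_left (hd.cont 0 1 (by omega)) xm).sub
    continuous_const
  have ca₁ := Continuous.curry_left ha₁ xm
  have ca₂ := Continuous.curry_left ha₂ xm
  -- bounds for the error derivatives on the mid line
  have F1 : ∫ y in y₀..y₁, |wx y| ≤ (1 + γ) * (H * S) := by
    have h := hd.integral_abs_interp_error_dx_le hx hy
    refine le_of_mul_le_mul_left (h.trans ?_) hx0
    have e1 : (x₁ - x₀) ^ 2 * rectAbs x₀ x₁ y₀ y₁ (d 3 0) ≤ (x₁ - x₀) * H * S := by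
      rw [sq]; gcongr
    have e2 : (y₁ - y₀) ^ 2 * rectAbs x₀ x₁ y₀ y₁ (d 1 2) ≤ (γ * (x₁ - x₀)) * H * S := by
      rw [sq]
      have := hk.trans hγ
      gcongr
    linarith
  have F2 : ∫ y in y₀..y₁, |wy y| ≤ (γ + 2 * D) * S := by
    have h := hd.integral_abs_interp_error_dy_le hx hy
    refine le_of_mul_le_mul_left (h.trans ?_) hx0
    have e1 : (y₁ - y₀) * rectAbs x₀ x₁ y₀ y₁ (d 0 2) ≤ (γ * (x₁ - x₀)) * S := by
      have := hk.trans hγ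
      gcongr
    have e2 : (x₁ - x₀) * ((y₁ - y₀) * rectAbs x₀ x₁ y₀ y₁ (d 1 2)) ≤ (x₁ - x₀) * (D * S) := by
      have := hk.trans hHD
      gcongr
    have e3 : (x₁ - x₀) ^ 2 * rectAbs x₀ x₁ y₀ y₁ (d 2 1) ≤ (x₁ - x₀) * (D * S) := by
      rw [sq, mul_assoc]
      have := hh.trans hHD
      gcongr
    linarith
  -- splitting off the frozen coefficient
  set r : ℝ → ℝ := fun y => a₁ xm y * wx y + (a₂ xm y - c) * wy y with hr
  have cr : Continuous r := by fun_prop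
  have hsplit : ∀ s t, ∫ y in s..t, midFlux x₀ x₁ y₀ y₁ a₁ a₂ (d 0 0) (d 1 0) (d 0 1) y =
      (∫ y in s..t, r y) + c * ∫ y in s..t, wy y := by
    intro s t
    rw [← intervalIntegral.integral_const_mul, ← intervalIntegral.integral_add
      (cr.intervalIntegrable _ _) ((cwy.const_mul c).intervalIntegrable _ _)]
    refine intervalIntegral.integral_congr fun y _ => ?_
    simp only [midFlux, hr, hwx, hwy]
    ring
  have hr_bd : ∫ y in y₀..y₁, |r y| ≤ M * ((1 + γ) * (H * S)) + L * H * ((γ + 2 * D) * S) := by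
    have : ∫ y in y₀..y₁, |r y| ≤ ∫ y in y₀..y₁, (M * |wx y| + L * H * |wy y|) := by
      refine intervalIntegral.integral_mono_on hy.le (cr.abs.intervalIntegrable _ _)
        (Continuous.intervalIntegrable (by fun_prop) _ _) fun y hyy => ?_
      refine (abs_add_le _ _).trans (add_le_add ?_ ?_)
      · rw [abs_mul]
        exact mul_le_mul_of_nonneg_right (hM₁ _ hxm _ hyy) (abs_nonneg _)
      · rw [abs_mul]
        refine mul_le_mul_of_nonneg_right ((hL _ _ _ _).trans ?_) (abs_nonneg _)
        refine mul_le_mul_of_nonneg_left ?_ hL0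
        rw [sub_self, abs_zero, zero_add, abs_le]
        constructor <;> linarith [hyy.1, hyy.2]
    refine this.trans ?_
    rw [intervalIntegral.integral_add (Continuous.intervalIntegrable (by fun_prop) _ _)
      (Continuous.intervalIntegrable (by fun_prop) _ _), intervalIntegral.integral_const_mul,
      intervalIntegral.integral_const_mul]
    gcongr
  have hr_half : ∀ s t, y₀ ≤ s → s ≤ t → t ≤ y₁ → ∫ y in s..t, |r y| ≤ ∫ y in y₀..y₁, |r y| :=
    fun s t h1 h2 h3 => intervalIntegral.integral_mono_interval h1 h2 h3
      (Eventually.of_forall fun t => abs_nonneg _) (cr.abs.intervalIntegrable _ _)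
  have T1 : |D₀ * (∫ y in y₀..ym, r y) + D₁ * ∫ y in ym..y₁, r y| ≤
      (M * (1 + γ) + L * (γ + 2 * D)) * (H ^ 2 * N * S) := by
    have e1 := intervalIntegral.abs_integral_le_integral_abs (f := r) (μ := volume) hym.1
    have e2 := intervalIntegral.abs_integral_le_integral_abs (f := r) (μ := volume) hym.2
    have e3 := intervalIntegral.integral_add_adjacent_intervals (μ := volume)
      (cr.abs.intervalIntegrable y₀ ym) (cr.abs.intervalIntegrable ym y₁)
    calc _ ≤ H * N * (∫ y in y₀..ym, |r y|) + H * N * ∫ y in ym..y₁, |r y| := by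
          refine (abs_add_le _ _).trans (add_le_add ?_ ?_) <;> rw [abs_mul] <;> gcongr
      _ = H * N * ∫ y in y₀..y₁, |r y| := by rw [← e3]; ring
      _ ≤ H * N * (M * ((1 + γ) * (H * S)) + L * H * ((γ + 2 * D) * S)) := by gcongr
      _ = _ := by ring
  -- the frozen part
  have hFTC : ∀ s ∈ Icc y₀ y₁, ∀ t ∈ Icc y₀ y₁, ∫ y in s..t, wy y =
      d 0 0 xm t - d 0 0 xm s - (t - s) * bilinDyMid x₀ x₁ y₀ y₁ (d 0 0) := by
    intro s hs t ht
    have hci := Continuous.curry_left (hd.cont 0 1 (by omega)) xm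
    simp only [hwy]
    rw [intervalIntegral.integral_sub (hci.intervalIntegrable _ _) (by simp),
      intervalIntegral.integral_eq_sub_of_hasDerivAt (f := d 0 0 xm) (fun z hz => ?_)
        (hci.intervalIntegrable _ _)]
    · simp
    · exact hd.dy 0 0 (by omega) xm hxm z (uIcc_subset_Icc hs ht hz)
  have hyl : y₀ ∈ Icc y₀ y₁ := left_mem_Icc.2 hy.le
  have hyr : y₁ ∈ Icc y₀ y₁ := right_mem_Icc.2 hy.le
  set P := d 0 0 xm y₁ - d 0 0 xm y₀ -
      ((d 0 0 x₀ y₁ - d 0 0 x₀ y₀) + (d 0 0 x₁ y₁ - d 0 0 x₁ y₀)) / 2 with hP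
  have hPle : |P| ≤ H * S := (hd.mid_increment_le hx.le hy.le).trans (by gcongr)
  set q : ℝ → ℝ := fun x => secondDiff y₀ y₁ (d 0 0 x) with hq
  -- For half integrals `p₀` and `p₁`, `D₀ p₀ + D₁ p₁ = (D₀ + D₁)/2 (p₀ + p₁) + (D₁ - D₀)/2 (p₁ -
  -- p₀)`. The sum is the increment error `P`. In the difference the constant slope of the
  -- interpolant cancels, which leaves the second difference of `u` on the mid line.
  have hfrozen : D₀ * (∫ y in y₀..ym, wy y) + D₁ * (∫ y in ym..y₁, wy y) =
      (D₀ + D₁) / 2 * P + (W₁ - W₀) / 2 * q xm := by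
    rw [hFTC _ hyl _ hym, hFTC _ hym _ hyr, ← hDW]
    simp only [hq, secondDiff, hP, bilinDyMid, ← hymdef]
    have : ym - y₀ = (y₁ - y₀) / 2 := by rw [hymdef]; ring
    have h' : y₁ - ym = (y₁ - y₀) / 2 := by rw [hymdef]; ring
    rw [this, h']
    field_simp
    ring
  have T2 : |c * ((D₀ + D₁) / 2 * P)| ≤ M * (H ^ 2 * N * S) := by
    have e1 : |(D₀ + D₁) / 2| ≤ H * N := by
      rw [abs_div, abs_two]
      linarith [abs_add_le D₀ D₁]
    calc _ = |c| * (|(D₀ + D₁) / 2| * |P|) := by rw [abs_mul, abs_mul]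
      _ ≤ M * ((H * N) * (H * S)) := by
        have := hM₂ _ hxm _ hym
        gcongr
      _ = _ := by ring
  -- The coefficient and the second difference are moved one after the other: the first change is
  -- paid by the Lipschitz constant, the second by `IsJet.secondDiff_sub_le`.
  have T3 : ∀ x ∈ Icc x₀ x₁, |c * q xm - a₂ x ym * q x| ≤
      (L * (2 + 2 * D) + 2 * M) * (H * S) := by
    intro x hxx
    have e : c * q xm - a₂ x ym * q x = (c - a₂ x ym) * q x + c * (q xm - q x) := by ring
    have e1 : |c - a₂ x ym| ≤ L * (x₁ - x₀) := by
      refine (hL _ _ _ _).trans (mul_le_mul_of_nonneg_left ?_ hL0)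
      rw [sub_self, abs_zero, add_zero, abs_le]
      constructor <;> linarith [hxx.1, hxx.2, hxm.1, hxm.2]
    have e2 := hd.length_mul_secondDiff_le hy.le hxx
    have e3 := hd.secondDiff_sub_le hy.le hxm hxx
    have e4 := hM₂ _ hxm _ hym
    have e5 := hh.trans hHD
    rw [e]
    refine (abs_add_le _ _).trans ?_
    rw [abs_mul, abs_mul]
    calc |c - a₂ x ym| * |q x| + |c| * |q xm - q x|
        ≤ L * (x₁ - x₀) * |q x| + M * (2 * (y₁ - y₀) * rectAbs x₀ x₁ y₀ y₁ (d 1 2)) := by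
          gcongr
      _ = L * ((x₁ - x₀) * |q x|) + M * (2 * (y₁ - y₀) * rectAbs x₀ x₁ y₀ y₁ (d 1 2)) := by ring
      _ ≤ L * (2 * H * (S + D * S)) + M * (2 * H * S) := by
          refine add_le_add (mul_le_mul_of_nonneg_left (e2.trans ?_) hL0) ?_ <;> gcongr
      _ = _ := by ring
  -- The frozen term `(W₁ - W₀) / 2 * c * q xm` is split between the two vertical edges, and at each
  -- edge the value on the mid line is compared with the value on that edge.
  have hfinal : vertFlux x₀ x₁ y₀ y₁ D₀ D₁ a₁ a₂ (d 0 0) (d 1 0) (d 0 1) -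
      (edgeTerm y₀ y₁ W₁ a₂ (d 0 0) x₁ - edgeTerm y₀ y₁ W₀ a₂ (d 0 0) x₀) / 2 =
      (D₀ * (∫ y in y₀..ym, r y) + D₁ * ∫ y in ym..y₁, r y) + c * ((D₀ + D₁) / 2 * P) +
        (W₁ / 2 * (c * q xm - a₂ x₁ ym * q x₁) - W₀ / 2 * (c * q xm - a₂ x₀ ym * q x₀)) := by
    simp only [vertFlux, edgeTerm, ← hymdef]
    rw [hsplit, hsplit]
    linear_combination c * hfrozen
  have T4 : ∀ W x, |W| ≤ H * N → x ∈ Icc x₀ x₁ → |W / 2 * (c * q xm - a₂ x ym * q x)| ≤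
      (L * (1 + D) + M) * (H ^ 2 * N * S) := by
    intro W x hW hxx
    rw [abs_mul, abs_div, abs_two]
    calc _ ≤ H * N / 2 * ((L * (2 + 2 * D) + 2 * M) * (H * S)) := by
          have := T3 x hxx
          gcongr
      _ = _ := by ring
  rw [hfinal]
  refine (abs_add_le _ _).trans ((add_le_add ((abs_add_le _ _).trans (add_le_add T1 T2))
    ((abs_sub _ _).trans (add_le_add (T4 W₁ x₁ hW₁ hxr) (T4 W₀ x₀ hW₀ hxl)))).trans (le_of_eq ?_))
  ring

end ElementFlux

/-! ### Mollification of weak derivatives, and contraction of the rectangle. -/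

noncomputable section Mollification

open scoped Convolution
open ContinuousLinearMap (mul lsmul)

/-! ### Partial derivatives of smooth functions -/

lemma hasDerivAt_slice_fst {f : ℝ × ℝ → ℝ} {x y : ℝ} {L : ℝ × ℝ →L[ℝ] ℝ}
    (hf : HasFDerivAt f L (x, y)) : HasDerivAt (fun s => f (s, y)) (L (1, 0)) x :=
  hf.comp_hasDerivAt x ((hasDerivAt_id' x).prodMk (hasDerivAt_const x y))

lemma hasDerivAt_slice_snd {f : ℝ × ℝ → ℝ} {x y : ℝ} {L : ℝ × ℝ →L[ℝ] ℝ}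
    (hf : HasFDerivAt f L (x, y)) : HasDerivAt (fun s => f (x, s)) (L (0, 1)) y :=
  hf.comp_hasDerivAt y ((hasDerivAt_const y x).prodMk (hasDerivAt_id' y))

lemma pdx_eq_fderiv {f : ℝ × ℝ → ℝ} (hf : Differentiable ℝ f) :
    pdx f = fun z => fderiv ℝ f z (1, 0) := by
  funext ⟨x, y⟩
  exact (hasDerivAt_slice_fst (hf (x, y)).hasFDerivAt).deriv

lemma pdy_eq_fderiv {f : ℝ × ℝ → ℝ} (hf : Differentiable ℝ f) :
    pdy f = fun z => fderiv ℝ f z (0, 1) := by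
  funext ⟨x, y⟩
  exact (hasDerivAt_slice_snd (hf (x, y)).hasFDerivAt).deriv

lemma contDiff_fderiv_apply {f : ℝ × ℝ → ℝ} (hf : ContDiff ℝ ((⊤ : ℕ∞) : WithTop ℕ∞) f)
    (e : ℝ × ℝ) : ContDiff ℝ ((⊤ : ℕ∞) : WithTop ℕ∞) fun z => fderiv ℝ f z e :=
  (hf.fderiv_right (m := ((⊤ : ℕ∞) : WithTop ℕ∞)) (by simp)).clm_apply contDiff_const

lemma contDiff_pdx {f : ℝ × ℝ → ℝ} (hf : ContDiff ℝ ((⊤ : ℕ∞) : WithTop ℕ∞) f) :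
    ContDiff ℝ ((⊤ : ℕ∞) : WithTop ℕ∞) (pdx f) := by
  rw [pdx_eq_fderiv (hf.differentiable (by simp))]
  exact contDiff_fderiv_apply hf _

lemma contDiff_pdy {f : ℝ × ℝ → ℝ} (hf : ContDiff ℝ ((⊤ : ℕ∞) : WithTop ℕ∞) f) :
    ContDiff ℝ ((⊤ : ℕ∞) : WithTop ℕ∞) (pdy f) := by
  rw [pdy_eq_fderiv (hf.differentiable (by simp))]
  exact contDiff_fderiv_apply hf _

lemma pdy_pdx_comm {f : ℝ × ℝ → ℝ} (hf : ContDiff ℝ ((⊤ : ℕ∞) : WithTop ℕ∞) f) :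
    pdy (pdx f) = pdx (pdy f) := by
  have hdx := (contDiff_pdx hf).differentiable (by simp)
  have hdy := (contDiff_pdy hf).differentiable (by simp)
  have hd : Differentiable ℝ (fderiv ℝ f) :=
    (hf.fderiv_right (m := ((⊤ : ℕ∞) : WithTop ℕ∞)) (by simp)).differentiable (by simp)
  rw [pdy_eq_fderiv hdx, pdx_eq_fderiv hdy, pdx_eq_fderiv (hf.differentiable (by simp)),
    pdy_eq_fderiv (hf.differentiable (by simp))]
  funext z
  have hs : IsSymmSndFDerivAt ℝ f z :=
    hf.contDiffAt.isSymmSndFDerivAt (by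
    rw [minSmoothness_of_isRCLikeNormedField]
    exact WithTop.coe_le_coe.2 (le_top : (2 : ℕ∞) ≤ ⊤))
  have key : ∀ e e' : ℝ × ℝ,
      fderiv ℝ (fun z => fderiv ℝ f z e) z e' = fderiv ℝ (fderiv ℝ f) z e' e := by
    intro e e'
    rw [fderiv_clm_apply (hd z) (differentiableAt_const e)]
    simp
  rw [key, key]
  exact hs _ _

lemma pdy_iterate_pdx_comm {f : ℝ × ℝ → ℝ} (hf : ContDiff ℝ ((⊤ : ℕ∞) : WithTop ℕ∞) f) (j : ℕ) :
    pdy^[j] (pdx f) = pdx (pdy^[j] f) := by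
  induction j generalizing f with
  | zero => rfl
  | succ j ih =>
    rw [Function.iterate_succ_apply, Function.iterate_succ_apply, pdy_pdx_comm hf,
      ih (contDiff_pdy hf)]

lemma pd_pdx {f : ℝ × ℝ → ℝ} (hf : ContDiff ℝ ((⊤ : ℕ∞) : WithTop ℕ∞) f) (i j : ℕ) :
    pd (i, j) (pdx f) = pd (i + 1, j) f := by
  simp only [pd, pdy_iterate_pdx_comm hf, Function.iterate_succ_apply]

lemma pd_pdy (f : ℝ × ℝ → ℝ) (i j : ℕ) : pd (i, j) (pdy f) = pd (i, j + 1) f := by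
  simp only [pd, Function.iterate_succ_apply]

lemma IsTestFunction.pdx {Ω : Set (ℝ × ℝ)} {φ : ℝ × ℝ → ℝ} (h : IsTestFunction Ω φ) :
    IsTestFunction Ω (pdx φ) := by
  refine ⟨contDiff_pdx h.1, ?_⟩
  rw [pdx_eq_fderiv (h.1.differentiable (by simp))]
  exact ⟨h.2.1.fderiv_apply (𝕜 := ℝ) _, (tsupport_fderiv_apply_subset ℝ _).trans h.2.2⟩

lemma IsTestFunction.pdy {Ω : Set (ℝ × ℝ)} {φ : ℝ × ℝ → ℝ} (h : IsTestFunction Ω φ) :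
    IsTestFunction Ω (pdy φ) := by
  refine ⟨contDiff_pdy h.1, ?_⟩
  rw [pdy_eq_fderiv (h.1.differentiable (by simp))]
  exact ⟨h.2.1.fderiv_apply (𝕜 := ℝ) _, (tsupport_fderiv_apply_subset ℝ _).trans h.2.2⟩

/-- Two weak derivatives of `u` whose orders differ by one are weak derivatives of each other: `∂_x
φ` is tested in the definition for `g`, `φ` in that for `g'`, and the signs leave a single minus.
This one-step form is what differentiating a mollification needs. -/
lemma IsWeakDeriv.integral_pdx {Ω : Set (ℝ × ℝ)} {u g g' : ℝ × ℝ → ℝ} {i j : ℕ}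
    (hg : IsWeakDeriv Ω (i, j) u g) (hg' : IsWeakDeriv Ω (i + 1, j) u g') {φ : ℝ × ℝ → ℝ}
    (hφ : IsTestFunction Ω φ) : ∫ z in Ω, g z * pdx φ z = - ∫ z in Ω, g' z * φ z := by
  have h1 := hg.2.2 _ hφ.pdx
  have h2 := hg'.2.2 _ hφ
  rw [pd_pdx hφ.1, h2] at h1
  simp only at h1
  have h3 : ((-1 : ℝ) ^ (i + j)) * (-1) ^ (i + j) = 1 := by
    rw [← mul_pow]; norm_num
  have e : (-1 : ℝ) ^ (i + 1 + j) = - (-1) ^ (i + j) := by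
    rw [show i + 1 + j = i + j + 1 by ring, pow_succ]; ring
  rw [e] at h1
  linear_combination -(-1) ^ (i + j) * h1 - (∫ z in Ω, g z * FVE.pdx φ z) * h3
    - (∫ z in Ω, g' z * φ z) * h3

lemma IsWeakDeriv.integral_pdy {Ω : Set (ℝ × ℝ)} {u g g' : ℝ × ℝ → ℝ} {i j : ℕ}
    (hg : IsWeakDeriv Ω (i, j) u g) (hg' : IsWeakDeriv Ω (i, j + 1) u g') {φ : ℝ × ℝ → ℝ}
    (hφ : IsTestFunction Ω φ) : ∫ z in Ω, g z * pdy φ z = - ∫ z in Ω, g' z * φ z := by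
  have h1 := hg.2.2 _ hφ.pdy
  have h2 := hg'.2.2 _ hφ
  rw [pd_pdy, h2] at h1
  simp only at h1
  have h3 : ((-1 : ℝ) ^ (i + j)) * (-1) ^ (i + j) = 1 := by
    rw [← mul_pow]; norm_num
  rw [← add_assoc, pow_succ] at h1
  linear_combination -(-1) ^ (i + j) * h1 - (∫ z in Ω, g z * FVE.pdy φ z) * h3
    - (∫ z in Ω, g' z * φ z) * h3

/-! ### Mollification -/

/-- Convolution with the kernel `ρ`. -/
def mollify (ρ f : ℝ × ℝ → ℝ) (x : ℝ × ℝ) : ℝ := ∫ w, f w * ρ (x - w)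

lemma mollify_eq_convolution (ρ f : ℝ × ℝ → ℝ) : mollify ρ f = f ⋆[mul ℝ ℝ, volume] ρ := by
  funext x
  simp [mollify, convolution_def]

lemma mollify_eq_convolution' (ρ f : ℝ × ℝ → ℝ) : mollify ρ f = ρ ⋆[lsmul ℝ ℝ, volume] f := by
  funext x
  rw [convolution_lsmul_swap, mollify]
  simp [mul_comm]

variable {ρ f : ℝ × ℝ → ℝ}

lemma hasFDerivAt_mollify (hρ : ContDiff ℝ 1 ρ) (hc : HasCompactSupport ρ)
    (hf : LocallyIntegrable f volume) (x : ℝ × ℝ) :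
    ∃ L : ℝ × ℝ →L[ℝ] ℝ, HasFDerivAt (mollify ρ f) L x ∧
      ∀ e, L e = ∫ w, f w * fderiv ℝ ρ (x - w) e := by
  refine ⟨(f ⋆[(mul ℝ ℝ).precompR (ℝ × ℝ), volume] fderiv ℝ ρ) x, ?_, fun e => ?_⟩
  · rw [mollify_eq_convolution]
    exact hc.hasFDerivAt_convolution_right (mul ℝ ℝ) hf hρ x
  · rw [convolution_precompR_apply (mul ℝ ℝ) hf (hc.fderiv (𝕜 := ℝ))
      (hρ.continuous_fderiv (by simp))]
    simp [convolution_def]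

lemma continuous_mollify (hρ : ContDiff ℝ 1 ρ) (hc : HasCompactSupport ρ)
    (hf : LocallyIntegrable f volume) : Continuous (mollify ρ f) := by
  refine continuous_iff_continuousAt.2 fun x => ?_
  obtain ⟨L, hL, -⟩ := hasFDerivAt_mollify hρ hc hf x
  exact hL.continuousAt

lemma integrable_mollify (hρ : Integrable ρ) (hf : Integrable f) : Integrable (mollify ρ f) := by
  rw [mollify_eq_convolution]
  exact hf.integrable_convolution _ hρ

lemma integrable_mollify_integrand (hρ : Continuous ρ) (hc : HasCompactSupport ρ)
    (hf : LocallyIntegrable f volume) (x : ℝ × ℝ) : Integrable fun w => f w * ρ (x - w) := by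
  have := hc.convolutionExists_right (mul ℝ ℝ) hf hρ x
  simpa [ConvolutionExistsAt] using this

/-- Since the kernel is nonnegative, the mollification of `f` is dominated by that of `|f|`, whose
integral is `∫ |f|` by Fubini. -/
lemma integral_abs_mollify_le (hρ0 : ∀ x, 0 ≤ ρ x) (hρ1 : ∫ x, ρ x = 1) (hf : Integrable f) :
    ∫ x, |mollify ρ f x| ≤ ∫ x, |f x| := by
  have hρ : Integrable ρ := integrable_of_integral_eq_one hρ1
  have h1 : ∫ x, mollify ρ (fun x => |f x|) x = ∫ x, |f x| := by
    rw [mollify_eq_convolution, integral_convolution (mul ℝ ℝ) hf.abs hρ, hρ1]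
    simp
  rw [← h1]
  refine integral_mono (integrable_mollify hρ hf).abs (integrable_mollify hρ hf.abs) fun x => ?_
  simp only [mollify]
  refine (abs_integral_le_integral_abs).trans (le_of_eq ?_)
  refine integral_congr_ae (Eventually.of_forall fun w => ?_)
  simp [abs_mul, abs_of_nonneg (hρ0 _)]

lemma mollify_sub (hρ : Continuous ρ) (hc : HasCompactSupport ρ) {g : ℝ × ℝ → ℝ}
    (hf : LocallyIntegrable f volume) (hg : LocallyIntegrable g volume) (x : ℝ × ℝ) :
    mollify ρ (fun w => f w - g w) x = mollify ρ f x - mollify ρ g x := by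
  simp only [mollify, sub_mul]
  exact integral_sub (integrable_mollify_integrand hρ hc hf x)
    (integrable_mollify_integrand hρ hc hg x)

lemma abs_mollify_sub_le {R δ c : ℝ} {x : ℝ × ℝ} (hδ : 0 ≤ δ)
    (hsupp : Function.support ρ ⊆ Metric.ball 0 R) (hρ0 : ∀ x, 0 ≤ ρ x) (hρ1 : ∫ x, ρ x = 1)
    (hf : AEStronglyMeasurable f volume) (h : ∀ w ∈ Metric.ball x R, |f w - c| ≤ δ) :
    |mollify ρ f x - c| ≤ δ := by
  rw [mollify_eq_convolution']
  exact dist_convolution_le hδ hsupp hρ0 hρ1 hf h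

lemma abs_mollify_le (hρ0 : ∀ x, 0 ≤ ρ x) (hρ1 : ∫ x, ρ x = 1) {B : ℝ}
    (hf : ∀ᵐ w, |f w| ≤ B) (x : ℝ × ℝ) : |mollify ρ f x| ≤ B := by
  have hρ : Integrable ρ := integrable_of_integral_eq_one hρ1
  have h1 : ∫ w, B * ρ (x - w) = B := by
    rw [integral_const_mul, integral_sub_left_eq_self (fun w => ρ w) volume x, hρ1, mul_one]
  rw [← h1, mollify, ← Real.norm_eq_abs]
  refine norm_integral_le_of_norm_le ((hρ.comp_sub_left x).const_mul B) ?_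
  filter_upwards [hf] with w hw
  rw [Real.norm_eq_abs, abs_mul, abs_of_nonneg (hρ0 _)]
  exact mul_le_mul_of_nonneg_right hw (hρ0 _)

/-! ### Contraction of the rectangle -/

variable {a b c d : ℝ}

/-- The contraction by the factor `t` about the centre of `(a, b) × (c, d)`. -/
def contraction (a b c d t : ℝ) (z : ℝ × ℝ) : ℝ × ℝ :=
  ((a + b) / 2 + t * (z.1 - (a + b) / 2), (c + d) / 2 + t * (z.2 - (c + d) / 2))

lemma isOpen_rect : IsOpen (rect a b c d) := isOpen_Ioo.prod isOpen_Ioo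

lemma measurableSet_rect : MeasurableSet (rect a b c d) := isOpen_rect.measurableSet

lemma closure_rect (hab : a < b) (hcd : c < d) :
    closure (rect a b c d) = Icc a b ×ˢ Icc c d := by
  rw [rect, closure_prod_eq, closure_Ioo hab.ne, closure_Ioo hcd.ne]

lemma volume_rect_lt_top : volume (rect a b c d) < ∞ :=
  ((Metric.isBounded_Ioo a b).prod (Metric.isBounded_Ioo c d)).measure_lt_top

/-- The contraction moves each point of the closed rectangle to a distance of at least `s` times
half a side from that side, and this exceeds `s * r`. A kernel of radius `s * r` thus never sees the
outside, even when `z` is on the boundary. -/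
lemma closedBall_contraction_subset {s : ℝ} (hs : 0 < s) (hs1 : s ≤ 1) {r : ℝ} 
    (hr1 : r < (b - a) / 2) (hr2 : r < (d - c) / 2) {z : ℝ × ℝ} (hz : z ∈ Icc a b ×ˢ Icc c d) :
    Metric.closedBall (contraction a b c d (1 - s) z) (s * r) ⊆ rect a b c d := by
  rintro ⟨x, y⟩ hw
  rw [Metric.mem_closedBall, Prod.dist_eq, max_le_iff, Real.dist_eq, Real.dist_eq, abs_le, abs_le]
    at hw
  simp only [contraction] at hw
  obtain ⟨⟨h1, h2⟩, h3, h4⟩ := hw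
  obtain ⟨⟨h5, h6⟩, h7, h8⟩ := hz
  have hs1' : 0 ≤ 1 - s := by linarith
  refine ⟨⟨?_, ?_⟩, ?_, ?_⟩ <;> simp only <;> nlinarith

lemma dist_contraction_le {s : ℝ} (hs : 0 ≤ s) {z : ℝ × ℝ} (hz : z ∈ Icc a b ×ˢ Icc c d) :
    dist (contraction a b c d (1 - s) z) z ≤ s * ((b - a) + (d - c)) := by
  obtain ⟨⟨h5, h6⟩, h7, h8⟩ := hz
  rw [Prod.dist_eq, max_le_iff, Real.dist_eq, Real.dist_eq, abs_le, abs_le]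
  simp only [contraction]
  refine ⟨⟨?_, ?_⟩, ?_, ?_⟩ <;> nlinarith

lemma integral_comp_contraction (F : ℝ × ℝ → ℝ) {t : ℝ} (ht : 0 < t) :
    ∫ z, F (contraction a b c d t z) = (t ^ 2)⁻¹ * ∫ z, F z := by
  set p : ℝ × ℝ := ((a + b) / 2 - t * ((a + b) / 2), (c + d) / 2 - t * ((c + d) / 2)) with hp
  have e : ∀ z, contraction a b c d t z = p + t • z := by
    intro z
    ext <;> simp [contraction, hp] <;> ring
  simp only [e]
  have h1 := Measure.integral_comp_smul_of_nonneg (volume : Measure (ℝ × ℝ))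
    (fun z => F (p + z)) t (hR := ht.le)
  rw [h1, integral_add_left_eq_self]
  simp [Module.finrank_prod]

lemma integrable_comp_contraction {F : ℝ × ℝ → ℝ} (hF : Integrable F) {t : ℝ} (ht : t ≠ 0) :
    Integrable fun z => F (contraction a b c d t z) := by
  set p : ℝ × ℝ := ((a + b) / 2 - t * ((a + b) / 2), (c + d) / 2 - t * ((c + d) / 2)) with hp
  have e : ∀ z, contraction a b c d t z = p + t • z := by
    intro z
    ext <;> simp [contraction, hp] <;> ring
  simp only [e]
  exact (hF.comp_add_left p).comp_smul ht

end Mollification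

/-! ### Approximation by smooth functions up to the boundary. -/

noncomputable section Approximation

/-- Smooth averaging kernels supported in the ball of radius `ε`. -/
structure IsKernel (ε : ℝ) (ρ : ℝ × ℝ → ℝ) : Prop where
  contDiff : ContDiff ℝ ((⊤ : ℕ∞) : WithTop ℕ∞) ρ
  hasCompactSupport : HasCompactSupport ρ
  support_subset : Function.support ρ ⊆ Metric.ball 0 ε
  nonneg : ∀ x, 0 ≤ ρ x
  integral_eq_one : ∫ x, ρ x = 1

lemma exists_isKernel {ε : ℝ} (hε : 0 < ε) : ∃ ρ, IsKernel ε ρ := by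
  let φ : ContDiffBump (0 : ℝ × ℝ) := ⟨ε / 2, ε, by positivity, by linarith⟩
  exact ⟨φ.normed volume, φ.contDiff_normed, φ.hasCompactSupport_normed,
    (φ.support_normed_eq (μ := volume)).subset, φ.nonneg_normed, φ.integral_normed⟩

lemma IsKernel.contDiff_one {ε : ℝ} {ρ : ℝ × ℝ → ℝ} (h : IsKernel ε ρ) : ContDiff ℝ 1 ρ :=
  h.contDiff.of_le (WithTop.coe_le_coe.2 (le_top : (1 : ℕ∞) ≤ ⊤))

lemma IsKernel.isTestFunction {ε : ℝ} {ρ : ℝ × ℝ → ℝ} (h : IsKernel ε ρ) {Ω : Set (ℝ × ℝ)}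
    {p : ℝ × ℝ} (hp : Metric.closedBall p ε ⊆ Ω) : IsTestFunction Ω fun w => ρ (p - w) := by
  refine ⟨h.contDiff.comp (contDiff_const.sub contDiff_id), ?_, ?_⟩
  · exact h.hasCompactSupport.comp_homeomorph (Homeomorph.subLeft p)
  · refine (closure_minimal (fun w hw => ?_) Metric.isClosed_closedBall).trans hp
    have := h.support_subset (show p - w ∈ Function.support ρ from hw)
    rw [mem_ball_zero_iff, ← dist_eq_norm, dist_comm] at this
    exact this.le

lemma IsKernel.pdx_comp_sub {ε : ℝ} {ρ : ℝ × ℝ → ℝ} (h : IsKernel ε ρ) (p w : ℝ × ℝ) :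
    pdx (fun w => ρ (p - w)) w = - fderiv ℝ ρ (p - w) (1, 0) := by
  have hd : Differentiable ℝ ρ := h.contDiff.differentiable (by simp)
  have hd' : Differentiable ℝ fun w => ρ (p - w) := hd.comp (differentiable_const p |>.sub
    differentiable_id)
  have e : fderiv ℝ (fun w => ρ (p - w)) w = _ :=
    ((hd (p - w)).hasFDerivAt.comp w ((hasFDerivAt_id w).const_sub p)).fderiv
  simp only [pdx_eq_fderiv hd', e]
  simp

lemma IsKernel.pdy_comp_sub {ε : ℝ} {ρ : ℝ × ℝ → ℝ} (h : IsKernel ε ρ) (p w : ℝ × ℝ) :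
    pdy (fun w => ρ (p - w)) w = - fderiv ℝ ρ (p - w) (0, 1) := by
  have hd : Differentiable ℝ ρ := h.contDiff.differentiable (by simp)
  have hd' : Differentiable ℝ fun w => ρ (p - w) := hd.comp (differentiable_const p |>.sub
    differentiable_id)
  have e : fderiv ℝ (fun w => ρ (p - w)) w = _ :=
    ((hd (p - w)).hasFDerivAt.comp w ((hasFDerivAt_id w).const_sub p)).fderiv
  simp only [pdy_eq_fderiv hd', e]
  simp

lemma mollify_indicator {Ω : Set (ℝ × ℝ)} (hΩ : MeasurableSet Ω) (ρ g : ℝ × ℝ → ℝ) (p : ℝ × ℝ) :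
    mollify ρ (Ω.indicator g) p = ∫ w in Ω, g w * ρ (p - w) := by
  rw [mollify, ← integral_indicator hΩ]
  refine integral_congr_ae (Eventually.of_forall fun w => ?_)
  by_cases hw : w ∈ Ω <;> simp [hw]

/-- When the `ε`-ball at `p` lies in `Ω`, the reflected kernel `w ↦ ρ (p - w)` is a test function.
Its derivative carries a minus sign that cancels the one in the weak derivative, so differentiation
passes from the kernel to `g`; the extension by zero plays no role. -/
lemma exists_fderiv_mollify_indicator {ε : ℝ} {ρ : ℝ × ℝ → ℝ} (h : IsKernel ε ρ)
    {Ω : Set (ℝ × ℝ)} (hΩ : MeasurableSet Ω) {p : ℝ × ℝ} (hp : Metric.closedBall p ε ⊆ Ω)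
    {u g gx gy : ℝ × ℝ → ℝ} {i j : ℕ} (hgi : IntegrableOn g Ω) (hg : IsWeakDeriv Ω (i, j) u g)
    (hgx : IsWeakDeriv Ω (i + 1, j) u gx) (hgy : IsWeakDeriv Ω (i, j + 1) u gy) :
    ∃ L : ℝ × ℝ →L[ℝ] ℝ, HasFDerivAt (mollify ρ (Ω.indicator g)) L p ∧
      L (1, 0) = mollify ρ (Ω.indicator gx) p ∧ L (0, 1) = mollify ρ (Ω.indicator gy) p := by
  obtain ⟨L, hL, hLe⟩ := hasFDerivAt_mollify h.contDiff_one h.hasCompactSupport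
    (hgi.integrable_indicator hΩ).locallyIntegrable p
  have key : ∀ e, L e = ∫ w in Ω, g w * fderiv ℝ ρ (p - w) e := by
    intro e
    rw [hLe, ← integral_indicator hΩ]
    refine integral_congr_ae (Eventually.of_forall fun w => ?_)
    by_cases hw : w ∈ Ω <;> simp [hw]
  refine ⟨L, hL, ?_, ?_⟩
  · have := hg.integral_pdx hgx (h.isTestFunction hp)
    simp only [h.pdx_comp_sub, mul_neg, integral_neg, neg_inj] at this
    rw [key, this, mollify_indicator hΩ]
  · have := hg.integral_pdy hgy (h.isTestFunction hp)
    simp only [h.pdy_comp_sub, mul_neg, integral_neg, neg_inj] at this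
    rw [key, this, mollify_indicator hΩ]

variable {a b c d : ℝ}

/-- Contracted mollification of order `(i, j)` derivative data. -/
def approxDeriv (a b c d t : ℝ) (ρ : ℝ × ℝ → ℝ) (g : ℕ → ℕ → ℝ × ℝ → ℝ) (i j : ℕ) (x y : ℝ) : ℝ :=
  t ^ (i + j) * mollify ρ ((rect a b c d).indicator (g i j)) (contraction a b c d t (x, y))

lemma continuous_contraction (a b c d t : ℝ) : Continuous (contraction a b c d t) := by
  unfold contraction
  fun_prop

/-- The factor `t ^ (i + j)` in `approxDeriv` is the chain rule factor of the contraction; with it,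
data of consecutive orders are derivatives of each other on the closed rectangle. -/
lemma isJet_approxDeriv {m : ℕ} {s r : ℝ} (hs : 0 < s) (hs1 : s ≤ 1) (hr1 : r < (b - a) / 2)
    (hr2 : r < (d - c) / 2) {ρ : ℝ × ℝ → ℝ} (h : IsKernel (s * r) ρ) {u : ℝ × ℝ → ℝ}
    {g : ℕ → ℕ → ℝ × ℝ → ℝ}
    (hg : ∀ i j, i + j ≤ m → IsWeakDeriv (rect a b c d) (i, j) u (g i j))
    (hgi : ∀ i j, i + j ≤ m → IntegrableOn (g i j) (rect a b c d)) :
    IsJet m a b c d (approxDeriv a b c d (1 - s) ρ g) where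
  cont i j hij := by
    have := continuous_mollify h.contDiff_one h.hasCompactSupport
      ((hgi i j hij).integrable_indicator measurableSet_rect).locallyIntegrable
    exact continuous_const.mul (this.comp (continuous_contraction a b c d (1 - s)))
  dx i j hij x hx y hy := by
    obtain ⟨L, hL, hLx, -⟩ := exists_fderiv_mollify_indicator h measurableSet_rect
      (closedBall_contraction_subset hs hs1 hr1 hr2 (z := (x, y)) ⟨hx, hy⟩)
      (hgi i j (by omega)) (hg i j (by omega)) (hg (i + 1) j (by omega))
      (hg i (j + 1) (by omega))
    have hcurve : HasDerivAt (fun x => contraction a b c d (1 - s) (x, y)) (1 - s, 0) x := by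
      have h1 : HasDerivAt (fun x => (a + b) / 2 + (1 - s) * (x - (a + b) / 2)) (1 - s) x := by
        simpa using ((((hasDerivAt_id' x).sub_const ((a + b) / 2)).const_mul (1 - s)).const_add
          ((a + b) / 2))
      exact h1.prodMk (hasDerivAt_const x ((c + d) / 2 + (1 - s) * (y - (c + d) / 2)))
    have := (hL.comp_hasDerivAt x hcurve).const_mul ((1 - s) ^ (i + j))
    refine this.congr_deriv ?_
    have e : ((1 - s, 0) : ℝ × ℝ) = (1 - s) • ((1, 0) : ℝ × ℝ) := by simp
    rw [e, map_smul, hLx, approxDeriv]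
    simp only [smul_eq_mul]
    ring
  dy i j hij x hx y hy := by
    obtain ⟨L, hL, -, hLy⟩ := exists_fderiv_mollify_indicator h measurableSet_rect
      (closedBall_contraction_subset hs hs1 hr1 hr2 (z := (x, y)) ⟨hx, hy⟩)
      (hgi i j (by omega)) (hg i j (by omega)) (hg (i + 1) j (by omega))
      (hg i (j + 1) (by omega))
    have hcurve : HasDerivAt (fun y => contraction a b c d (1 - s) (x, y)) (0, 1 - s) y := by
      have h1 : HasDerivAt (fun y => (c + d) / 2 + (1 - s) * (y - (c + d) / 2)) (1 - s) y := by
        simpa using ((((hasDerivAt_id' y).sub_const ((c + d) / 2)).const_mul (1 - s)).const_add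
          ((c + d) / 2))
      exact (hasDerivAt_const y ((a + b) / 2 + (1 - s) * (x - (a + b) / 2))).prodMk h1
    have := (hL.comp_hasDerivAt y hcurve).const_mul ((1 - s) ^ (i + j))
    refine this.congr_deriv ?_
    have e : ((0, 1 - s) : ℝ × ℝ) = (1 - s) • ((0, 1) : ℝ × ℝ) := by simp
    rw [e, map_smul, hLy, approxDeriv]
    simp only [smul_eq_mul]
    ring

/-- Contracted mollifications converge in `L¹`. -/
lemma tendsto_integral_abs_mollify_contraction_sub {s : ℕ → ℝ} {r : ℝ} (hr : 0 ≤ r)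
    (hs : ∀ n, 0 < s n) (hs1 : ∀ n, s n ≤ 1 / 2) (hlim : Tendsto s atTop (𝓝 0))
    {ρ : ℕ → ℝ × ℝ → ℝ} (hρ : ∀ n, IsKernel (s n * r) (ρ n)) {f : ℝ × ℝ → ℝ}
    (hf : Integrable f) :
    Tendsto (fun n => ∫ z in rect a b c d,
      |mollify (ρ n) f (contraction a b c d (1 - s n) z) - f z|) atTop (𝓝 0) := by
  set Ω := rect a b c d with hΩ
  have hΩfin : volume Ω ≠ ∞ := volume_rect_lt_top.ne
  set V := volume.real Ω with hV
  have hV0 : 0 ≤ V := measureReal_nonneg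
  rw [Metric.tendsto_atTop]
  intro δ hδ
  -- `f` is replaced by a uniformly continuous `g`. The Jacobian of the contraction is at most `4`
  -- because `s n ≤ 1/2`, so the three errors are at most `4 δ/12`, `δ/4` and `δ/12`, with sum `2δ/3
  -- < δ`.
  obtain ⟨g, hgc, hgi, hgcont, hgint⟩ := hf.exists_hasCompactSupport_integral_sub_le
    (show 0 < δ / 12 by positivity)
  have huc : UniformContinuous g := hgc.uniformContinuous_of_continuous hgcont
  rw [Metric.uniformContinuous_iff] at huc
  obtain ⟨η, hη, huc⟩ := huc (δ / (4 * (V + 1))) (by positivity)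
  set D := |b - a| + |d - c| + r with hD
  have hD0 : 0 ≤ D := by positivity
  have hev : ∀ᶠ n in atTop, s n * D < η := by
    have : Tendsto (fun n => s n * D) atTop (𝓝 0) := by simpa using hlim.mul_const D
    exact this.eventually_lt_const hη
  obtain ⟨N, hN⟩ := eventually_atTop.1 hev
  refine ⟨N, fun n hn => ?_⟩
  have hn := hN n hn
  have ht0 : 0 < 1 - s n := by linarith [hs1 n]
  set T := contraction a b c d (1 - s n) with hT
  have hρ' := hρ n
  have hρi : Integrable (ρ n) := integrable_of_integral_eq_one hρ'.integral_eq_one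
  -- the three error terms
  have hcont : ∀ {k : ℝ × ℝ → ℝ}, Integrable k → Integrable fun z => mollify (ρ n) k (T z) :=
    fun hk => integrable_comp_contraction (integrable_mollify hρi hk) ht0.ne'
  have hfg : Integrable fun w => f w - g w := hf.sub hgint
  have e1 : ∫ z in Ω, |mollify (ρ n) (fun w => f w - g w) (T z)| ≤ 4 * (δ / 12) := by
    calc _ ≤ ∫ z, |mollify (ρ n) (fun w => f w - g w) (T z)| :=
          setIntegral_le_integral (hcont hfg).abs (Eventually.of_forall fun _ => abs_nonneg _)
      _ = ((1 - s n) ^ 2)⁻¹ * ∫ z, |mollify (ρ n) (fun w => f w - g w) z| :=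
          integral_comp_contraction (fun z => |mollify (ρ n) (fun w => f w - g w) z|) ht0
      _ ≤ 4 * (δ / 12) := by
          have h1 : ((1 - s n) ^ 2)⁻¹ ≤ 4 := by
            rw [inv_le_comm₀ (by positivity) (by norm_num)]
            nlinarith [hs1 n]
          have h2 := (integral_abs_mollify_le hρ'.nonneg hρ'.integral_eq_one hfg).trans hgi
          gcongr
  have e2 : ∫ z in Ω, |mollify (ρ n) g (T z) - g z| ≤ V * (δ / (4 * (V + 1))) := by
    have : ∀ z ∈ Ω, ‖|mollify (ρ n) g (T z) - g z|‖ ≤ δ / (4 * (V + 1)) := by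
      intro z hz
      rw [Real.norm_eq_abs, abs_abs]
      refine abs_mollify_sub_le (by positivity) hρ'.support_subset hρ'.nonneg
        hρ'.integral_eq_one hgcont.aestronglyMeasurable fun w hw => ?_
      refine (huc ?_).le
      have h1 := dist_contraction_le (hs n).le
        (show z ∈ Icc a b ×ˢ Icc c d from ⟨Ioo_subset_Icc_self hz.1, Ioo_subset_Icc_self hz.2⟩)
      have h2 := dist_triangle w (T z) z
      rw [Metric.mem_ball] at hw
      have h3 : s n * (b - a + (d - c)) ≤ s n * (|b - a| + |d - c|) := by
        have := (hs n).le
        gcongr <;> exact le_abs_self _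
      have : s n * D = s n * (|b - a| + |d - c|) + s n * r := by rw [hD]; ring
      linarith
    have h := norm_setIntegral_le_of_norm_le_const hΩfin.lt_top this
    rw [mul_comm]
    exact (le_abs_self _).trans h
  have e3 : ∫ z in Ω, |f z - g z| ≤ δ / 12 :=
    (setIntegral_le_integral hfg.abs (Eventually.of_forall fun _ => abs_nonneg _)).trans hgi
  have hsum : ∫ z in Ω, |mollify (ρ n) f (T z) - f z| ≤
      ∫ z in Ω, (|mollify (ρ n) (fun w => f w - g w) (T z)| + |mollify (ρ n) g (T z) - g z| +
        |f z - g z|) := by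
    refine integral_mono ((hcont hf).sub hf).abs.integrableOn
      (((hcont hfg).abs.add ((hcont hgint).sub hgint).abs).add hfg.abs).integrableOn fun z => ?_
    simp only
    rw [mollify_sub hρ'.contDiff.continuous hρ'.hasCompactSupport hf.locallyIntegrable
      hgint.locallyIntegrable]
    have h1 := abs_add_three (mollify (ρ n) f (T z) - mollify (ρ n) g (T z))
      (mollify (ρ n) g (T z) - g z) (g z - f z)
    rw [abs_sub_comm (f z)]
    refine le_trans (le_of_eq ?_) h1
    congr 1; ring
  have i1 : IntegrableOn (fun z => |mollify (ρ n) (fun w => f w - g w) (T z)|) Ω :=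
    (hcont hfg).abs.integrableOn
  have i2 : IntegrableOn (fun z => |mollify (ρ n) g (T z) - g z|) Ω :=
    ((hcont hgint).sub hgint).abs.integrableOn
  rw [integral_add (i1.fun_add i2) hfg.abs.integrableOn, integral_add i1 i2] at hsum
  have e4 : V * (δ / (4 * (V + 1))) ≤ δ / 4 := by
    rw [mul_div_assoc', div_le_div_iff₀ (by positivity) (by positivity)]
    nlinarith
  rw [Real.dist_eq, sub_zero, abs_of_nonneg (integral_nonneg fun _ => abs_nonneg _)]
  linarith

/-- Smooth approximation, up to the boundary, of a function with weak derivatives in `L¹`. -/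
theorem exists_jet_approx (hab : a < b) (hcd : c < d) {m : ℕ} {u : ℝ × ℝ → ℝ}
    {g : ℕ → ℕ → ℝ × ℝ → ℝ}
    (hg : ∀ i j, i + j ≤ m → IsWeakDeriv (rect a b c d) (i, j) u (g i j))
    (hgi : ∀ i j, i + j ≤ m → IntegrableOn (g i j) (rect a b c d)) :
    ∃ D : ℕ → ℕ → ℕ → ℝ → ℝ → ℝ, (∀ n, IsJet m a b c d (D n)) ∧
      (∀ i j, i + j ≤ m →
        Tendsto (fun n => ∫ z in rect a b c d, |D n i j z.1 z.2 - g i j z|) atTop (𝓝 0)) ∧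
      (∀ i j B, 0 ≤ B → (∀ᵐ z ∂(volume.restrict (rect a b c d)), |g i j z| ≤ B) →
        ∀ n x y, |D n i j x y| ≤ B) ∧
      (ContinuousOn (g 0 0) (rect a b c d) → ∀ z ∈ rect a b c d,
        Tendsto (fun n => D n 0 0 z.1 z.2) atTop (𝓝 (g 0 0 z))) ∧
      (ContinuousOn (g 0 0) (closure (rect a b c d)) →
        TendstoUniformlyOn (fun n z => D n 0 0 z.1 z.2) (g 0 0) atTop
          (closure (rect a b c d))) := by
  set Ω := rect a b c d with hΩ
  -- A quarter of the shorter side, so that `r` is strictly smaller than both half sides.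
  set r := min ((b - a) / 2) ((d - c) / 2) / 2 with hr
  have hm0 : 0 < min ((b - a) / 2) ((d - c) / 2) := lt_min (by linarith) (by linarith)
  have hr0 : 0 < r := by positivity
  have hr1 : r < (b - a) / 2 := (half_lt_self hm0).trans_le (min_le_left _ _)
  have hr2 : r < (d - c) / 2 := (half_lt_self hm0).trans_le (min_le_right _ _)
  -- The shift by `2` keeps the contraction factor `1 - s n` at or above `1/2`.
  set s : ℕ → ℝ := fun n => 1 / ((n : ℝ) + 2) with hs
  have hs0 : ∀ n, 0 < s n := fun n => by positivity
  have hs1 : ∀ n, s n ≤ 1 / 2 := fun n =>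
    one_div_le_one_div_of_le (by norm_num) (by linarith [n.cast_nonneg (α := ℝ)])
  have hslim : Tendsto s atTop (𝓝 0) := by
    have h1 : Tendsto (fun n : ℕ => (n : ℝ) + 2) atTop atTop :=
      tendsto_atTop_add_const_right _ _ tendsto_natCast_atTop_atTop
    refine h1.inv_tendsto_atTop.congr fun n => ?_
    simp [hs]
  choose ρ hρ using fun n => exists_isKernel (mul_pos (hs0 n) hr0)
  have hint : ∀ i j, i + j ≤ m → Integrable (Ω.indicator (g i j)) := fun i j hij =>
    (hgi i j hij).integrable_indicator measurableSet_rect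
  have hball : ∀ n, ∀ z ∈ Icc a b ×ˢ Icc c d,
      Metric.closedBall (contraction a b c d (1 - s n) z) (s n * r) ⊆ Ω := fun n z hz =>
    closedBall_contraction_subset (hs0 n) (by linarith [hs1 n]) hr1 hr2 hz
  have hdist : ∀ n, ∀ z ∈ Icc a b ×ˢ Icc c d,
      ∀ w ∈ Metric.ball (contraction a b c d (1 - s n) z) (s n * r),
        dist w z < s n * (b - a + (d - c) + r) := by
    intro n z hz w hw
    have h1 := dist_contraction_le (hs0 n).le hz
    have h2 := dist_triangle w (contraction a b c d (1 - s n) z) z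
    rw [Metric.mem_ball] at hw
    linarith
  have hevent : ∀ η > 0, ∀ᶠ n in atTop, s n * (b - a + (d - c) + r) < η := by
    intro η hη
    have : Tendsto (fun n => s n * (b - a + (d - c) + r)) atTop (𝓝 0) := by
      simpa using hslim.mul_const (b - a + (d - c) + r)
    exact this.eventually_lt_const hη
  refine ⟨fun n => approxDeriv a b c d (1 - s n) (ρ n) g, fun n => ?_, fun i j hij => ?_,
    fun i j B hB hgB n x y => ?_, fun hc z hz => ?_, fun hc => ?_⟩
  · exact isJet_approxDeriv (hs0 n) (by linarith [hs1 n]) hr1 hr2 (hρ n) hg hgi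
  · have h1 := tendsto_integral_abs_mollify_contraction_sub (a := a) (b := b) (c := c) (d := d)
      hr0.le hs0 hs1 hslim hρ (hint i j hij)
    -- The chain rule factor is not `1` but tends to `1`; its defect multiplies the fixed L¹ norm of
    -- `g i j`.
    have h2 : Tendsto (fun n => |(1 - s n) ^ (i + j) - 1| * ∫ z in Ω, |g i j z|) atTop (𝓝 0) := by
      have : Tendsto (fun n => |(1 - s n) ^ (i + j) - 1|) atTop (𝓝 |(1 - 0) ^ (i + j) - 1|) :=
        (((hslim.const_sub 1).pow (i + j)).sub_const 1).abs
      simpa using this.mul_const (∫ z in Ω, |g i j z|)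
    refine squeeze_zero (fun n => integral_nonneg fun _ => abs_nonneg _) (fun n => ?_)
      (by simpa using h1.add h2)
    have ht0 : 0 < 1 - s n := by linarith [hs1 n]
    have hρi : Integrable (ρ n) := integrable_of_integral_eq_one (hρ n).integral_eq_one
    have hM : Integrable fun z => mollify (ρ n) (Ω.indicator (g i j))
        (contraction a b c d (1 - s n) z) :=
      integrable_comp_contraction (integrable_mollify hρi (hint i j hij)) ht0.ne'
    have i1 : IntegrableOn (fun z => |mollify (ρ n) (Ω.indicator (g i j))
        (contraction a b c d (1 - s n) z) - Ω.indicator (g i j) z|) Ω :=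
      (hM.sub (hint i j hij)).abs.integrableOn
    have i2 : IntegrableOn (fun z => |(1 - s n) ^ (i + j) - 1| * |g i j z|) Ω :=
      (hgi i j hij).abs.const_mul _
    rw [← integral_const_mul, ← integral_add i1 i2]
    refine setIntegral_mono_on ?_ ?_ measurableSet_rect fun z hz => ?_
    · exact ((hM.const_mul _).integrableOn.sub (hgi i j hij)).abs
    · exact i1.fun_add i2
    · simp only [approxDeriv, ← hΩ, indicator_of_mem hz, Prod.mk.eta]
      set M := mollify (ρ n) (Ω.indicator (g i j)) (contraction a b c d (1 - s n) z)
      have e : (1 - s n) ^ (i + j) * M - g i j z =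
          (1 - s n) ^ (i + j) * (M - g i j z) + ((1 - s n) ^ (i + j) - 1) * g i j z := by ring
      rw [e]
      refine (abs_add_le _ _).trans ?_
      rw [abs_mul, abs_mul, abs_of_nonneg (pow_nonneg ht0.le _)]
      gcongr
      exact mul_le_of_le_one_left (abs_nonneg _)
        (pow_le_one₀ ht0.le (by linarith [hs0 n]))
  · have ht0 : 0 < 1 - s n := by linarith [hs1 n]
    have h1 : ∀ᵐ w, |Ω.indicator (g i j) w| ≤ B := by
      have := (ae_restrict_iff' (measurableSet_rect (a := a) (b := b) (c := c) (d := d))).1 hgB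
      filter_upwards [this] with w hw
      by_cases h : w ∈ Ω
      · simpa [h] using hw h
      · simpa [h] using hB
    have h2 := abs_mollify_le (hρ n).nonneg (hρ n).integral_eq_one h1
      (contraction a b c d (1 - s n) (x, y))
    simp only [approxDeriv]
    rw [abs_mul, abs_of_nonneg (pow_nonneg ht0.le _)]
    exact (mul_le_of_le_one_left (abs_nonneg _)
        (pow_le_one₀ ht0.le (by linarith [hs0 n]))).trans h2
  · have hz' : z ∈ Icc a b ×ˢ Icc c d :=
      ⟨Ioo_subset_Icc_self hz.1, Ioo_subset_Icc_self hz.2⟩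
    rw [Metric.tendsto_atTop]
    intro δ hδ
    have h1 := (hc.continuousAt (isOpen_rect.mem_nhds hz))
    rw [Metric.continuousAt_iff] at h1
    obtain ⟨η, hη, h1⟩ := h1 (δ / 2) (by positivity)
    obtain ⟨N, hN⟩ := eventually_atTop.1 (hevent η hη)
    refine ⟨N, fun n hn => ?_⟩
    simp only [approxDeriv, add_zero, pow_zero, one_mul, Prod.mk.eta]
    refine lt_of_le_of_lt ?_ (half_lt_self hδ)
    refine abs_mollify_sub_le (by positivity) (hρ n).support_subset (hρ n).nonneg
      (hρ n).integral_eq_one (hint 0 0 (by omega)).aestronglyMeasurable fun w hw => ?_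
    rw [indicator_of_mem (hball n z hz' (Metric.ball_subset_closedBall hw))]
    exact (h1 ((hdist n z hz' w hw).trans (hN n hn))).le
  · have hcl : closure Ω = Icc a b ×ˢ Icc c d := closure_rect hab hcd
    rw [hcl] at hc ⊢
    have huc := (isCompact_Icc.prod isCompact_Icc).uniformContinuousOn_of_continuous hc
    rw [Metric.uniformContinuousOn_iff] at huc
    rw [Metric.tendstoUniformlyOn_iff]
    intro δ hδ
    obtain ⟨η, hη, h1⟩ := huc (δ / 2) (by positivity)
    filter_upwards [hevent η hη] with n hn z hz
    simp only [approxDeriv, add_zero, pow_zero, one_mul, Prod.mk.eta]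
    rw [dist_comm]
    refine lt_of_le_of_lt ?_ (half_lt_self hδ)
    refine abs_mollify_sub_le (by positivity) (hρ n).support_subset (hρ n).nonneg
      (hρ n).integral_eq_one (hint 0 0 (by omega)).aestronglyMeasurable fun w hw => ?_
    have hwΩ := hball n z hz (Metric.ball_subset_closedBall hw)
    rw [indicator_of_mem hwΩ]
    exact (h1 w ⟨Ioo_subset_Icc_self hwΩ.1, Ioo_subset_Icc_self hwΩ.2⟩ z hz
      ((hdist n z hz w hw).trans hn)).le

end Approximation

/-! ### Consequences of the approximation: Lipschitz coefficients and `C¹` regularity of `u`. -/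

noncomputable section Limits

/-! ### Uniqueness of weak derivatives -/

/-- The fundamental lemma of the calculus of variations. It makes the arbitrarily chosen `weakDeriv`
interchangeable with any explicit weak derivative. -/
lemma IsWeakDeriv.ae_eq {Ω : Set (ℝ × ℝ)} (hΩ : IsOpen Ω) {α : ℕ × ℕ} {u g g' : ℝ × ℝ → ℝ}
    (hg : IsWeakDeriv Ω α u g) (hg' : IsWeakDeriv Ω α u g') : g =ᵐ[volume.restrict Ω] g' := by
  rw [Filter.EventuallyEq, ae_restrict_iff' hΩ.measurableSet]
  have key := hΩ.ae_eq_zero_of_integral_contDiff_smul_eq_zero (hg.2.1.sub hg'.2.1) (μ := volume) ?_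
  · filter_upwards [key] with z hz h
    exact sub_eq_zero.1 (hz h)
  · intro φ h1 h2 h3
    have e : ∀ f : ℝ × ℝ → ℝ, ∫ z, f z * φ z = ∫ z in Ω, f z * φ z := by
      intro f
      refine (setIntegral_eq_integral_of_forall_compl_eq_zero fun z hz => ?_).symm
      rw [image_eq_zero_of_notMem_tsupport fun h => hz (h3 h), mul_zero]
    have hi : ∀ f : ℝ × ℝ → ℝ, LocallyIntegrableOn f Ω volume → Integrable fun z => f z * φ z := by
      intro f hf
      have h4 : IntegrableOn (fun z => f z * φ z) (tsupport φ) :=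
        (hf.integrableOn_compact_subset h3 h2).mul_continuousOn h1.continuous.continuousOn h2
      refine (integrableOn_iff_integrable_of_support_subset fun z hz => ?_).1 h4
      exact subset_tsupport _ (right_ne_zero_of_mul hz)
    have h := (hg.2.2 φ ⟨h1, h2, h3⟩).symm.trans (hg'.2.2 φ ⟨h1, h2, h3⟩)
    have hne : ((-1 : ℝ) ^ (α.1 + α.2)) ≠ 0 := pow_ne_zero _ (by norm_num)
    have h := mul_left_cancel₀ hne h
    simp only [smul_eq_mul, Pi.sub_apply]
    have : ∀ z, φ z * (g z - g' z) = g z * φ z - g' z * φ z := fun z => by ring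
    simp only [this]
    rw [integral_sub (hi _ hg.2.1) (hi _ hg'.2.1), e, e, h, sub_self]

lemma IsWeakDeriv.refl {Ω : Set (ℝ × ℝ)} {u : ℝ × ℝ → ℝ} (hu : LocallyIntegrableOn u Ω) :
    IsWeakDeriv Ω (0, 0) u u :=
  ⟨hu, hu, fun φ _ => by simp [pd]⟩

lemma isWeakDeriv_weakDeriv {Ω : Set (ℝ × ℝ)} {α : ℕ × ℕ} {u g : ℝ × ℝ → ℝ}
    (hg : IsWeakDeriv Ω α u g) : IsWeakDeriv Ω α u (weakDeriv Ω α u) := by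
  have h : ∃ g, IsWeakDeriv Ω α u g := ⟨g, hg⟩
  rw [weakDeriv, dif_pos h]
  exact h.choose_spec

lemma mem_multiIndices {m : ℕ} {α : ℕ × ℕ} : α ∈ multiIndices m ↔ α.1 + α.2 ≤ m := by
  simp only [multiIndices, Finset.mem_filter, Finset.mem_product, Finset.mem_range]
  omega

/-! ### Rectangles -/

lemma setIntegral_rect {f : ℝ × ℝ → ℝ} {x₀ x₁ y₀ y₁ : ℝ} (hx : x₀ ≤ x₁) (hy : y₀ ≤ y₁)
    (hf : IntegrableOn f (rect x₀ x₁ y₀ y₁)) :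
    ∫ z in rect x₀ x₁ y₀ y₁, f z = ∫ x in x₀..x₁, ∫ y in y₀..y₁, f (x, y) := by
  rw [rect, Measure.volume_eq_prod, setIntegral_prod f hf, intervalIntegral.integral_of_le hx,
    integral_Ioc_eq_integral_Ioo]
  simp only [intervalIntegral.integral_of_le hy, integral_Ioc_eq_integral_Ioo]

lemma rect_subset_Icc {x₀ x₁ y₀ y₁ : ℝ} : rect x₀ x₁ y₀ y₁ ⊆ Icc x₀ x₁ ×ˢ Icc y₀ y₁ :=
  prod_mono Ioo_subset_Icc_self Ioo_subset_Icc_self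

lemma integrableOn_rect_of_continuousOn {f : ℝ × ℝ → ℝ} {x₀ x₁ y₀ y₁ : ℝ}
    (hf : ContinuousOn f (Icc x₀ x₁ ×ˢ Icc y₀ y₁)) : IntegrableOn f (rect x₀ x₁ y₀ y₁) :=
  (hf.integrableOn_compact (isCompact_Icc.prod isCompact_Icc)).mono_set rect_subset_Icc

lemma rectAbs_eq_setIntegral {f : ℝ → ℝ → ℝ} (hf : Continuous (Function.uncurry f))
    {x₀ x₁ y₀ y₁ : ℝ} (hx : x₀ ≤ x₁) (hy : y₀ ≤ y₁) :
    rectAbs x₀ x₁ y₀ y₁ f = ∫ z in rect x₀ x₁ y₀ y₁, |f z.1 z.2| := by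
  rw [setIntegral_rect (f := fun z => |f z.1 z.2|) hx hy
    (integrableOn_rect_of_continuousOn hf.abs.continuousOn),
    ← rectAbs_swap hf]
  rfl

lemma volume_real_rect {x₀ x₁ y₀ y₁ : ℝ} (hx : x₀ ≤ x₁) (hy : y₀ ≤ y₁) :
    volume.real (rect x₀ x₁ y₀ y₁) = (x₁ - x₀) * (y₁ - y₀) := by
  rw [rect, Measure.volume_eq_prod, measureReal_prod_prod, Real.volume_real_Ioo_of_le hx,
    Real.volume_real_Ioo_of_le hy]

/-! ### Lipschitz coefficients -/

lemma abs_sub_le_of_jet_bound {a b c d : ℝ} {D : ℕ → ℕ → ℝ → ℝ → ℝ} (hD : IsJet 1 a b c d D)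
    {B : ℝ} (h10 : ∀ x y, |D 1 0 x y| ≤ B) (h01 : ∀ x y, |D 0 1 x y| ≤ B) {x y x' y' : ℝ}
    (hx : x ∈ Icc a b) (hy : y ∈ Icc c d) (hx' : x' ∈ Icc a b) (hy' : y' ∈ Icc c d) :
    |D 0 0 x y - D 0 0 x' y'| ≤ B * (|x - x'| + |y - y'|) := by
  have h1 := (convex_Icc a b).norm_image_sub_le_of_norm_hasDerivWithin_le (C := B)
    (fun t ht => (hD.dx 0 0 (by omega) t ht y hy).hasDerivWithinAt) (fun t _ => h10 t y) hx' hx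
  have h2 := (convex_Icc c d).norm_image_sub_le_of_norm_hasDerivWithin_le (C := B)
    (fun t ht => (hD.dy 0 0 (by omega) x' hx' t ht).hasDerivWithinAt) (fun t _ => h01 x' t) hy' hy
  simp only [Real.norm_eq_abs] at h1 h2
  have := abs_add_le (D 0 0 x y - D 0 0 x' y) (D 0 0 x' y - D 0 0 x' y')
  rw [sub_add_sub_cancel] at this
  linarith

/-- A continuous function in `W^{1,∞}` of a rectangle has a bounded Lipschitz extension. -/
theorem exists_lipschitz_extension {a b c d : ℝ} (hab : a < b) (hcd : c < d) {f : ℝ × ℝ → ℝ}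
    (hf : MemSobolev 1 ∞ (rect a b c d) f) (hfc : ContinuousOn f (rect a b c d)) :
    ∃ (F : ℝ × ℝ → ℝ) (M L : ℝ), 0 ≤ L ∧ EqOn f F (rect a b c d) ∧
      (∀ z ∈ Icc a b ×ˢ Icc c d, |F z| ≤ M) ∧
      ∀ x y x' y', |F (x, y) - F (x', y')| ≤ L * (|x - x'| + |y - y'|) := by
  set Ω := rect a b c d with hΩ
  have : IsFiniteMeasure (volume.restrict Ω) := ⟨by simpa using volume_rect_lt_top⟩
  obtain ⟨g00, hg00, hb00⟩ := hf (0, 0) (by simp [mem_multiIndices])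
  obtain ⟨g10, hg10, hb10⟩ := hf (1, 0) (by simp [mem_multiIndices])
  obtain ⟨g01, hg01, hb01⟩ := hf (0, 1) (by simp [mem_multiIndices])
  have hrefl := IsWeakDeriv.refl hg00.1
  have hfint : IntegrableOn f Ω := by
    have : MemLp f ∞ (volume.restrict Ω) := hb00.ae_eq (hg00.ae_eq isOpen_rect hrefl)
    exact this.integrable le_top
  -- At order zero the continuous function `f` itself is taken, not an almost everywhere
  -- representative, so that the approximations converge to it at every point of `Ω`.
  set g : ℕ → ℕ → ℝ × ℝ → ℝ := fun i j => if i = 0 ∧ j = 0 then f else if i = 1 then g10 else g01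
    with hg
  obtain ⟨D, hD, -, hDb, hDp, -⟩ := exists_jet_approx hab hcd (m := 1) (u := f) (g := g)
    (by
      intro i j hij
      obtain ⟨rfl, rfl⟩ | ⟨rfl, rfl⟩ | ⟨rfl, rfl⟩ :
        (i = 0 ∧ j = 0) ∨ (i = 1 ∧ j = 0) ∨ (i = 0 ∧ j = 1) := by omega
      · exact hrefl
      · exact hg10
      · exact hg01)
    (by
      intro i j hij
      obtain ⟨rfl, rfl⟩ | ⟨rfl, rfl⟩ | ⟨rfl, rfl⟩ :
        (i = 0 ∧ j = 0) ∨ (i = 1 ∧ j = 0) ∨ (i = 0 ∧ j = 1) := by omega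
      · exact hfint
      · exact hb10.integrable le_top
      · exact hb01.integrable le_top)
  have hbd : ∀ {k : ℝ × ℝ → ℝ}, MemLp k ∞ (volume.restrict Ω) →
      ∀ᵐ z ∂(volume.restrict Ω), |k z| ≤ (eLpNorm k ∞ (volume.restrict Ω)).toReal := by
    intro k hk
    filter_upwards [ae_le_eLpNormEssSup (f := k) (μ := volume.restrict Ω)] with z hz
    rw [← eLpNorm_exponent_top] at hz
    have := ENNReal.toReal_mono hk.2.ne hz
    simpa using this
  set B := max (eLpNorm g10 ∞ (volume.restrict Ω)).toReal (eLpNorm g01 ∞ (volume.restrict Ω)).toReal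
    with hB
  have hB0 : 0 ≤ B := ENNReal.toReal_nonneg.trans (le_max_left _ _)
  have h10 := hDb 1 0 B hB0 ((hbd hb10).mono fun z hz => hz.trans (le_max_left _ _))
  have h01 := hDb 0 1 B hB0 ((hbd hb01).mono fun z hz => hz.trans (le_max_right _ _))
  -- Averaging and contraction do not increase sup norms, so all approximations have the same bound
  -- `B` on their first derivatives, and it survives in the pointwise limit.
  have hlip : ∀ z ∈ Ω, ∀ w ∈ Ω, |f z - f w| ≤ B * (|z.1 - w.1| + |z.2 - w.2|) := by
    intro z hz w hw
    refine le_of_tendsto ((hDp hfc z hz).sub (hDp hfc w hw)).abs (Eventually.of_forall fun n => ?_)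
    exact abs_sub_le_of_jet_bound (hD n) (h10 n) (h01 n) (Ioo_subset_Icc_self hz.1)
      (Ioo_subset_Icc_self hz.2) (Ioo_subset_Icc_self hw.1) (Ioo_subset_Icc_self hw.2)
  -- The factor `2` passes from the sum of the coordinate distances to the maximum metric on the
  -- product.
  have hlip' : LipschitzOnWith (2 * B).toNNReal f Ω := by
    refine LipschitzOnWith.of_dist_le_mul fun z hz w hw => ?_
    rw [Real.coe_toNNReal _ (by positivity), Real.dist_eq]
    have h1 : |z.1 - w.1| ≤ dist z w := by
      rw [← Real.dist_eq, Prod.dist_eq]; exact le_max_left _ _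
    have h2 : |z.2 - w.2| ≤ dist z w := by
      rw [← Real.dist_eq, Prod.dist_eq]; exact le_max_right _ _
    have := hlip z hz w hw
    nlinarith
  obtain ⟨F, hF, hfF⟩ := hlip'.extend_real
  have hFL : ∀ x y x' y', |F (x, y) - F (x', y')| ≤ (2 * B) * (|x - x'| + |y - y'|) := by
    intro x y x' y'
    have := hF.dist_le_mul (x, y) (x', y')
    rw [Real.coe_toNNReal _ (by positivity), Real.dist_eq] at this
    refine this.trans (mul_le_mul_of_nonneg_left ?_ (by positivity))
    rw [Prod.dist_eq, Real.dist_eq, Real.dist_eq]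
    exact max_le_add_of_nonneg (abs_nonneg _) (abs_nonneg _)
  refine ⟨F, |F (a, c)| + 2 * B * ((b - a) + (d - c)), 2 * B, by positivity, hfF, ?_, hFL⟩
  rintro ⟨x, y⟩ ⟨hx, hy⟩
  have h1 := hFL x y a c
  have h2 := abs_sub_abs_le_abs_sub (F (x, y)) (F (a, c))
  simp only at hx hy
  rw [abs_of_nonneg (sub_nonneg.2 hx.1), abs_of_nonneg (sub_nonneg.2 hy.1)] at h1
  have h3 : 2 * B * (x - a + (y - c)) ≤ 2 * B * (b - a + (d - c)) := by
    gcongr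
    · exact hx.2
    · exact hy.2
  linarith

/-! ### Uniform limits of jets -/

variable {a b c d : ℝ}

/-- The embedding `IsJet.area_mul_abs_le`, applied to differences of jets, bounds their sup distance
by L¹ distances, and these tend to zero because both jets approach the same `G`. The zeroth order
parts are thus uniformly Cauchy. -/
lemma exists_uniform_limit_of_jets (hab : a < b) (hcd : c < d) {E : ℕ → ℕ → ℕ → ℝ → ℝ → ℝ}
    (hE : ∀ n, IsJet 2 a b c d (E n)) {G : ℕ → ℕ → ℝ × ℝ → ℝ}
    (hG : ∀ i j, i + j ≤ 2 → IntegrableOn (G i j) (rect a b c d))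
    (hlim : ∀ i j, i + j ≤ 2 →
      Tendsto (fun n => ∫ z in rect a b c d, |E n i j z.1 z.2 - G i j z|) atTop (𝓝 0)) :
    ∃ f : ℝ × ℝ → ℝ,
      TendstoUniformlyOn (fun n z => E n 0 0 z.1 z.2) f atTop (Icc a b ×ˢ Icc c d) := by
  have hb0 : 0 < b - a := sub_pos.2 hab
  have hd0 : 0 < d - c := sub_pos.2 hcd
  set e : ℕ → ℕ → ℕ → ℝ := fun i j n => ∫ z in rect a b c d, |E n i j z.1 z.2 - G i j z| with he
  set s : ℕ → ℝ := fun n => e 0 0 n + e 1 0 n + e 0 1 n + e 1 1 n with hs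
  have he0 : ∀ i j n, 0 ≤ e i j n := fun i j n => integral_nonneg fun _ => abs_nonneg _
  have hslim : Tendsto s atTop (𝓝 0) := by
    simpa using (((hlim 0 0 (by omega)).add (hlim 1 0 (by omega))).add
      (hlim 0 1 (by omega))).add (hlim 1 1 (by omega))
  set C := (1 + (b - a)) * (1 + (d - c)) / ((b - a) * (d - c)) with hC
  have hC0 : 0 < C := by positivity
  have hdiff : ∀ n k i j, i + j ≤ 2 →
      rectAbs a b c d (fun x y => E n i j x y - E k i j x y) ≤ e i j n + e i j k := by
    intro n k i j hij
    have c1 := (hE n).cont i j hij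
    have c2 := (hE k).cont i j hij
    rw [rectAbs_eq_setIntegral (f := fun x y => E n i j x y - E k i j x y) (c1.sub c2) hab.le hcd.le]
    have i1 : IntegrableOn (fun z : ℝ × ℝ => |E n i j z.1 z.2 - G i j z|) (rect a b c d) :=
      ((integrableOn_rect_of_continuousOn c1.continuousOn).sub (hG i j hij)).abs
    have i2 : IntegrableOn (fun z : ℝ × ℝ => |E k i j z.1 z.2 - G i j z|) (rect a b c d) :=
      ((integrableOn_rect_of_continuousOn c2.continuousOn).sub (hG i j hij)).abs
    simp only [he]
    rw [← integral_add i1 i2]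
    refine integral_mono ((integrableOn_rect_of_continuousOn (c1.sub c2).continuousOn).abs)
      (i1.fun_add i2) fun z => ?_
    simp only
    rw [abs_sub_comm (E k i j z.1 z.2)]
    exact abs_sub_le _ _ _
  have hcauchy : ∀ n k, ∀ z ∈ Icc a b ×ˢ Icc c d,
      |E n 0 0 z.1 z.2 - E k 0 0 z.1 z.2| ≤ C * (s n + s k) := by
    intro n k z hz
    have h := ((hE n).sub (hE k)).area_mul_abs_le hz.1 hz.2
    have hT : ∀ i j, e i j n ≤ s n → e i j k ≤ s k → i + j ≤ 2 →
        rectAbs a b c d (fun x y => E n i j x y - E k i j x y) ≤ s n + s k :=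
      fun i j h1 h2 hij => (hdiff n k i j hij).trans (add_le_add h1 h2)
    have hle : ∀ n, e 0 0 n ≤ s n ∧ e 1 0 n ≤ s n ∧ e 0 1 n ≤ s n ∧ e 1 1 n ≤ s n := by
      intro n
      simp only [hs]
      refine ⟨?_, ?_, ?_, ?_⟩ <;> linarith [he0 0 0 n, he0 1 0 n, he0 0 1 n, he0 1 1 n]
    have t00 := hT 0 0 (hle n).1 (hle k).1 (by omega)
    have t10 := hT 1 0 (hle n).2.1 (hle k).2.1 (by omega)
    have t01 := hT 0 1 (hle n).2.2.1 (hle k).2.2.1 (by omega)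
    have t11 := hT 1 1 (hle n).2.2.2 (hle k).2.2.2 (by omega)
    have h2 : (b - a) * (d - c) * |E n 0 0 z.1 z.2 - E k 0 0 z.1 z.2| ≤
        (s n + s k) + (b - a) * (s n + s k) + (d - c) * ((s n + s k) + (b - a) * (s n + s k)) := by
      refine h.trans ?_
      gcongr
    rw [hC, div_mul_eq_mul_div, le_div_iff₀ (by positivity)]
    linarith
  have hs0 : ∀ n, 0 ≤ s n := fun n => by
    simp only [hs]; linarith [he0 0 0 n, he0 1 0 n, he0 0 1 n, he0 1 1 n]
  have hUC : UniformCauchySeqOn (fun n z => E n 0 0 z.1 z.2) atTop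
      (Icc a b ×ˢ Icc c d : Set (ℝ × ℝ)) := by
    rw [Metric.uniformCauchySeqOn_iff]
    intro ε hε
    obtain ⟨N, hN⟩ := eventually_atTop.1 (hslim.eventually_lt_const
      (show 0 < ε / (2 * C) by positivity))
    refine ⟨N, fun n hn k hk z hz => ?_⟩
    rw [Real.dist_eq]
    refine (hcauchy n k z hz).trans_lt ?_
    have h1 := hN n hn
    have h2 := hN k hk
    calc C * (s n + s k) < C * (ε / (2 * C) + ε / (2 * C)) := by gcongr
      _ = ε := by field_simp; ring
  have hpt : ∀ z : ℝ × ℝ, ∃ l : ℝ, z ∈ Icc a b ×ˢ Icc c d →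
      Tendsto (fun n => E n 0 0 z.1 z.2) atTop (𝓝 l) := by
    intro z
    by_cases hz : z ∈ Icc a b ×ˢ Icc c d
    · obtain ⟨l, hl⟩ := cauchySeq_tendsto_of_complete (hUC.cauchySeq hz)
      exact ⟨l, fun _ => hl⟩
    · exact ⟨0, fun h => absurd h hz⟩
  choose f hf using hpt
  exact ⟨f, hUC.tendstoUniformlyOn_of_tendsto fun z hz => hf z hz⟩

/-- A sequence of jets on a closed element converging to `(u, ux, uy)` uniformly, together with
control of all `L¹` norms of derivatives in the limit. -/
structure JetLimit (x₀ x₁ y₀ y₁ : ℝ) (u ux uy : ℝ → ℝ → ℝ) (S : ℝ)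
    (D : ℕ → ℕ → ℕ → ℝ → ℝ → ℝ) (s : ℕ → ℝ) : Prop where
  jet : ∀ n, IsJet 3 x₀ x₁ y₀ y₁ (D n)
  le : ∀ n i j, i + j ≤ 3 → rectAbs x₀ x₁ y₀ y₁ (D n i j) ≤ s n
  tendsto : Tendsto s atTop (𝓝 S)
  lim : ∀ ε > 0, ∀ᶠ n in atTop, ∀ x ∈ Icc x₀ x₁, ∀ y ∈ Icc y₀ y₁, |D n 0 0 x y - u x y| ≤ ε
  limx : ∀ ε > 0, ∀ᶠ n in atTop, ∀ x ∈ Icc x₀ x₁, ∀ y ∈ Icc y₀ y₁, |D n 1 0 x y - ux x y| ≤ ε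
  limy : ∀ ε > 0, ∀ᶠ n in atTop, ∀ x ∈ Icc x₀ x₁, ∀ y ∈ Icc y₀ y₁, |D n 0 1 x y - uy x y| ≤ ε

lemma TendstoUniformlyOn.eventually_abs_le {F : ℕ → ℝ × ℝ → ℝ} {f : ℝ × ℝ → ℝ}
    {s : Set (ℝ × ℝ)} (h : TendstoUniformlyOn F f atTop s) {ε : ℝ} (hε : 0 < ε) :
    ∀ᶠ n in atTop, ∀ z ∈ s, |F n z - f z| ≤ ε := by
  filter_upwards [Metric.tendstoUniformlyOn_iff.1 h ε hε] with n hn z hz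
  rw [← Real.dist_eq, dist_comm]
  exact (hn z hz).le

/-- Functions in `W^{3,1}` of a rectangle are `C¹` up to the boundary, and on every element they are
limits of jets. -/
theorem exists_gradient_and_jetLimit (hab : a < b) (hcd : c < d) {u : ℝ × ℝ → ℝ}
    {G : ℕ → ℕ → ℝ × ℝ → ℝ} (hG0 : G 0 0 = u)
    (hG : ∀ i j, i + j ≤ 3 → IsWeakDeriv (rect a b c d) (i, j) u (G i j))
    (hGi : ∀ i j, i + j ≤ 3 → IntegrableOn (G i j) (rect a b c d))
    (hu : ContinuousOn u (closure (rect a b c d))) :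
    ∃ ux uy : ℝ × ℝ → ℝ,
      ContinuousOn ux (Icc a b ×ˢ Icc c d) ∧ ContinuousOn uy (Icc a b ×ˢ Icc c d) ∧
      (∀ z ∈ rect a b c d, HasDerivAt (fun s => u (s, z.2)) (ux z) z.1) ∧
      (∀ z ∈ rect a b c d, HasDerivAt (fun s => u (z.1, s)) (uy z) z.2) ∧
      ∀ x₀ x₁ y₀ y₁, x₀ ≤ x₁ → y₀ ≤ y₁ → Icc x₀ x₁ ⊆ Icc a b → Icc y₀ y₁ ⊆ Icc c d →
        ∃ D s, JetLimit x₀ x₁ y₀ y₁ (fun x y => u (x, y)) (fun x y => ux (x, y))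
          (fun x y => uy (x, y))
          (∑ α ∈ multiIndices 3, ∫ z in rect x₀ x₁ y₀ y₁, |G α.1 α.2 z|) D s := by
  obtain ⟨D, hD, hDlim, -, -, hDu⟩ := exists_jet_approx hab hcd hG hGi
  rw [hG0] at hDu
  have hDu := hDu hu
  rw [closure_rect hab hcd] at hDu
  -- Both first derivatives of a jet of order three generate a jet of order two, to which the
  -- uniform limit lemma applies.
  have shiftx : ∀ n, IsJet 2 a b c d fun i j => D n (i + 1) j := fun n =>
    ⟨fun i j h => (hD n).cont _ _ (by omega), fun i j h => (hD n).dx _ _ (by omega),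
      fun i j h => (hD n).dy _ _ (by omega)⟩
  have shifty : ∀ n, IsJet 2 a b c d fun i j => D n i (j + 1) := fun n =>
    ⟨fun i j h => (hD n).cont _ _ (by omega), fun i j h => (hD n).dx _ _ (by omega),
      fun i j h => (hD n).dy _ _ (by omega)⟩
  obtain ⟨ux, hux⟩ := exists_uniform_limit_of_jets hab hcd shiftx
    (G := fun i j => G (i + 1) j) (fun i j h => hGi _ _ (by omega))
    (fun i j h => hDlim _ _ (by omega))
  obtain ⟨uy, huy⟩ := exists_uniform_limit_of_jets hab hcd shifty
    (G := fun i j => G i (j + 1)) (fun i j h => hGi _ _ (by omega))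
    (fun i j h => hDlim _ _ (by omega))
  simp only [zero_add] at hux huy
  refine ⟨ux, uy,
    hux.continuousOn (Frequently.of_forall fun n => ((hD n).cont 1 0 (by omega)).continuousOn),
    huy.continuousOn (Frequently.of_forall fun n => ((hD n).cont 0 1 (by omega)).continuousOn),
    fun z hz => ?_, fun z hz => ?_, fun x₀ x₁ y₀ y₁ hx hy hxs hys => ?_⟩
  -- Along a line the functions and their derivatives converge, the latter uniformly, so the limit
  -- of the derivatives is the classical derivative of `u`.
  · have hmaps : MapsTo (fun s => (s, z.2)) (Ioo a b) (Icc a b ×ˢ Icc c d) := fun s hs =>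
      ⟨Ioo_subset_Icc_self hs, Ioo_subset_Icc_self hz.2⟩
    exact hasDerivAt_of_tendstoUniformlyOn (f := fun n s => D n 0 0 s z.2)
      (f' := fun n s => D n 1 0 s z.2) (g' := fun s => ux (s, z.2)) (l := atTop) isOpen_Ioo
      ((hux.comp (fun s : ℝ => (s, z.2))).mono hmaps)
      (Eventually.of_forall fun n x hx => (hD n).dx 0 0 (by omega) x (Ioo_subset_Icc_self hx) z.2
        (Ioo_subset_Icc_self hz.2))
      (fun x hx => hDu.tendsto_at (hmaps hx)) hz.1
  · have hmaps : MapsTo (fun s => (z.1, s)) (Ioo c d) (Icc a b ×ˢ Icc c d) := fun s hs =>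
      ⟨Ioo_subset_Icc_self hz.1, Ioo_subset_Icc_self hs⟩
    exact hasDerivAt_of_tendstoUniformlyOn (f := fun n s => D n 0 0 z.1 s)
      (f' := fun n s => D n 0 1 z.1 s) (g' := fun s => uy (z.1, s)) (l := atTop) isOpen_Ioo
      ((huy.comp (fun s : ℝ => (z.1, s))).mono hmaps)
      (Eventually.of_forall fun n x hx => (hD n).dy 0 0 (by omega) z.1 (Ioo_subset_Icc_self hz.1) x
        (Ioo_subset_Icc_self hx))
      (fun x hx => hDu.tendsto_at (hmaps hx)) hz.2
  have hsub : rect x₀ x₁ y₀ y₁ ⊆ rect a b c d := by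
    rw [rect, rect, ← interior_Icc, ← interior_Icc, ← interior_Icc, ← interior_Icc]
    exact prod_mono (interior_mono hxs) (interior_mono hys)
  -- The bound `s n` is the sum of all L¹ norms of the `n`-th jet on the element; it dominates each
  -- of them and converges to the same sum for the weak derivatives of `u`.
  refine ⟨D, fun n => ∑ α ∈ multiIndices 3, rectAbs x₀ x₁ y₀ y₁ (D n α.1 α.2),
    fun n => (hD n).mono hxs hys, fun n i j hij => ?_, ?_, fun ε hε => ?_, fun ε hε => ?_,
    fun ε hε => ?_⟩
  · exact Finset.single_le_sum (f := fun α : ℕ × ℕ => rectAbs x₀ x₁ y₀ y₁ (D n α.1 α.2))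
      (fun α _ => rectAbs_nonneg hx hy _) (mem_multiIndices.2 hij : (i, j) ∈ multiIndices 3)
  · refine tendsto_finsetSum _ fun α hα => ?_
    have hα := mem_multiIndices.1 hα
    have hc := fun n => (hD n).cont α.1 α.2 hα
    rw [tendsto_iff_dist_tendsto_zero]
    refine squeeze_zero (fun n => dist_nonneg) (fun n => ?_) (hDlim α.1 α.2 hα)
    have i0 : IntegrableOn (fun z : ℝ × ℝ => D n α.1 α.2 z.1 z.2) (rect a b c d) :=
      integrableOn_rect_of_continuousOn (hc n).continuousOn
    have i1 := i0.mono_set hsub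
    have i2 := (hGi α.1 α.2 hα).mono_set hsub
    rw [rectAbs_eq_setIntegral (hc n) hx hy, Real.dist_eq, ← integral_sub i1.abs i2.abs]
    calc _ ≤ ∫ z in rect x₀ x₁ y₀ y₁, |(|D n α.1 α.2 z.1 z.2| - |G α.1 α.2 z|)| :=
          abs_integral_le_integral_abs
      _ ≤ ∫ z in rect x₀ x₁ y₀ y₁, |D n α.1 α.2 z.1 z.2 - G α.1 α.2 z| :=
          integral_mono (i1.abs.sub i2.abs).abs (i1.sub i2).abs fun z => abs_abs_sub_abs_le _ _
      _ ≤ _ := setIntegral_mono_set ((i0.sub (hGi α.1 α.2 hα)).abs)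
          (Eventually.of_forall fun z => abs_nonneg _) hsub.eventuallyLE
  · exact (TendstoUniformlyOn.eventually_abs_le hDu hε).mono fun n h x hx y hy =>
      h (x, y) ⟨hxs hx, hys hy⟩
  · exact (TendstoUniformlyOn.eventually_abs_le hux hε).mono fun n h x hx y hy =>
      h (x, y) ⟨hxs hx, hys hy⟩
  · exact (TendstoUniformlyOn.eventually_abs_le huy hε).mono fun n h x hx y hy =>
      h (x, y) ⟨hxs hx, hys hy⟩

end Limits

/-! ### The element estimates for functions in the Sobolev space. -/

noncomputable section ElementLimits

variable {x₀ x₁ y₀ y₁ S : ℝ} {u ux uy : ℝ → ℝ → ℝ} {D : ℕ → ℕ → ℕ → ℝ → ℝ → ℝ} {s : ℕ → ℝ}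

/-- Exchanging the coordinates lets the estimate for vertical mid lines serve the horizontal ones as
well. -/
lemma JetLimit.swap (h : JetLimit x₀ x₁ y₀ y₁ u ux uy S D s) :
    JetLimit y₀ y₁ x₀ x₁ (fun x y => u y x) (fun x y => uy y x) (fun x y => ux y x) S
      (fun n i j x y => D n j i y x) s where
  jet n := (h.jet n).swap
  le n i j hij := by
    rw [rectAbs_swap ((h.jet n).cont j i (by omega))]
    exact h.le n j i (by omega)
  tendsto := h.tendsto
  lim ε hε := (h.lim ε hε).mono fun n hn x hx y hy => hn y hy x hx
  limx ε hε := (h.limy ε hε).mono fun n hn x hx y hy => hn y hy x hx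
  limy ε hε := (h.limx ε hε).mono fun n hn x hx y hy => hn y hy x hx

lemma abs_bilinDx_sub_le {w : ℝ → ℝ → ℝ} (hx : x₀ < x₁) (hy : y₀ < y₁) {δ : ℝ}
    (h : ∀ x ∈ Icc x₀ x₁, ∀ y ∈ Icc y₀ y₁, |w x y - u x y| ≤ δ) {y : ℝ} (hyy : y ∈ Icc y₀ y₁) :
    |bilinDx x₀ x₁ y₀ y₁ w y - bilinDx x₀ x₁ y₀ y₁ u y| ≤ 2 * δ / (x₁ - x₀) := by
  have hx0 : 0 < x₁ - x₀ := sub_pos.2 hx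
  have hy0 : 0 < y₁ - y₀ := sub_pos.2 hy
  have hxl : x₀ ∈ Icc x₀ x₁ := left_mem_Icc.2 hx.le
  have hxr : x₁ ∈ Icc x₀ x₁ := right_mem_Icc.2 hx.le
  have hyl : y₀ ∈ Icc y₀ y₁ := left_mem_Icc.2 hy.le
  have hyr : y₁ ∈ Icc y₀ y₁ := right_mem_Icc.2 hy.le
  have h00 := abs_le.1 (h _ hxl _ hyl)
  have h01 := abs_le.1 (h _ hxl _ hyr)
  have h10 := abs_le.1 (h _ hxr _ hyl)
  have h11 := abs_le.1 (h _ hxr _ hyr)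
  have e : bilinDx x₀ x₁ y₀ y₁ w y - bilinDx x₀ x₁ y₀ y₁ u y =
      ((y₁ - y) * ((w x₁ y₀ - u x₁ y₀) - (w x₀ y₀ - u x₀ y₀)) +
        (y - y₀) * ((w x₁ y₁ - u x₁ y₁) - (w x₀ y₁ - u x₀ y₁))) / ((x₁ - x₀) * (y₁ - y₀)) := by
    simp only [bilinDx]
    ring
  rw [e, abs_div, abs_of_pos (mul_pos hx0 hy0), div_le_div_iff₀ (mul_pos hx0 hy0) hx0]
  have p1 : |(y₁ - y) * ((w x₁ y₀ - u x₁ y₀) - (w x₀ y₀ - u x₀ y₀))| ≤ (y₁ - y) * (2 * δ) := by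
    rw [abs_mul, abs_of_nonneg (sub_nonneg.2 hyy.2)]
    refine mul_le_mul_of_nonneg_left (abs_le.2 ⟨?_, ?_⟩) (sub_nonneg.2 hyy.2) <;> linarith
  have p2 : |(y - y₀) * ((w x₁ y₁ - u x₁ y₁) - (w x₀ y₁ - u x₀ y₁))| ≤ (y - y₀) * (2 * δ) := by
    rw [abs_mul, abs_of_nonneg (sub_nonneg.2 hyy.1)]
    refine mul_le_mul_of_nonneg_left (abs_le.2 ⟨?_, ?_⟩) (sub_nonneg.2 hyy.1) <;> linarith
  have p3 := (abs_add_le _ _).trans (add_le_add p1 p2)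
  have p4 := mul_le_mul_of_nonneg_right p3 hx0.le
  linarith

lemma abs_bilinDyMid_sub_le {w : ℝ → ℝ → ℝ} (hx : x₀ < x₁) (hy : y₀ < y₁) {δ : ℝ}
    (h : ∀ x ∈ Icc x₀ x₁, ∀ y ∈ Icc y₀ y₁, |w x y - u x y| ≤ δ) :
    |bilinDyMid x₀ x₁ y₀ y₁ w - bilinDyMid x₀ x₁ y₀ y₁ u| ≤ 2 * δ / (y₁ - y₀) := by
  have hy0 : 0 < y₁ - y₀ := sub_pos.2 hy
  have hxl : x₀ ∈ Icc x₀ x₁ := left_mem_Icc.2 hx.le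
  have hxr : x₁ ∈ Icc x₀ x₁ := right_mem_Icc.2 hx.le
  have hyl : y₀ ∈ Icc y₀ y₁ := left_mem_Icc.2 hy.le
  have hyr : y₁ ∈ Icc y₀ y₁ := right_mem_Icc.2 hy.le
  have h00 := abs_le.1 (h _ hxl _ hyl)
  have h01 := abs_le.1 (h _ hxl _ hyr)
  have h10 := abs_le.1 (h _ hxr _ hyl)
  have h11 := abs_le.1 (h _ hxr _ hyr)
  have e : bilinDyMid x₀ x₁ y₀ y₁ w - bilinDyMid x₀ x₁ y₀ y₁ u =
      ((w x₀ y₁ - u x₀ y₁) - (w x₀ y₀ - u x₀ y₀) +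
        ((w x₁ y₁ - u x₁ y₁) - (w x₁ y₀ - u x₁ y₀))) / 2 / (y₁ - y₀) := by
    simp only [bilinDyMid]
    field_simp
    ring
  rw [e, abs_div, abs_of_pos hy0]
  gcongr
  rw [abs_le]
  constructor <;> linarith

variable {a₁ a₂ : ℝ → ℝ → ℝ}

/-- The flux involves only first derivatives and corner values, so uniform convergence of `u`, `ux`,
`uy` suffices. The factors `1 / (x₁ - x₀)` and `1 / (y₁ - y₀)` do no harm because the element is
fixed in this limit. -/
lemma JetLimit.tendsto_integral_midFlux (h : JetLimit x₀ x₁ y₀ y₁ u ux uy S D s) (hx : x₀ < x₁)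
    (hy : y₀ < y₁) (ha₁ : Continuous (Function.uncurry a₁))
    (ha₂ : Continuous (Function.uncurry a₂)) {M : ℝ}
    (hM₁ : ∀ x ∈ Icc x₀ x₁, ∀ y ∈ Icc y₀ y₁, |a₁ x y| ≤ M)
    (hM₂ : ∀ x ∈ Icc x₀ x₁, ∀ y ∈ Icc y₀ y₁, |a₂ x y| ≤ M) {t t' : ℝ} (ht : t ∈ Icc y₀ y₁)
    (ht' : t' ∈ Icc y₀ y₁) :
    Tendsto (fun n => ∫ y in t..t', midFlux x₀ x₁ y₀ y₁ a₁ a₂ (D n 0 0) (D n 1 0) (D n 0 1) y)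
      atTop (𝓝 (∫ y in t..t', midFlux x₀ x₁ y₀ y₁ a₁ a₂ u ux uy y)) := by
  have hx0 : 0 < x₁ - x₀ := sub_pos.2 hx
  have hy0 : 0 < y₁ - y₀ := sub_pos.2 hy
  have hxm : (x₀ + x₁) / 2 ∈ Icc x₀ x₁ := ⟨by linarith, by linarith⟩
  have hM0 : 0 ≤ M := (abs_nonneg _).trans (hM₁ _ hxm _ ht)
  refine TendstoUniformlyOn.tendsto_intervalIntegral_of_continuousOn
    (Eventually.of_forall fun n => ?_) ?_
  · have c1 := Continuous.curry_left ha₁ ((x₀ + x₁) / 2)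
    have c2 := Continuous.curry_left ha₂ ((x₀ + x₁) / 2)
    have c3 := Continuous.curry_left ((h.jet n).cont 1 0 (by omega)) ((x₀ + x₁) / 2)
    have c4 := Continuous.curry_left ((h.jet n).cont 0 1 (by omega)) ((x₀ + x₁) / 2)
    have : Continuous (midFlux x₀ x₁ y₀ y₁ a₁ a₂ (D n 0 0) (D n 1 0) (D n 0 1)) := by
      unfold midFlux bilinDx
      fun_prop
    exact this.continuousOn
  · rw [Metric.tendstoUniformlyOn_iff]
    intro ε hε
    set C := M * (1 + 2 / (x₁ - x₀)) + M * (1 + 2 / (y₁ - y₀)) with hC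
    have hC0 : 0 ≤ C := by positivity
    have hδ : 0 < ε / (C + 1) := by positivity
    filter_upwards [h.lim _ hδ, h.limx _ hδ, h.limy _ hδ] with n h0 h1 h2 y hyy
    have hyy : y ∈ Icc y₀ y₁ := uIcc_subset_Icc ht ht' hyy
    set δ := ε / (C + 1) with hδd
    have b1 := abs_bilinDx_sub_le hx hy h0 hyy
    have b2 := abs_bilinDyMid_sub_le hx hy h0
    have b3 := h1 _ hxm y hyy
    have b4 := h2 _ hxm y hyy
    rw [dist_comm, Real.dist_eq]
    have e : midFlux x₀ x₁ y₀ y₁ a₁ a₂ (D n 0 0) (D n 1 0) (D n 0 1) y -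
        midFlux x₀ x₁ y₀ y₁ a₁ a₂ u ux uy y =
        a₁ ((x₀ + x₁) / 2) y * ((D n 1 0 ((x₀ + x₁) / 2) y - ux ((x₀ + x₁) / 2) y) -
          (bilinDx x₀ x₁ y₀ y₁ (D n 0 0) y - bilinDx x₀ x₁ y₀ y₁ u y)) +
        a₂ ((x₀ + x₁) / 2) y * ((D n 0 1 ((x₀ + x₁) / 2) y - uy ((x₀ + x₁) / 2) y) -
          (bilinDyMid x₀ x₁ y₀ y₁ (D n 0 0) - bilinDyMid x₀ x₁ y₀ y₁ u)) := by
      simp only [midFlux]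
      ring
    rw [e]
    calc _ ≤ M * (δ + 2 * δ / (x₁ - x₀)) + M * (δ + 2 * δ / (y₁ - y₀)) := by
          refine (abs_add_le _ _).trans (add_le_add ?_ ?_)
          · rw [abs_mul]
            exact mul_le_mul (hM₁ _ hxm _ hyy) ((abs_sub _ _).trans (add_le_add b3 b1))
              (abs_nonneg _) hM0
          · rw [abs_mul]
            exact mul_le_mul (hM₂ _ hxm _ hyy) ((abs_sub _ _).trans (add_le_add b4 b2))
              (abs_nonneg _) hM0
      _ = C * δ := by rw [hC]; ring
      _ < (C + 1) * δ := by nlinarith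
      _ = ε := by rw [hδd]; field_simp

lemma tendsto_of_eventually_abs_le {f : ℕ → ℝ} {l : ℝ}
    (h : ∀ ε > 0, ∀ᶠ n in atTop, |f n - l| ≤ ε) : Tendsto f atTop (𝓝 l) := by
  rw [Metric.tendsto_nhds]
  intro ε hε
  filter_upwards [h (ε / 2) (by positivity)] with n hn
  rw [Real.dist_eq]
  linarith

lemma JetLimit.tendsto_apply (h : JetLimit x₀ x₁ y₀ y₁ u ux uy S D s) {x y : ℝ}
    (hx : x ∈ Icc x₀ x₁) (hy : y ∈ Icc y₀ y₁) :
    Tendsto (fun n => D n 0 0 x y) atTop (𝓝 (u x y)) :=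
  tendsto_of_eventually_abs_le fun ε hε => (h.lim ε hε).mono fun _ hn => hn x hx y hy

/-- Estimate of the vertical mid line contribution of an element. -/
theorem JetLimit.vertFlux_sub_edgeTerm_le (h : JetLimit x₀ x₁ y₀ y₁ u ux uy S D s) (hx : x₀ < x₁)
    (hy : y₀ < y₁) (ha₁ : Continuous (Function.uncurry a₁))
    (ha₂ : Continuous (Function.uncurry a₂)) {M L H R N γ D₀ D₁ W₀ W₁ : ℝ}
    (hM₁ : ∀ x ∈ Icc x₀ x₁, ∀ y ∈ Icc y₀ y₁, |a₁ x y| ≤ M)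
    (hM₂ : ∀ x ∈ Icc x₀ x₁, ∀ y ∈ Icc y₀ y₁, |a₂ x y| ≤ M)
    (hL : ∀ x y x' y', |a₂ x y - a₂ x' y'| ≤ L * (|x - x'| + |y - y'|))
    (hL0 : 0 ≤ L) (hh : x₁ - x₀ ≤ H) (hk : y₁ - y₀ ≤ H) (hγ : H ≤ γ * (x₁ - x₀)) (hγ0 : 0 ≤ γ)
    (hHR : H ≤ R) (hD₀ : |D₀| ≤ H * N) (hD₁ : |D₁| ≤ H * N) (hW₀ : |W₀| ≤ H * N)
    (hW₁ : |W₁| ≤ H * N) (hDW : D₁ - D₀ = W₁ - W₀) :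
    |vertFlux x₀ x₁ y₀ y₁ D₀ D₁ a₁ a₂ u ux uy -
      (edgeTerm y₀ y₁ W₁ a₂ u x₁ - edgeTerm y₀ y₁ W₀ a₂ u x₀) / 2| ≤
      (M * (4 + γ) + L * (2 + 4 * R + γ)) * (H ^ 2 * N * S) := by
  have hym : (y₀ + y₁) / 2 ∈ Icc y₀ y₁ := ⟨by linarith, by linarith⟩
  have hyl : y₀ ∈ Icc y₀ y₁ := left_mem_Icc.2 hy.le
  have hyr : y₁ ∈ Icc y₀ y₁ := right_mem_Icc.2 hy.le
  have hedge : ∀ x ∈ Icc x₀ x₁, ∀ W, Tendsto (fun n => edgeTerm y₀ y₁ W a₂ (D n 0 0) x) atTop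
      (𝓝 (edgeTerm y₀ y₁ W a₂ u x)) := by
    intro x hxx W
    exact ((((h.tendsto_apply hxx hyl).sub ((h.tendsto_apply hxx hym).const_mul 2)).add
      (h.tendsto_apply hxx hyr)).const_mul _).const_mul W
  have hvert : Tendsto (fun n => vertFlux x₀ x₁ y₀ y₁ D₀ D₁ a₁ a₂ (D n 0 0) (D n 1 0) (D n 0 1))
      atTop (𝓝 (vertFlux x₀ x₁ y₀ y₁ D₀ D₁ a₁ a₂ u ux uy)) :=
    ((h.tendsto_integral_midFlux hx hy ha₁ ha₂ hM₁ hM₂ hyl hym).const_mul D₀).add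
      ((h.tendsto_integral_midFlux hx hy ha₁ ha₂ hM₁ hM₂ hym hyr).const_mul D₁)
  refine le_of_tendsto_of_tendsto
    (hvert.sub (((hedge _ (right_mem_Icc.2 hx.le) W₁).sub
      (hedge _ (left_mem_Icc.2 hx.le) W₀)).div_const 2)).abs
    ((h.tendsto.const_mul (H ^ 2 * N)).const_mul (M * (4 + γ) + L * (2 + 4 * R + γ)))
    (Eventually.of_forall fun n => ?_)
  exact (h.jet n).vertFlux_sub_edgeTerm_le hx hy ha₁ ha₂ hM₁ hM₂ hL hL0 hh hk hγ hγ0 hHR hD₀ hD₁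
    hW₀ hW₁ hDW (h.le n 0 2 (by omega)) (h.le n 1 2 (by omega)) (h.le n 2 1 (by omega))
    (h.le n 3 0 (by omega))

/-- The interpolant is a convex combination of the four corner values. -/
lemma abs_bilin_sub_le {w : ℝ → ℝ → ℝ} (hx : x₀ < x₁) (hy : y₀ < y₁) {δ : ℝ}
    (h : ∀ x ∈ Icc x₀ x₁, ∀ y ∈ Icc y₀ y₁, |w x y - u x y| ≤ δ) {x y : ℝ} (hxx : x ∈ Icc x₀ x₁)
    (hyy : y ∈ Icc y₀ y₁) :
    |bilin x₀ x₁ y₀ y₁ w x y - bilin x₀ x₁ y₀ y₁ u x y| ≤ δ := by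
  have hx0 : 0 < x₁ - x₀ := sub_pos.2 hx
  have hy0 : 0 < y₁ - y₀ := sub_pos.2 hy
  have hxl : x₀ ∈ Icc x₀ x₁ := left_mem_Icc.2 hx.le
  have hxr : x₁ ∈ Icc x₀ x₁ := right_mem_Icc.2 hx.le
  have hyl : y₀ ∈ Icc y₀ y₁ := left_mem_Icc.2 hy.le
  have hyr : y₁ ∈ Icc y₀ y₁ := right_mem_Icc.2 hy.le
  have key : ∀ p q e, 0 ≤ p → 0 ≤ q → |e| ≤ δ → |p * (q * e)| ≤ p * (q * δ) := by
    intro p q e hp hq he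
    rw [abs_mul, abs_mul, abs_of_nonneg hp, abs_of_nonneg hq]
    gcongr
  have p1 := key (x₁ - x) (y₁ - y) _ (sub_nonneg.2 hxx.2) (sub_nonneg.2 hyy.2) (h _ hxl _ hyl)
  have p2 := key (x₁ - x) (y - y₀) _ (sub_nonneg.2 hxx.2) (sub_nonneg.2 hyy.1) (h _ hxl _ hyr)
  have p3 := key (x - x₀) (y₁ - y) _ (sub_nonneg.2 hxx.1) (sub_nonneg.2 hyy.2) (h _ hxr _ hyl)
  have p4 := key (x - x₀) (y - y₀) _ (sub_nonneg.2 hxx.1) (sub_nonneg.2 hyy.1) (h _ hxr _ hyr)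
  rw [bilin, bilin, ← sub_div, abs_div, abs_of_pos (mul_pos hx0 hy0),
    div_le_iff₀ (mul_pos hx0 hy0), abs_le]
  rw [abs_le] at p1 p2 p3 p4
  constructor <;> linarith

/-- The `L¹` interpolation error on an element. -/
theorem JetLimit.integral_abs_sub_bilin_le (h : JetLimit x₀ x₁ y₀ y₁ u ux uy S D s) (hx : x₀ < x₁)
    (hy : y₀ < y₁) (hu : ContinuousOn (Function.uncurry u) (Icc x₀ x₁ ×ˢ Icc y₀ y₁)) {H R : ℝ}
    (hh : x₁ - x₀ ≤ H) (hk : y₁ - y₀ ≤ H) (hHR : H ≤ R) :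
    ∫ z in rect x₀ x₁ y₀ y₁, |u z.1 z.2 - bilin x₀ x₁ y₀ y₁ u z.1 z.2| ≤
      (2 + R) * (H ^ 2 * S) := by
  have hx0 : 0 < x₁ - x₀ := sub_pos.2 hx
  have hy0 : 0 < y₁ - y₀ := sub_pos.2 hy
  have hH0 : 0 < H := hx0.trans_le hh
  set V := volume.real (rect x₀ x₁ y₀ y₁) with hV
  have hV0 : 0 ≤ V := measureReal_nonneg
  have hcb : ∀ w : ℝ → ℝ → ℝ, Continuous fun z : ℝ × ℝ => bilin x₀ x₁ y₀ y₁ w z.1 z.2 := by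
    intro w
    unfold bilin
    fun_prop
  have iu : IntegrableOn (fun z => |u z.1 z.2 - bilin x₀ x₁ y₀ y₁ u z.1 z.2|)
      (rect x₀ x₁ y₀ y₁) :=
    integrableOn_rect_of_continuousOn (hu.sub (hcb u).continuousOn).abs
  refine le_of_forall_pos_le_add fun ε hε => ?_
  -- Replacing `u` by a jet changes the function and its interpolant by at most `δ` each, hence the
  -- L¹ error by at most `2 * δ * V ≤ ε`.
  set δ := ε / (2 * V + 1) with hδ
  have hδ0 : 0 < δ := by positivity
  have hlim : Tendsto (fun n => (2 + R) * (H ^ 2 * s n) + 2 * δ * V) atTop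
      (𝓝 ((2 + R) * (H ^ 2 * S) + 2 * δ * V)) :=
    ((h.tendsto.const_mul _).const_mul _).add_const _
  have hle : 2 * δ * V ≤ ε := by
    rw [hδ]
    rw [show 2 * (ε / (2 * V + 1)) * V = (ε * (2 * V)) / (2 * V + 1) by ring,
      div_le_iff₀ (by positivity)]
    nlinarith
  refine le_trans (ge_of_tendsto hlim ?_) (by linarith)
  filter_upwards [h.lim δ hδ0] with n hn
  have cD := (h.jet n).cont 0 0 (by omega)
  have iD : IntegrableOn (fun z : ℝ × ℝ =>
      |D n 0 0 z.1 z.2 - bilin x₀ x₁ y₀ y₁ (D n 0 0) z.1 z.2|) (rect x₀ x₁ y₀ y₁) :=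
    integrableOn_rect_of_continuousOn (cD.sub (hcb _)).abs.continuousOn
  have iδ : IntegrableOn (fun _ : ℝ × ℝ => 2 * δ) (rect x₀ x₁ y₀ y₁) :=
    integrableOn_const volume_rect_lt_top.ne
  have h1 : ∫ z in rect x₀ x₁ y₀ y₁, |u z.1 z.2 - bilin x₀ x₁ y₀ y₁ u z.1 z.2| ≤
      ∫ z in rect x₀ x₁ y₀ y₁,
        (|D n 0 0 z.1 z.2 - bilin x₀ x₁ y₀ y₁ (D n 0 0) z.1 z.2| + 2 * δ) := by
    refine setIntegral_mono_on iu (iD.fun_add iδ) measurableSet_rect fun z hz => ?_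
    have hz := rect_subset_Icc hz
    have e1 := hn _ hz.1 _ hz.2
    have e2 := abs_bilin_sub_le hx hy hn hz.1 hz.2
    rw [abs_le] at e1 e2
    have e3 := neg_abs_le (D n 0 0 z.1 z.2 - bilin x₀ x₁ y₀ y₁ (D n 0 0) z.1 z.2)
    have e4 := le_abs_self (D n 0 0 z.1 z.2 - bilin x₀ x₁ y₀ y₁ (D n 0 0) z.1 z.2)
    rw [abs_le]
    constructor <;> linarith
  rw [integral_add iD iδ, setIntegral_const, smul_eq_mul,
    ← rectAbs_eq_setIntegral (f := fun x y => D n 0 0 x y - bilin x₀ x₁ y₀ y₁ (D n 0 0) x y)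
      (cD.sub (hcb _)) hx.le hy.le] at h1
  have h2 := (h.jet n).rectAbs_sub_bilin_le hx hy
  have h20 := h.le n 2 0 (by omega)
  have h02 := h.le n 0 2 (by omega)
  have h12 := h.le n 1 2 (by omega)
  have n20 := rectAbs_nonneg hx.le hy.le (D n 2 0)
  have n02 := rectAbs_nonneg hx.le hy.le (D n 0 2)
  have n12 := rectAbs_nonneg hx.le hy.le (D n 1 2)
  have hsn : 0 ≤ s n := n20.trans h20
  have hR0 : 0 ≤ R := hH0.le.trans hHR
  have h3 : (x₁ - x₀) ^ 2 * rectAbs x₀ x₁ y₀ y₁ (D n 2 0) + (y₁ - y₀) ^ 2 *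
      (rectAbs x₀ x₁ y₀ y₁ (D n 0 2) + (x₁ - x₀) * rectAbs x₀ x₁ y₀ y₁ (D n 1 2)) ≤
      H ^ 2 * s n + H ^ 2 * (s n + R * s n) := by
    have := hh.trans hHR
    gcongr
  linarith

end ElementLimits

/-! ### Grids, dual elements, and the interpolation error on the mid lines. -/

noncomputable section MeshGeometry

namespace Grid

variable {a b : ℝ} (X : Grid a b)

lemma pt_strictMonoOn : StrictMonoOn X.pt (Iic X.n) :=
  strictMonoOn_of_lt_succ ordConnected_Iic fun i _ _ hi => X.pt_lt i (by simpa using hi)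

lemma pt_lt_pt {i j : ℕ} (hij : i < j) (hj : j ≤ X.n) : X.pt i < X.pt j :=
  X.pt_strictMonoOn (hij.le.trans hj) hj hij

lemma pt_le_pt {i j : ℕ} (hij : i ≤ j) (hj : j ≤ X.n) : X.pt i ≤ X.pt j :=
  X.pt_strictMonoOn.monotoneOn (hij.trans hj) hj hij

lemma pt_mem_Icc {i : ℕ} (hi : i ≤ X.n) : X.pt i ∈ Icc a b :=
  ⟨X.pt_zero.symm.le.trans (X.pt_le_pt (Nat.zero_le i) hi), (X.pt_le_pt hi le_rfl).trans X.pt_last.le⟩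

lemma n_pos (hab : a < b) : 0 < X.n := by
  rcases Nat.eq_zero_or_pos X.n with h | h
  · have h1 := X.pt_zero
    have h2 := X.pt_last
    rw [h, h1] at h2
    exact absurd h2 hab.ne
  · exact h

lemma Icc_subset {i : ℕ} (hi : i < X.n) : Icc (X.pt i) (X.pt (i + 1)) ⊆ Icc a b :=
  Icc_subset_Icc (X.pt_mem_Icc hi.le).1 (X.pt_mem_Icc hi).2

lemma Ioo_subset {i : ℕ} (hi : i < X.n) : Ioo (X.pt i) (X.pt (i + 1)) ⊆ Ioo a b :=
  Ioo_subset_Ioo (X.pt_mem_Icc hi.le).1 (X.pt_mem_Icc hi).2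

/-- Midpoint of the `i`-th mesh interval. -/
def mid (i : ℕ) : ℝ := (X.pt i + X.pt (i + 1)) / 2

lemma mid_mem {i : ℕ} (hi : i < X.n) : X.mid i ∈ Ioo (X.pt i) (X.pt (i + 1)) := by
  have := X.pt_lt i hi
  constructor <;> unfold mid <;> linarith

lemma hat_left {i : ℕ} (hi : i < X.n) {t : ℝ} (ht : t ∈ Icc (X.pt i) (X.pt (i + 1))) :
    X.hat i t = (X.pt (i + 1) - t) / (X.pt (i + 1) - X.pt i) := by
  have h := X.pt_lt i hi
  have h1 : (X.pt (i + 1) - t) / (X.pt (i + 1) - X.pt i) ≤ 1 := by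
    rw [div_le_one (by linarith)]; linarith [ht.1]
  have h0 : 0 ≤ (X.pt (i + 1) - t) / (X.pt (i + 1) - X.pt i) :=
    div_nonneg (by linarith [ht.2]) (by linarith)
  unfold hat
  rw [if_neg hi.ne, min_eq_right, max_eq_right h0]
  split_ifs with h2
  · exact h1
  · refine h1.trans ?_
    have := X.pt_lt_pt (show i - 1 < i by omega) hi.le
    rw [one_le_div (by linarith)]
    linarith [ht.1]

lemma hat_right {i : ℕ} (hi : i < X.n) {t : ℝ} (ht : t ∈ Icc (X.pt i) (X.pt (i + 1))) :
    X.hat (i + 1) t = (t - X.pt i) / (X.pt (i + 1) - X.pt i) := by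
  have h := X.pt_lt i hi
  have h1 : (t - X.pt i) / (X.pt (i + 1) - X.pt i) ≤ 1 := by
    rw [div_le_one (by linarith)]; linarith [ht.2]
  have h0 : 0 ≤ (t - X.pt i) / (X.pt (i + 1) - X.pt i) :=
    div_nonneg (by linarith [ht.1]) (by linarith)
  unfold hat
  rw [if_neg (Nat.succ_ne_zero i), Nat.add_sub_cancel, min_eq_left, max_eq_right h0]
  split_ifs with h2
  · exact h1
  · refine h1.trans ?_
    have := X.pt_lt_pt (show i + 1 < i + 1 + 1 by omega) (by omega)
    rw [one_le_div (by linarith)]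
    linarith [ht.2]

lemma hat_eq_zero {i k : ℕ} (hi : i < X.n) (hk : k ≤ X.n) (h1 : k ≠ i) (h2 : k ≠ i + 1) {t : ℝ}
    (ht : t ∈ Icc (X.pt i) (X.pt (i + 1))) : X.hat k t = 0 := by
  unfold hat
  refine max_eq_left ?_
  rcases lt_or_gt_of_ne h1 with h | h
  · refine (min_le_right _ _).trans ?_
    rw [if_neg (by omega)]
    have e1 := X.pt_le_pt (show k + 1 ≤ i by omega) hi.le
    have e2 := X.pt_lt k (by omega)
    exact div_nonpos_of_nonpos_of_nonneg (by linarith [ht.1]) (by linarith)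
  · refine (min_le_left _ _).trans ?_
    rw [if_neg (by omega)]
    have e1 := X.pt_le_pt (show i + 1 ≤ k - 1 by omega) (by omega)
    have e2 := X.pt_lt_pt (show k - 1 < k by omega) hk
    exact div_nonpos_of_nonpos_of_nonneg (by linarith [ht.2]) (by linarith)

/-- On a mesh interval only the hats of its two end points are nonzero. -/
lemma sum_mul_hat {i : ℕ} (hi : i < X.n) {t : ℝ} (ht : t ∈ Icc (X.pt i) (X.pt (i + 1)))
    (f : ℕ → ℝ) : ∑ k : Fin (X.n + 1), f k * X.hat k t =
      ((X.pt (i + 1) - t) * f i + (t - X.pt i) * f (i + 1)) / (X.pt (i + 1) - X.pt i) := by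
  rw [Fin.sum_univ_eq_sum_range (fun k => f k * X.hat k t) (X.n + 1),
    Finset.sum_eq_add i (i + 1) (by omega)]
  · rw [X.hat_left hi ht, X.hat_right hi ht]
    ring
  · intro k hk h
    rw [X.hat_eq_zero hi (by simpa [Nat.lt_succ_iff] using hk) h.1 h.2 ht, mul_zero]
  · intro h
    exact absurd (Finset.mem_range.2 (by omega)) h
  · intro h
    exact absurd (Finset.mem_range.2 (by omega)) h

lemma dualLeft_of_pos {i : ℕ} (hi : 0 < i) : X.dualLeft i = X.mid (i - 1) := by
  rw [dualLeft, if_neg hi.ne', mid, Nat.sub_add_cancel hi]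

lemma dualRight_of_lt {i : ℕ} (hi : i < X.n) : X.dualRight i = X.mid i := by
  rw [dualRight, if_neg hi.ne, mid]

lemma dualLeft_le {i : ℕ} (hi : i ≤ X.n) : X.dualLeft i ≤ X.pt i := by
  rcases Nat.eq_zero_or_pos i with rfl | h
  · simp [dualLeft]
  · rw [X.dualLeft_of_pos h]
    have := (X.mid_mem (show i - 1 < X.n by omega)).2
    rw [Nat.sub_add_cancel h] at this
    exact this.le

lemma le_dualRight {i : ℕ} (hi : i ≤ X.n) : X.pt i ≤ X.dualRight i := by
  rcases hi.eq_or_lt with rfl | h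
  · simp [dualRight]
  · rw [X.dualRight_of_lt h]
    exact (X.mid_mem h).1.le

lemma dualLeft_lt_dualRight (hab : a < b) {i : ℕ} (hi : i ≤ X.n) :
    X.dualLeft i < X.dualRight i := by
  rcases hi.eq_or_lt with h | h
  · have hn := X.n_pos hab
    refine lt_of_lt_of_le ?_ (X.le_dualRight hi)
    rw [X.dualLeft_of_pos (by omega)]
    have := (X.mid_mem (show i - 1 < X.n by omega)).2
    rwa [Nat.sub_add_cancel (by omega)] at this
  · refine lt_of_le_of_lt (X.dualLeft_le hi) ?_
    rw [X.dualRight_of_lt h]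
    exact (X.mid_mem h).1

lemma dualRight_le_dualLeft {i k : ℕ} (hik : i < k) (hk : k ≤ X.n) :
    X.dualRight i ≤ X.dualLeft k := by
  rw [X.dualRight_of_lt (by omega), X.dualLeft_of_pos (by omega)]
  rcases (show i ≤ k - 1 by omega).eq_or_lt with h | h
  · rw [h]
  · exact ((X.mid_mem (by omega)).2.le.trans (X.pt_le_pt (show i + 1 ≤ k - 1 by omega) (by omega))).trans
      (X.mid_mem (by omega)).1.le

lemma eq_of_mem_dual {i k : ℕ} (hi : i ≤ X.n) (hk : k ≤ X.n) {t : ℝ}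
    (h1 : t ∈ Ioo (X.dualLeft i) (X.dualRight i)) (h2 : t ∈ Ioo (X.dualLeft k) (X.dualRight k)) :
    i = k := by
  rcases lt_trichotomy i k with h | h | h
  · have := X.dualRight_le_dualLeft h hk
    linarith [h1.2, h2.1]
  · exact h
  · have := X.dualRight_le_dualLeft h hi
    linarith [h2.2, h1.1]

lemma dual_subset {i : ℕ} (hi : i ≤ X.n) : Ioo (X.dualLeft i) (X.dualRight i) ⊆ Ioo a b := by
  refine Ioo_subset_Ioo ?_ ?_
  · rcases Nat.eq_zero_or_pos i with rfl | h
    · simp [dualLeft, X.pt_zero]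
    · rw [X.dualLeft_of_pos h]
      exact (X.Ioo_subset (by omega) (X.mid_mem (show i - 1 < X.n by omega))).1.le
  · rcases hi.eq_or_lt with rfl | h
    · simp [dualRight, X.pt_last]
    · rw [X.dualRight_of_lt h]
      exact (X.Ioo_subset h (X.mid_mem h)).2.le

/-- A dual interval meets only the two adjacent mesh intervals. -/
lemma eq_or_eq_of_mem {i k : ℕ} (hi : i < X.n) (hk : k ≤ X.n) {t : ℝ}
    (h1 : t ∈ Ioo (X.pt i) (X.pt (i + 1))) (h2 : t ∈ Ioo (X.dualLeft k) (X.dualRight k)) :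
    k = i ∨ k = i + 1 := by
  by_contra hne
  push Not at hne
  rcases lt_or_gt_of_ne hne.1 with h | h
  · have e1 := h2.2
    rw [X.dualRight_of_lt (by omega)] at e1
    have e2 := (X.mid_mem (show k < X.n by omega)).2
    have e3 := X.pt_le_pt (show k + 1 ≤ i by omega) hi.le
    linarith [h1.1]
  · have e1 := h2.1
    rw [X.dualLeft_of_pos (by omega)] at e1
    have e2 := (X.mid_mem (show k - 1 < X.n by omega)).1
    have e3 := X.pt_le_pt (show i + 1 ≤ k - 1 by omega) (by omega)
    linarith [h1.2]

lemma eq_of_mem_elem {i k : ℕ} (hi : i < X.n) (hk : k < X.n) {t : ℝ}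
    (h1 : t ∈ Ioo (X.pt i) (X.pt (i + 1))) (h2 : t ∈ Ioo (X.pt k) (X.pt (k + 1))) : i = k := by
  rcases lt_trichotomy i k with h | h | h
  · have := X.pt_le_pt (show i + 1 ≤ k by omega) hk.le
    linarith [h1.2, h2.1]
  · exact h
  · have := X.pt_le_pt (show k + 1 ≤ i by omega) hi.le
    linarith [h2.2, h1.1]

/-- Points that are not grid points lie in an open mesh interval. -/
lemma exists_mem_Ioo {t : ℝ} (ht : t ∈ Ioo a b) (hne : ∀ i ≤ X.n, t ≠ X.pt i) :
    ∃ i < X.n, t ∈ Ioo (X.pt i) (X.pt (i + 1)) := by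
  by_contra hcon
  push Not at hcon
  have key : ∀ i ≤ X.n, X.pt i < t := by
    intro i
    induction i with
    | zero => intro _; rw [X.pt_zero]; exact ht.1
    | succ i ih =>
      intro hi
      by_contra h
      exact hcon i hi ⟨ih (by omega), lt_of_le_of_ne (not_lt.1 h) (hne _ hi)⟩
  have := key X.n le_rfl
  rw [X.pt_last] at this
  linarith [ht.2]

lemma ae_ne_pt : ∀ᵐ t : ℝ, ∀ i ≤ X.n, t ≠ X.pt i := by
  have : ∀ᵐ t : ℝ, ∀ i : ℕ, t ≠ X.pt i := ae_all_iff.2 fun i => Measure.ae_ne volume (X.pt i)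
  exact this.mono fun t h i _ => h i

end Grid

namespace Mesh

variable {a b c d : ℝ} (T : Mesh a b c d)

/-- The open element. -/
def elem (i j : ℕ) : Set (ℝ × ℝ) := rect (T.X.pt i) (T.X.pt (i + 1)) (T.Y.pt j) (T.Y.pt (j + 1))

lemma sum_node (F : ℕ → ℕ → ℝ) : ∑ P : T.Node, F P.1 P.2 =
    ∑ i ∈ Finset.range (T.X.n + 1), ∑ j ∈ Finset.range (T.Y.n + 1), F i j := by
  rw [Fintype.sum_prod_type, ← Fin.sum_univ_eq_sum_range
    (fun i => ∑ j ∈ Finset.range (T.Y.n + 1), F i j)]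
  exact Finset.sum_congr rfl fun i _ => Fin.sum_univ_eq_sum_range (fun j => F i j) _

lemma sum_elem (F : ℕ → ℕ → ℝ) : ∑ K : T.Elem, F K.1 K.2 =
    ∑ i ∈ Finset.range T.X.n, ∑ j ∈ Finset.range T.Y.n, F i j := by
  rw [Fintype.sum_prod_type, ← Fin.sum_univ_eq_sum_range
    (fun i => ∑ j ∈ Finset.range T.Y.n, F i j)]
  exact Finset.sum_congr rfl fun i _ => Fin.sum_univ_eq_sum_range (fun j => F i j) _

lemma interp_eq_bilin (u : ℝ × ℝ → ℝ) {i j : ℕ} (hi : i < T.X.n) (hj : j < T.Y.n) {x y : ℝ}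
    (hx : x ∈ Icc (T.X.pt i) (T.X.pt (i + 1))) (hy : y ∈ Icc (T.Y.pt j) (T.Y.pt (j + 1))) :
    T.interp u (x, y) = bilin (T.X.pt i) (T.X.pt (i + 1)) (T.Y.pt j) (T.Y.pt (j + 1))
      (fun x y => u (x, y)) x y := by
  have h1 : ∀ k : ℕ, ∑ l : Fin (T.Y.n + 1), u (T.X.pt k, T.Y.pt l) * T.Y.hat l y = _ := fun k =>
    T.Y.sum_mul_hat hj hy fun l => u (T.X.pt k, T.Y.pt l)
  have h2 := T.X.sum_mul_hat hi hx fun k => ((T.Y.pt (j + 1) - y) * u (T.X.pt k, T.Y.pt j) +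
    (y - T.Y.pt j) * u (T.X.pt k, T.Y.pt (j + 1))) / (T.Y.pt (j + 1) - T.Y.pt j)
  have h3 := T.X.pt_lt i hi
  have h4 := T.Y.pt_lt j hj
  calc T.interp u (x, y) = ∑ k : Fin (T.X.n + 1),
        (∑ l : Fin (T.Y.n + 1), u (T.X.pt k, T.Y.pt l) * T.Y.hat l y) * T.X.hat k x := by
        rw [interp, Fintype.sum_prod_type]
        refine Finset.sum_congr rfl fun k _ => ?_
        rw [Finset.sum_mul]
        refine Finset.sum_congr rfl fun l _ => ?_
        simp only [point]
        ring
    _ = _ := by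
        simp only [h1]
        rw [h2, bilin]
        have h5 : T.X.pt (i + 1) - T.X.pt i ≠ 0 := by linarith
        have h6 : T.Y.pt (j + 1) - T.Y.pt j ≠ 0 := by linarith
        field_simp

section Flux

variable {u ux uy : ℝ × ℝ → ℝ}

/-- Near a point of an open element the interpolant coincides with one bilinear function, so its
classical derivative exists there; across mesh lines it need not. -/
lemma pdx_sub_interp {i j : ℕ} (hi : i < T.X.n) (hj : j < T.Y.n) {x y : ℝ}
    (hx : x ∈ Ioo (T.X.pt i) (T.X.pt (i + 1))) (hy : y ∈ Ioo (T.Y.pt j) (T.Y.pt (j + 1)))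
    (hu : HasDerivAt (fun s => u (s, y)) (ux (x, y)) x) :
    pdx (u - T.interp u) (x, y) = ux (x, y) -
      bilinDx (T.X.pt i) (T.X.pt (i + 1)) (T.Y.pt j) (T.Y.pt (j + 1)) (fun x y => u (x, y)) y := by
  have hb : HasDerivAt (fun s => bilin (T.X.pt i) (T.X.pt (i + 1)) (T.Y.pt j) (T.Y.pt (j + 1))
      (fun x y => u (x, y)) s y) (bilinDx (T.X.pt i) (T.X.pt (i + 1)) (T.Y.pt j) (T.Y.pt (j + 1))
        (fun x y => u (x, y)) y) x := by
    unfold bilin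
    have h1 := ((hasDerivAt_id' x).const_sub (T.X.pt (i + 1))).mul_const
      ((T.Y.pt (j + 1) - y) * u (T.X.pt i, T.Y.pt j) +
        (y - T.Y.pt j) * u (T.X.pt i, T.Y.pt (j + 1)))
    have h2 := ((hasDerivAt_id' x).sub_const (T.X.pt i)).mul_const
      ((T.Y.pt (j + 1) - y) * u (T.X.pt (i + 1), T.Y.pt j) +
        (y - T.Y.pt j) * u (T.X.pt (i + 1), T.Y.pt (j + 1)))
    refine ((h1.fun_add h2).div_const _).congr_deriv ?_
    rw [bilinDx]
    ring
  have he : (fun s => T.interp u (s, y)) =ᶠ[𝓝 x] fun s => bilin (T.X.pt i) (T.X.pt (i + 1))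
      (T.Y.pt j) (T.Y.pt (j + 1)) (fun x y => u (x, y)) s y := by
    filter_upwards [isOpen_Ioo.mem_nhds hx] with s hs
    exact T.interp_eq_bilin u hi hj (Ioo_subset_Icc_self hs) (Ioo_subset_Icc_self hy)
  exact (hu.fun_sub (hb.congr_of_eventuallyEq he)).deriv

lemma pdy_sub_interp {i j : ℕ} (hi : i < T.X.n) (hj : j < T.Y.n) {x y : ℝ}
    (hx : x ∈ Ioo (T.X.pt i) (T.X.pt (i + 1))) (hy : y ∈ Ioo (T.Y.pt j) (T.Y.pt (j + 1)))
    (hu : HasDerivAt (fun s => u (x, s)) (uy (x, y)) y) :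
    pdy (u - T.interp u) (x, y) = uy (x, y) -
      bilinDx (T.Y.pt j) (T.Y.pt (j + 1)) (T.X.pt i) (T.X.pt (i + 1)) (fun y x => u (x, y)) x := by
  have hb : HasDerivAt (fun s => bilin (T.X.pt i) (T.X.pt (i + 1)) (T.Y.pt j) (T.Y.pt (j + 1))
      (fun x y => u (x, y)) x s) (bilinDx (T.Y.pt j) (T.Y.pt (j + 1)) (T.X.pt i) (T.X.pt (i + 1))
        (fun y x => u (x, y)) x) y := by
    unfold bilin
    have h1 := (((hasDerivAt_id' y).const_sub (T.Y.pt (j + 1))).mul_const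
      (u (T.X.pt i, T.Y.pt j))).fun_add (((hasDerivAt_id' y).sub_const (T.Y.pt j)).mul_const
        (u (T.X.pt i, T.Y.pt (j + 1))))
    have h2 := (((hasDerivAt_id' y).const_sub (T.Y.pt (j + 1))).mul_const
      (u (T.X.pt (i + 1), T.Y.pt j))).fun_add (((hasDerivAt_id' y).sub_const (T.Y.pt j)).mul_const
        (u (T.X.pt (i + 1), T.Y.pt (j + 1))))
    refine (((h1.const_mul (T.X.pt (i + 1) - x)).fun_add
      (h2.const_mul (x - T.X.pt i))).div_const _).congr_deriv ?_
    rw [bilinDx]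
    ring
  have he : (fun s => T.interp u (x, s)) =ᶠ[𝓝 y] fun s => bilin (T.X.pt i) (T.X.pt (i + 1))
      (T.Y.pt j) (T.Y.pt (j + 1)) (fun x y => u (x, y)) x s := by
    filter_upwards [isOpen_Ioo.mem_nhds hy] with s hs
    exact T.interp_eq_bilin u hi hj (Ioo_subset_Icc_self hx) (Ioo_subset_Icc_self hs)
  exact (hu.fun_sub (hb.congr_of_eventuallyEq he)).deriv

/-- The tangential derivative of the bilinear interpolant is constant along a mid line. This
identifies the value read off at the midpoint with the form used in `midFlux`; for `x₁ = x₀` both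
sides are divisions by zero. -/
lemma bilinDx_mid {x₀ x₁ y₀ y₁ : ℝ} (hy : y₀ < y₁) (u : ℝ → ℝ → ℝ) :
    bilinDx x₀ x₁ y₀ y₁ u ((y₀ + y₁) / 2) = bilinDyMid y₀ y₁ x₀ x₁ fun y x => u x y := by
  have : y₁ - y₀ ≠ 0 := by linarith
  rw [bilinDx, bilinDyMid]
  rcases eq_or_ne x₁ x₀ with rfl | h
  · simp
  · have h' : x₁ - x₀ ≠ 0 := sub_ne_zero.2 h
    field_simp
    ring

variable {A : ℝ × ℝ → Matrix (Fin 2) (Fin 2) ℝ} {B : Fin 2 → Fin 2 → ℝ × ℝ → ℝ}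

/-- The edges of dual elements run along mid lines of elements, so apart from the crossings with
mesh lines the pointwise gradient in the bilinear form is the classical one. -/
lemma flux_vertical (hB : ∀ z ∈ rect a b c d, ∀ k l, A z k l = B k l z)
    (hux : ∀ z ∈ rect a b c d, HasDerivAt (fun s => u (s, z.2)) (ux z) z.1)
    (huy : ∀ z ∈ rect a b c d, HasDerivAt (fun s => u (z.1, s)) (uy z) z.2)
    {i j : ℕ} (hi : i < T.X.n) (hj : j < T.Y.n) {y : ℝ}
    (hy : y ∈ Ioo (T.Y.pt j) (T.Y.pt (j + 1))) :
    flux A (u - T.interp u) (T.X.mid i, y) 0 =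
      midFlux (T.X.pt i) (T.X.pt (i + 1)) (T.Y.pt j) (T.Y.pt (j + 1)) (fun x y => B 0 0 (x, y))
        (fun x y => B 0 1 (x, y)) (fun x y => u (x, y)) (fun x y => ux (x, y))
        (fun x y => uy (x, y)) y := by
  have hx := T.X.mid_mem hi
  have hz : (T.X.mid i, y) ∈ rect a b c d := ⟨T.X.Ioo_subset hi hx, T.Y.Ioo_subset hj hy⟩
  have e := bilinDx_mid (x₀ := T.Y.pt j) (x₁ := T.Y.pt (j + 1)) (T.X.pt_lt i hi)
    fun y x => u (x, y)
  simp only [flux, Matrix.mulVec, dotProduct, Fin.sum_univ_two, hB _ hz, Matrix.cons_val_zero,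
    Matrix.cons_val_one]
  rw [T.pdx_sub_interp hi hj hx hy (hux _ hz), T.pdy_sub_interp hi hj hx hy (huy _ hz), midFlux,
    ← e]
  rfl

lemma flux_horizontal (hB : ∀ z ∈ rect a b c d, ∀ k l, A z k l = B k l z)
    (hux : ∀ z ∈ rect a b c d, HasDerivAt (fun s => u (s, z.2)) (ux z) z.1)
    (huy : ∀ z ∈ rect a b c d, HasDerivAt (fun s => u (z.1, s)) (uy z) z.2)
    {i j : ℕ} (hi : i < T.X.n) (hj : j < T.Y.n) {x : ℝ}
    (hx : x ∈ Ioo (T.X.pt i) (T.X.pt (i + 1))) :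
    flux A (u - T.interp u) (x, T.Y.mid j) 1 =
      midFlux (T.Y.pt j) (T.Y.pt (j + 1)) (T.X.pt i) (T.X.pt (i + 1)) (fun y x => B 1 1 (x, y))
        (fun y x => B 1 0 (x, y)) (fun y x => u (x, y)) (fun y x => uy (x, y))
        (fun y x => ux (x, y)) x := by
  have hy := T.Y.mid_mem hj
  have hz : (x, T.Y.mid j) ∈ rect a b c d := ⟨T.X.Ioo_subset hi hx, T.Y.Ioo_subset hj hy⟩
  have e := bilinDx_mid (x₀ := T.X.pt i) (x₁ := T.X.pt (i + 1)) (T.Y.pt_lt j hj)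
    fun x y => u (x, y)
  simp only [flux, Matrix.mulVec, dotProduct, Fin.sum_univ_two, hB _ hz, Matrix.cons_val_zero,
    Matrix.cons_val_one]
  rw [T.pdx_sub_interp hi hj hx hy (hux _ hz), T.pdy_sub_interp hi hj hx hy (huy _ hz), midFlux,
    ← e, add_comm]
  rfl

end Flux

/-! ### Dual elements -/

lemma dualElem_eq_of_mem {P Q : T.Node} {z : ℝ × ℝ} (hP : z ∈ T.dualElem P)
    (hQ : z ∈ T.dualElem Q) : P = Q :=
  Prod.ext (Fin.ext (T.X.eq_of_mem_dual (Nat.lt_succ_iff.1 P.1.2) (Nat.lt_succ_iff.1 Q.1.2) hP.1 hQ.1))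
    (Fin.ext (T.Y.eq_of_mem_dual (Nat.lt_succ_iff.1 P.2.2) (Nat.lt_succ_iff.1 Q.2.2) hP.2 hQ.2))

lemma dualInterp_apply {P : T.Node} {z : ℝ × ℝ} (hP : z ∈ T.dualElem P) (v : ℝ × ℝ → ℝ) :
    T.dualInterp v z = v (T.point P) := by
  rw [dualInterp, Finset.sum_eq_single P]
  · simp [hP]
  · intro Q _ hQ
    rw [indicator_of_notMem, mul_zero]
    exact fun h => hQ (T.dualElem_eq_of_mem h hP)
  · simp

lemma dualCenter_mem (hab : a < b) (hcd : c < d) (P : T.Node) :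
    T.dualCenter P ∈ T.dualElem P := by
  have h1 := T.X.dualLeft_lt_dualRight hab (Nat.lt_succ_iff.1 P.1.2)
  have h2 := T.Y.dualLeft_lt_dualRight hcd (Nat.lt_succ_iff.1 P.2.2)
  refine ⟨⟨?_, ?_⟩, ?_, ?_⟩ <;> simp only [dualCenter] <;> linarith

lemma dualElem_subset (P : T.Node) : T.dualElem P ⊆ rect a b c d :=
  prod_mono (T.X.dual_subset (Nat.lt_succ_iff.1 P.1.2)) (T.Y.dual_subset (Nat.lt_succ_iff.1 P.2.2))

lemma measurableSet_dualElem (P : T.Node) : MeasurableSet (T.dualElem P) := measurableSet_rect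

lemma fveForm_dualInterp (hab : a < b) (hcd : c < d) (A : ℝ × ℝ → Matrix (Fin 2) (Fin 2) ℝ)
    (c₀ w v : ℝ × ℝ → ℝ) : fveForm T A c₀ w (T.dualInterp v) =
      (∑ P : T.Node, -(boundaryFlux (T.X.dualLeft P.1) (T.X.dualRight P.1) (T.Y.dualLeft P.2)
        (T.Y.dualRight P.2) (flux A w) * v (T.point P))) +
      ∑ P : T.Node, ∫ z in T.dualElem P, c₀ z * w z * v (T.point P) := by
  rw [fveForm, ← Finset.sum_add_distrib]
  refine Finset.sum_congr rfl fun P _ => ?_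
  rw [T.dualInterp_apply (T.dualCenter_mem hab hcd P)]
  congr 1
  exact setIntegral_congr_fun (T.measurableSet_dualElem P) fun z hz => by
    simp only [T.dualInterp_apply hz]

end Mesh

end MeshGeometry

/-! ### The diffusion part: summation by parts and telescoping. -/

noncomputable section FluxPart

/-! ### Summation by parts -/

/-- Abel summation. The truncated index `i - 1` at `i = 0` and the value `P n` do not matter,
because `V` vanishes at both ends. -/
lemma sum_mul_shift_sub {n : ℕ} {V : ℕ → ℝ} (P : ℕ → ℝ) (h0 : V 0 = 0) (hn : V n = 0) :
    ∑ i ∈ Finset.range (n + 1), V i * (P (i - 1) - P i) =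
      ∑ i ∈ Finset.range n, (V (i + 1) - V i) * P i := by
  simp only [mul_sub, sub_mul, Finset.sum_sub_distrib]
  rw [Finset.sum_range_succ', Finset.sum_range_succ (fun i => V i * P i)]
  simp [h0, hn]

lemma sum_mul_shift_add {n : ℕ} {V : ℕ → ℝ} (P Q : ℕ → ℝ) (h0 : V 0 = 0) (hn : V n = 0) :
    ∑ i ∈ Finset.range (n + 1), V i * (P (i - 1) + Q i) =
      ∑ i ∈ Finset.range n, (V (i + 1) * P i + V i * Q i) := by
  simp only [mul_add, Finset.sum_add_distrib]
  rw [Finset.sum_range_succ', Finset.sum_range_succ (fun i => V i * Q i)]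
  simp [h0, hn]

/-- Rearrangement of a sum over dual elements into a sum over elements, one direction. -/
lemma sum_node_eq_sum_elem {n m : ℕ} {V : ℕ → ℕ → ℝ} (lo hi : ℕ → ℕ → ℝ) (h0 : ∀ j, V 0 j = 0)
    (hn : ∀ j, V n j = 0) (h0' : ∀ i, V i 0 = 0) (hm : ∀ i, V i m = 0) :
    ∑ i ∈ Finset.range (n + 1), ∑ j ∈ Finset.range (m + 1),
        V i j * ((hi (i - 1) (j - 1) + lo (i - 1) j) - (hi i (j - 1) + lo i j)) =
      ∑ i ∈ Finset.range n, ∑ j ∈ Finset.range m,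
        ((V (i + 1) j - V i j) * lo i j + (V (i + 1) (j + 1) - V i (j + 1)) * hi i j) := by
  -- A dual edge on the mid line of column `i` consists of the upper half from row `j - 1` and the
  -- lower half from row `j`. Abel summation in `i` produces the increments of `V`; regrouping in
  -- `j` then collects the two halves in one element.
  rw [Finset.sum_comm]
  simp only [fun j => sum_mul_shift_sub (V := fun i => V i j)
    (fun i => hi i (j - 1) + lo i j) (h0 j) (hn j)]
  rw [Finset.sum_comm]
  refine Finset.sum_congr rfl fun i _ => ?_
  rw [sum_mul_shift_add (V := fun j => V (i + 1) j - V i j) (fun j => hi i j) (fun j => lo i j)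
    (by simp [h0']) (by simp [hm])]
  exact Finset.sum_congr rfl fun j _ => add_comm _ _

/-! ### Integrals of functions given on an open interval -/

/-- The flux is identified only inside open mesh intervals; the missing end points are a null set.
-/
lemma integral_congr_Ioo {f g : ℝ → ℝ} {p q s t : ℝ} (h : EqOn f g (Ioo p q)) (hs : p ≤ s)
    (hst : s ≤ t) (ht : t ≤ q) : ∫ y in s..t, f y = ∫ y in s..t, g y := by
  rw [intervalIntegral.integral_of_le hst, intervalIntegral.integral_of_le hst,
    integral_Ioc_eq_integral_Ioo, integral_Ioc_eq_integral_Ioo]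
  exact setIntegral_congr_fun measurableSet_Ioo (h.mono (Ioo_subset_Ioo hs ht))

lemma intervalIntegrable_congr_Ioo {f g : ℝ → ℝ} {p q s t : ℝ} (h : EqOn f g (Ioo p q))
    (hg : ContinuousOn g (Icc p q)) (hs : p ≤ s) (hst : s ≤ t) (ht : t ≤ q) :
    IntervalIntegrable f volume s t := by
  rw [intervalIntegrable_iff_integrableOn_Ioo_of_le hst]
  refine (((hg.integrableOn_Icc).mono_set ?_).congr_fun
    (h.mono (Ioo_subset_Ioo hs ht)).symm measurableSet_Ioo)
  exact Ioo_subset_Icc_self.trans (Icc_subset_Icc hs ht)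

lemma continuousOn_midFlux {x₀ x₁ y₀ y₁ : ℝ} (hx : x₀ ≤ x₁) {a₁ a₂ u ux uy : ℝ → ℝ → ℝ}
    (h₁ : Continuous (Function.uncurry a₁)) (h₂ : Continuous (Function.uncurry a₂))
    (hux : ContinuousOn (Function.uncurry ux) (Icc x₀ x₁ ×ˢ Icc y₀ y₁))
    (huy : ContinuousOn (Function.uncurry uy) (Icc x₀ x₁ ×ˢ Icc y₀ y₁)) :
    ContinuousOn (midFlux x₀ x₁ y₀ y₁ a₁ a₂ u ux uy) (Icc y₀ y₁) := by
  have hxm : (x₀ + x₁) / 2 ∈ Icc x₀ x₁ := ⟨by linarith, by linarith⟩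
  have hm : MapsTo (fun y => ((x₀ + x₁) / 2, y)) (Icc y₀ y₁) (Icc x₀ x₁ ×ˢ Icc y₀ y₁) :=
    fun y hy => ⟨hxm, hy⟩
  have hc : ContinuousOn (fun y : ℝ => ((x₀ + x₁) / 2, y)) (Icc y₀ y₁) := by fun_prop
  have c1 := (Continuous.curry_left h₁ ((x₀ + x₁) / 2)).continuousOn (s := Icc y₀ y₁)
  have c2 := (Continuous.curry_left h₂ ((x₀ + x₁) / 2)).continuousOn (s := Icc y₀ y₁)
  have c3 : ContinuousOn (fun y => ux ((x₀ + x₁) / 2) y) (Icc y₀ y₁) := hux.comp hc hm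
  have c4 : ContinuousOn (fun y => uy ((x₀ + x₁) / 2) y) (Icc y₀ y₁) := huy.comp hc hm
  have c5 : ContinuousOn (bilinDx x₀ x₁ y₀ y₁ u) (Icc y₀ y₁) := by
    unfold bilinDx
    fun_prop
  exact (c1.mul (c3.sub c5)).add (c2.mul (c4.sub continuousOn_const))

namespace Mesh

variable {a b c d : ℝ} (T : Mesh a b c d)

/-- Summation of element contributions along the `x`-direction: the edge terms cancel. -/
lemma abs_sum_le_of_telescoping {n m : ℕ} {F E Q : ℕ → ℕ → ℝ} (hE0 : ∀ j < m, E 0 j = 0)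
    (hEn : ∀ j < m, E n j = 0)
    (h : ∀ i < n, ∀ j < m, |F i j - (E (i + 1) j - E i j) / 2| ≤ Q i j) :
    |∑ i ∈ Finset.range n, ∑ j ∈ Finset.range m, F i j| ≤
      ∑ i ∈ Finset.range n, ∑ j ∈ Finset.range m, Q i j := by
  have e : ∑ i ∈ Finset.range n, ∑ j ∈ Finset.range m, F i j =
      ∑ i ∈ Finset.range n, ∑ j ∈ Finset.range m, (F i j - (E (i + 1) j - E i j) / 2) := by
    simp only [Finset.sum_sub_distrib]
    rw [eq_comm, sub_eq_self, Finset.sum_comm]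
    refine Finset.sum_eq_zero fun j hj => ?_
    rw [← Finset.sum_div, Finset.sum_range_sub (fun i => E i j), hE0 j (Finset.mem_range.1 hj),
      hEn j (Finset.mem_range.1 hj)]
    simp
  rw [e]
  refine (Finset.abs_sum_le_sum_abs _ _).trans (Finset.sum_le_sum fun i hi => ?_)
  refine (Finset.abs_sum_le_sum_abs _ _).trans (Finset.sum_le_sum fun j hj => ?_)
  exact h i (Finset.mem_range.1 hi) j (Finset.mem_range.1 hj)

/-- Flux on the two halves of an interior dual edge. -/
lemma integral_dual_eq {a b : ℝ} (X : Grid a b) {j : ℕ} (h0 : 0 < j) (hj : j < X.n) {f : ℝ → ℝ}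
    (hf : ∀ k < X.n, ∀ s t, X.pt k ≤ s → s ≤ t → t ≤ X.pt (k + 1) →
      IntervalIntegrable f volume s t) :
    ∫ y in X.dualLeft j..X.dualRight j, f y =
      (∫ y in X.mid (j - 1)..X.pt (j - 1 + 1), f y) + ∫ y in X.pt j..X.mid j, f y := by
  rw [X.dualLeft_of_pos h0, X.dualRight_of_lt hj]
  have m1 := X.mid_mem (show j - 1 < X.n by omega)
  have m2 := X.mid_mem hj
  have i1 := hf (j - 1) (by omega) _ _ m1.1.le m1.2.le le_rfl
  have i2 := hf j hj _ _ le_rfl m2.1.le m2.2.le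
  rw [Nat.sub_add_cancel h0] at i1 ⊢
  exact (intervalIntegral.integral_add_adjacent_intervals i1 i2).symm

variable {u ux uy v : ℝ × ℝ → ℝ} {A : ℝ × ℝ → Matrix (Fin 2) (Fin 2) ℝ}
  {B : Fin 2 → Fin 2 → ℝ × ℝ → ℝ}

/-- The contribution of the vertical mid line of an element. -/
abbrev vertTerm (B : Fin 2 → Fin 2 → ℝ × ℝ → ℝ) (u ux uy v : ℝ × ℝ → ℝ) (i j : ℕ) : ℝ :=
  vertFlux (T.X.pt i) (T.X.pt (i + 1)) (T.Y.pt j) (T.Y.pt (j + 1))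
    (v (T.X.pt (i + 1), T.Y.pt j) - v (T.X.pt i, T.Y.pt j))
    (v (T.X.pt (i + 1), T.Y.pt (j + 1)) - v (T.X.pt i, T.Y.pt (j + 1)))
    (fun x y => B 0 0 (x, y)) (fun x y => B 0 1 (x, y)) (fun x y => u (x, y))
    (fun x y => ux (x, y)) (fun x y => uy (x, y))

/-- The contribution of the horizontal mid line of an element. -/
abbrev horTerm (B : Fin 2 → Fin 2 → ℝ × ℝ → ℝ) (u ux uy v : ℝ × ℝ → ℝ) (i j : ℕ) : ℝ :=
  vertFlux (T.Y.pt j) (T.Y.pt (j + 1)) (T.X.pt i) (T.X.pt (i + 1))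
    (v (T.X.pt i, T.Y.pt (j + 1)) - v (T.X.pt i, T.Y.pt j))
    (v (T.X.pt (i + 1), T.Y.pt (j + 1)) - v (T.X.pt (i + 1), T.Y.pt j))
    (fun y x => B 1 1 (x, y)) (fun y x => B 1 0 (x, y)) (fun y x => u (x, y))
    (fun y x => uy (x, y)) (fun y x => ux (x, y))

/-- Each half mid line occurs in the boundaries of exactly two dual elements, with opposite normals,
so in the sum its flux is multiplied by the increment of `v` between their nodes. -/
lemma sum_boundaryFlux_eq (hB : ∀ z ∈ rect a b c d, ∀ k l, A z k l = B k l z)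
    (hBc : ∀ k l, Continuous (B k l))
    (cux : ContinuousOn ux (Icc a b ×ˢ Icc c d)) (cuy : ContinuousOn uy (Icc a b ×ˢ Icc c d))
    (hux : ∀ z ∈ rect a b c d, HasDerivAt (fun s => u (s, z.2)) (ux z) z.1)
    (huy : ∀ z ∈ rect a b c d, HasDerivAt (fun s => u (z.1, s)) (uy z) z.2)
    (hvx : ∀ y, v (a, y) = 0 ∧ v (b, y) = 0) (hvy : ∀ x, v (x, c) = 0 ∧ v (x, d) = 0) :
    ∑ P : T.Node, -(boundaryFlux (T.X.dualLeft P.1) (T.X.dualRight P.1) (T.Y.dualLeft P.2)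
        (T.Y.dualRight P.2) (flux A (u - T.interp u)) * v (T.point P)) =
      (∑ i ∈ Finset.range T.X.n, ∑ j ∈ Finset.range T.Y.n, T.vertTerm B u ux uy v i j) +
        ∑ i ∈ Finset.range T.X.n, ∑ j ∈ Finset.range T.Y.n, T.horTerm B u ux uy v i j := by
  set fv : ℕ → ℝ → ℝ := fun i y => flux A (u - T.interp u) (T.X.mid i, y) 0 with hfv
  set fh : ℕ → ℝ → ℝ := fun j x => flux A (u - T.interp u) (x, T.Y.mid j) 1 with hfh
  set Vlo : ℕ → ℕ → ℝ := fun i j => ∫ y in T.Y.pt j..T.Y.mid j, fv i y with hVlo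
  set Vhi : ℕ → ℕ → ℝ := fun i j => ∫ y in T.Y.mid j..T.Y.pt (j + 1), fv i y with hVhi
  set Hlo : ℕ → ℕ → ℝ := fun i j => ∫ x in T.X.pt i..T.X.mid i, fh j x with hHlo
  set Hhi : ℕ → ℕ → ℝ := fun i j => ∫ x in T.X.mid i..T.X.pt (i + 1), fh j x with hHhi
  set V : ℕ → ℕ → ℝ := fun i j => v (T.X.pt i, T.Y.pt j) with hV
  have V0 : ∀ j, V 0 j = 0 := fun j => by simp only [hV, T.X.pt_zero, (hvx _).1]
  have Vn : ∀ j, V T.X.n j = 0 := fun j => by simp only [hV, T.X.pt_last, (hvx _).2]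
  have V0' : ∀ i, V i 0 = 0 := fun i => by simp only [hV, T.Y.pt_zero, (hvy _).1]
  have Vm : ∀ i, V i T.Y.n = 0 := fun i => by simp only [hV, T.Y.pt_last, (hvy _).2]
  have hprod : ∀ {i j}, i < T.X.n → j < T.Y.n → Icc (T.X.pt i) (T.X.pt (i + 1)) ×ˢ
      Icc (T.Y.pt j) (T.Y.pt (j + 1)) ⊆ Icc a b ×ˢ Icc c d := fun hi hj =>
    prod_mono (T.X.Icc_subset hi) (T.Y.Icc_subset hj)
  have eqv : ∀ {i j}, i < T.X.n → j < T.Y.n → EqOn (fv i) _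
      (Ioo (T.Y.pt j) (T.Y.pt (j + 1))) := fun hi hj y hy => T.flux_vertical hB hux huy hi hj hy
  have eqh : ∀ {i j}, i < T.X.n → j < T.Y.n → EqOn (fh j) _
      (Ioo (T.X.pt i) (T.X.pt (i + 1))) := fun hi hj x hx => T.flux_horizontal hB hux huy hi hj hx
  have intv : ∀ i < T.X.n, ∀ j < T.Y.n, ∀ s t, T.Y.pt j ≤ s → s ≤ t → t ≤ T.Y.pt (j + 1) →
      IntervalIntegrable (fv i) volume s t := fun i hi j hj s t h1 h2 h3 =>
    intervalIntegrable_congr_Ioo (eqv hi hj)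
      (continuousOn_midFlux (T.X.pt_lt i hi).le (hBc 0 0) (hBc 0 1)
        (cux.mono (hprod hi hj)) (cuy.mono (hprod hi hj))) h1 h2 h3
  have hswap : ∀ {i j}, i < T.X.n → j < T.Y.n → MapsTo Prod.swap
      (Icc (T.Y.pt j) (T.Y.pt (j + 1)) ×ˢ Icc (T.X.pt i) (T.X.pt (i + 1))) (Icc a b ×ˢ Icc c d) :=
    fun hi hj z hz => hprod hi hj ⟨hz.2, hz.1⟩
  have inth : ∀ j < T.Y.n, ∀ i < T.X.n, ∀ s t, T.X.pt i ≤ s → s ≤ t → t ≤ T.X.pt (i + 1) →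
      IntervalIntegrable (fh j) volume s t := fun j hj i hi s t h1 h2 h3 =>
    intervalIntegrable_congr_Ioo (eqh hi hj)
      (continuousOn_midFlux (T.Y.pt_lt j hj).le ((hBc 1 1).comp continuous_swap)
        ((hBc 1 0).comp continuous_swap)
        (cuy.comp continuous_swap.continuousOn (hswap hi hj))
        (cux.comp continuous_swap.continuousOn (hswap hi hj))) h1 h2 h3
  have hterm : ∀ i ∈ Finset.range (T.X.n + 1), ∀ j ∈ Finset.range (T.Y.n + 1),
      -(boundaryFlux (T.X.dualLeft i) (T.X.dualRight i) (T.Y.dualLeft j) (T.Y.dualRight j)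
        (flux A (u - T.interp u)) * V i j) =
      V i j * ((Vhi (i - 1) (j - 1) + Vlo (i - 1) j) - (Vhi i (j - 1) + Vlo i j)) +
        V i j * ((Hhi (i - 1) (j - 1) + Hlo i (j - 1)) - (Hhi (i - 1) j + Hlo i j)) := by
    intro i hi j hj
    rw [Finset.mem_range] at hi hj
    -- Where `v` vanishes both sides are zero. This disposes of all boundary nodes, so the truncated
    -- dual elements are never computed.
    by_cases hz : V i j = 0
    · simp [hz]
    have i0 : 0 < i := Nat.pos_of_ne_zero fun h => hz (h ▸ V0 j)
    have iN : i < T.X.n := lt_of_le_of_ne (by omega) fun h => hz (h ▸ Vn j)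
    have j0 : 0 < j := Nat.pos_of_ne_zero fun h => hz (h ▸ V0' i)
    have jN : j < T.Y.n := lt_of_le_of_ne (by omega) fun h => hz (h ▸ Vm i)
    have e1 := integral_dual_eq T.Y j0 jN (intv i iN)
    have e2 := integral_dual_eq T.Y j0 jN (intv (i - 1) (by omega))
    have e3 := integral_dual_eq T.X i0 iN (inth j jN)
    have e4 := integral_dual_eq T.X i0 iN (inth (j - 1) (by omega))
    have x1 := T.X.dualRight_of_lt iN
    have x2 := T.X.dualLeft_of_pos i0
    have y1 := T.Y.dualRight_of_lt jN
    have y2 := T.Y.dualLeft_of_pos j0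
    have : boundaryFlux (T.X.dualLeft i) (T.X.dualRight i) (T.Y.dualLeft j) (T.Y.dualRight j)
        (flux A (u - T.interp u)) =
        (∫ y in T.Y.dualLeft j..T.Y.dualRight j, fv i y) -
          (∫ y in T.Y.dualLeft j..T.Y.dualRight j, fv (i - 1) y) +
        ((∫ x in T.X.dualLeft i..T.X.dualRight i, fh j x) -
          ∫ x in T.X.dualLeft i..T.X.dualRight i, fh (j - 1) x) := by
      simp only [hfv, hfh]
      rw [← x1, ← x2, ← y1, ← y2]
      rfl
    rw [this, e1, e2, e3, e4]
    simp only [hVlo, hVhi, hHlo, hHhi]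
    ring
  have hsum := T.sum_node fun i j => -(boundaryFlux (T.X.dualLeft i) (T.X.dualRight i)
    (T.Y.dualLeft j) (T.Y.dualRight j) (flux A (u - T.interp u)) * V i j)
  refine hsum.trans ?_
  rw [Finset.sum_congr rfl fun i hi => Finset.sum_congr rfl fun j hj => hterm i hi j hj]
  simp only [Finset.sum_add_distrib]
  congr 1
  · rw [sum_node_eq_sum_elem Vlo Vhi V0 Vn V0' Vm]
    refine Finset.sum_congr rfl fun i hi => Finset.sum_congr rfl fun j hj => ?_
    rw [Finset.mem_range] at hi hj
    have m := T.Y.mid_mem hj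
    have e1 := integral_congr_Ioo (eqv hi hj) le_rfl m.1.le m.2.le
    have e2 := integral_congr_Ioo (eqv hi hj) m.1.le m.2.le le_rfl
    simp only [hVlo, hVhi, e1, e2]
    rfl
  · rw [Finset.sum_comm, sum_node_eq_sum_elem (V := fun j i => V i j) (fun j i => Hlo i j)
      (fun j i => Hhi i j) V0' Vm V0 Vn, Finset.sum_comm]
    refine Finset.sum_congr rfl fun i hi => Finset.sum_congr rfl fun j hj => ?_
    rw [Finset.mem_range] at hi hj
    have m := T.X.mid_mem hi
    have e1 := integral_congr_Ioo (eqh hi hj) le_rfl m.1.le m.2.le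
    have e2 := integral_congr_Ioo (eqh hi hj) m.1.le m.2.le le_rfl
    simp only [hHlo, hHhi, e1, e2]
    rfl

/-- Estimate of the diffusion part of the bilinear form. -/
theorem abs_sum_boundaryFlux_le (hB : ∀ z ∈ rect a b c d, ∀ k l, A z k l = B k l z)
    (hBc : ∀ k l, Continuous (B k l)) {M L γ R : ℝ}
    (hM : ∀ k l, ∀ z ∈ Icc a b ×ˢ Icc c d, |B k l z| ≤ M)
    (hL : ∀ k l x y x' y', |B k l (x, y) - B k l (x', y')| ≤ L * (|x - x'| + |y - y'|))
    (hL0 : 0 ≤ L) (hγ0 : 0 ≤ γ)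
    (cux : ContinuousOn ux (Icc a b ×ˢ Icc c d)) (cuy : ContinuousOn uy (Icc a b ×ˢ Icc c d))
    (hux : ∀ z ∈ rect a b c d, HasDerivAt (fun s => u (s, z.2)) (ux z) z.1)
    (huy : ∀ z ∈ rect a b c d, HasDerivAt (fun s => u (z.1, s)) (uy z) z.2)
    (hvx : ∀ y, v (a, y) = 0 ∧ v (b, y) = 0) (hvy : ∀ x, v (x, c) = 0 ∧ v (x, d) = 0)
    {H N S : ℕ → ℕ → ℝ}
    (hjet : ∀ i < T.X.n, ∀ j < T.Y.n, ∃ D s, JetLimit (T.X.pt i) (T.X.pt (i + 1)) (T.Y.pt j)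
      (T.Y.pt (j + 1)) (fun x y => u (x, y)) (fun x y => ux (x, y)) (fun x y => uy (x, y))
        (S i j) D s)
    (hH : ∀ i < T.X.n, ∀ j < T.Y.n, T.X.len i ≤ H i j ∧ T.Y.len j ≤ H i j ∧
      H i j ≤ γ * T.X.len i ∧ H i j ≤ γ * T.Y.len j ∧ H i j ≤ R)
    (hN : ∀ i < T.X.n, ∀ j < T.Y.n,
      |v (T.X.pt (i + 1), T.Y.pt j) - v (T.X.pt i, T.Y.pt j)| ≤ H i j * N i j ∧
      |v (T.X.pt (i + 1), T.Y.pt (j + 1)) - v (T.X.pt i, T.Y.pt (j + 1))| ≤ H i j * N i j ∧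
      |v (T.X.pt i, T.Y.pt (j + 1)) - v (T.X.pt i, T.Y.pt j)| ≤ H i j * N i j ∧
      |v (T.X.pt (i + 1), T.Y.pt (j + 1)) - v (T.X.pt (i + 1), T.Y.pt j)| ≤ H i j * N i j) :
    |∑ P : T.Node, -(boundaryFlux (T.X.dualLeft P.1) (T.X.dualRight P.1) (T.Y.dualLeft P.2)
        (T.Y.dualRight P.2) (flux A (u - T.interp u)) * v (T.point P))| ≤
      2 * (M * (4 + γ) + L * (2 + 4 * R + γ)) *
        ∑ i ∈ Finset.range T.X.n, ∑ j ∈ Finset.range T.Y.n, H i j ^ 2 * N i j * S i j := by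
  rw [T.sum_boundaryFlux_eq hB hBc cux cuy hux huy hvx hvy]
  set K := M * (4 + γ) + L * (2 + 4 * R + γ) with hK
  have e : 2 * K * ∑ i ∈ Finset.range T.X.n, ∑ j ∈ Finset.range T.Y.n, H i j ^ 2 * N i j * S i j =
      (∑ i ∈ Finset.range T.X.n, ∑ j ∈ Finset.range T.Y.n, K * (H i j ^ 2 * N i j * S i j)) +
        ∑ j ∈ Finset.range T.Y.n, ∑ i ∈ Finset.range T.X.n, K * (H i j ^ 2 * N i j * S i j) := by
    rw [Finset.sum_comm (s := Finset.range T.Y.n)]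
    simp only [← Finset.mul_sum]
    ring
  rw [e]
  have hMe : ∀ k l, ∀ i < T.X.n, ∀ j < T.Y.n, ∀ x ∈ Icc (T.X.pt i) (T.X.pt (i + 1)),
      ∀ y ∈ Icc (T.Y.pt j) (T.Y.pt (j + 1)), |B k l (x, y)| ≤ M := fun k l i hi j hj x hx y hy =>
    hM k l _ ⟨T.X.Icc_subset hi hx, T.Y.Icc_subset hj hy⟩
  refine (abs_add_le _ _).trans (add_le_add ?_ ?_)
  -- The edge term at `x = pt i` carries the increment of `v` along that vertical edge, which is
  -- zero on `x = a` and `x = b`.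
  · refine abs_sum_le_of_telescoping (E := fun i j => edgeTerm (T.Y.pt j) (T.Y.pt (j + 1))
      (v (T.X.pt i, T.Y.pt (j + 1)) - v (T.X.pt i, T.Y.pt j)) (fun x y => B 0 1 (x, y))
      (fun x y => u (x, y)) (T.X.pt i)) (fun j _ => ?_) (fun j _ => ?_) fun i hi j hj => ?_
    · simp [edgeTerm, T.X.pt_zero, (hvx _).1]
    · simp [edgeTerm, T.X.pt_last, (hvx _).2]
    · obtain ⟨D, s, h⟩ := hjet i hi j hj
      obtain ⟨h1, h2, h3, h4, h5⟩ := hH i hi j hj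
      obtain ⟨n1, n2, n3, n4⟩ := hN i hi j hj
      exact h.vertFlux_sub_edgeTerm_le (a₁ := fun x y => B 0 0 (x, y))
        (a₂ := fun x y => B 0 1 (x, y)) (T.X.pt_lt i hi) (T.Y.pt_lt j hj) (hBc 0 0) (hBc 0 1)
        (hMe 0 0 i hi j hj) (hMe 0 1 i hi j hj) (fun x y x' y' => hL 0 1 x y x' y') hL0 h1 h2 h3 hγ0
        h5 n1 n2 n3 n4 (by ring)
  · rw [Finset.sum_comm]
    refine abs_sum_le_of_telescoping (E := fun j i => edgeTerm (T.X.pt i) (T.X.pt (i + 1))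
      (v (T.X.pt (i + 1), T.Y.pt j) - v (T.X.pt i, T.Y.pt j)) (fun y x => B 1 0 (x, y))
      (fun y x => u (x, y)) (T.Y.pt j)) (fun j _ => ?_) (fun j _ => ?_) fun j hj i hi => ?_
    · simp [edgeTerm, T.Y.pt_zero, (hvy _).1]
    · simp [edgeTerm, T.Y.pt_last, (hvy _).2]
    · obtain ⟨D, s, h⟩ := hjet i hi j hj
      obtain ⟨h1, h2, h3, h4, h5⟩ := hH i hi j hj
      obtain ⟨n1, n2, n3, n4⟩ := hN i hi j hj
      -- In the exchanged coordinates the normal coefficient is `B 1 1` and the tangential one `B 1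
      -- 0`; the horizontal and the vertical increments of `v` trade places.
      exact h.swap.vertFlux_sub_edgeTerm_le (a₁ := fun y x => B 1 1 (x, y))
        (a₂ := fun y x => B 1 0 (x, y)) (T.Y.pt_lt j hj) (T.X.pt_lt i hi)
        ((hBc 1 1).comp continuous_swap) ((hBc 1 0).comp continuous_swap)
        (fun y hy x hx => hMe 1 1 i hi j hj x hx y hy)
        (fun y hy x hx => hMe 1 0 i hi j hj x hx y hy)
        (fun y x y' x' => by rw [add_comm |y - y'|]; exact hL 1 0 x y x' y') hL0 h2 h1 h4 hγ0
        h5 n3 n4 n1 n2 (by ring)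

end Mesh

end FluxPart

/-! ### The reaction part. -/

noncomputable section ReactionPart

lemma Grid.continuous_hat {a b : ℝ} (X : Grid a b) (i : ℕ) : Continuous (X.hat i) := by
  unfold Grid.hat
  split_ifs <;> fun_prop

namespace Mesh

variable {a b c d : ℝ} (T : Mesh a b c d)

lemma continuous_interp (u : ℝ × ℝ → ℝ) : Continuous (T.interp u) := by
  unfold interp
  have h1 := fun i => (T.X.continuous_hat i)
  have h2 := fun i => (T.Y.continuous_hat i)
  fun_prop

lemma elem_subset {i j : ℕ} (hi : i < T.X.n) (hj : j < T.Y.n) : T.elem i j ⊆ rect a b c d :=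
  prod_mono (T.X.Ioo_subset hi) (T.Y.Ioo_subset hj)

lemma measurableSet_elem (i j : ℕ) : MeasurableSet (T.elem i j) := measurableSet_rect

lemma elem_eq_of_mem {K L : T.Elem} {z : ℝ × ℝ} (hK : z ∈ T.elem K.1 K.2)
    (hL : z ∈ T.elem L.1 L.2) : K = L :=
  Prod.ext (Fin.ext (T.X.eq_of_mem_elem K.1.2 L.1.2 hK.1 hL.1))
    (Fin.ext (T.Y.eq_of_mem_elem K.2.2 L.2.2 hK.2 hL.2))

lemma ae_ne_pt : ∀ᵐ z : ℝ × ℝ, (∀ i ≤ T.X.n, z.1 ≠ T.X.pt i) ∧ ∀ j ≤ T.Y.n, z.2 ≠ T.Y.pt j := by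
  rw [Measure.volume_eq_prod]
  exact (Measure.quasiMeasurePreserving_fst.ae T.X.ae_ne_pt).and
    (Measure.quasiMeasurePreserving_snd.ae T.Y.ae_ne_pt)

lemma iUnion_elem_ae_eq :
    (⋃ K ∈ (Finset.univ : Finset T.Elem), T.elem K.1 K.2 : Set (ℝ × ℝ)) =ᵐ[volume]
      rect a b c d := by
  filter_upwards [T.ae_ne_pt] with z hz
  refine propext ⟨fun h => ?_, fun h => ?_⟩
  · obtain ⟨K, -, hK⟩ := mem_iUnion₂.1 h
    exact T.elem_subset K.1.2 K.2.2 hK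
  · obtain ⟨i, hi, h1⟩ := T.X.exists_mem_Ioo h.1 hz.1
    obtain ⟨j, hj, h2⟩ := T.Y.exists_mem_Ioo h.2 hz.2
    exact mem_iUnion₂.2 ⟨(⟨i, hi⟩, ⟨j, hj⟩), Finset.mem_univ _, h1, h2⟩

lemma setIntegral_eq_sum_elem {f : ℝ × ℝ → ℝ} (hf : IntegrableOn f (rect a b c d)) :
    ∫ z in rect a b c d, f z =
      ∑ i ∈ Finset.range T.X.n, ∑ j ∈ Finset.range T.Y.n, ∫ z in T.elem i j, f z := by
  rw [← T.sum_elem fun i j => ∫ z in T.elem i j, f z, ← setIntegral_congr_set T.iUnion_elem_ae_eq]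
  refine integral_biUnion_finset _ (fun K _ => T.measurableSet_elem _ _) ?_
    fun K _ => hf.mono_set (T.elem_subset K.1.2 K.2.2)
  intro K _ L _ hne
  exact Set.disjoint_left.2 fun z hK hL => hne (T.elem_eq_of_mem hK hL)

/-- A point of an element lies in the dual element of one of its four vertices, or on a line between
dual elements, where `dualInterp` is zero. -/
lemma abs_dualInterp_le {v : ℝ × ℝ → ℝ} {i j : ℕ} (hi : i < T.X.n) (hj : j < T.Y.n) {N : ℝ}
    (hN : ∀ k l, k = i ∨ k = i + 1 → l = j ∨ l = j + 1 → |v (T.X.pt k, T.Y.pt l)| ≤ N)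
    {z : ℝ × ℝ} (hz : z ∈ T.elem i j) : |T.dualInterp v z| ≤ N := by
  by_cases h : ∃ P, z ∈ T.dualElem P
  · obtain ⟨P, hP⟩ := h
    rw [T.dualInterp_apply hP]
    exact hN _ _ (T.X.eq_or_eq_of_mem hi (Nat.lt_succ_iff.1 P.1.2) hz.1 hP.1)
      (T.Y.eq_or_eq_of_mem hj (Nat.lt_succ_iff.1 P.2.2) hz.2 hP.2)
  · rw [dualInterp, Finset.sum_eq_zero, abs_zero]
    · exact (abs_nonneg _).trans (hN i j (Or.inl rfl) (Or.inl rfl))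
    · intro P _
      rw [indicator_of_notMem fun hP => h ⟨P, hP⟩, mul_zero]

/-- Estimate of the reaction part of the bilinear form. -/
theorem abs_sum_reaction_le {c₀ w v : ℝ × ℝ → ℝ} {C : ℝ} {N : ℕ → ℕ → ℝ}
    (hcm : AEStronglyMeasurable c₀ (volume.restrict (rect a b c d)))
    (hc : ∀ᵐ z ∂(volume.restrict (rect a b c d)), |c₀ z| ≤ C)
    (hw : IntegrableOn w (rect a b c d))
    (hN : ∀ i < T.X.n, ∀ j < T.Y.n, ∀ k l, k = i ∨ k = i + 1 → l = j ∨ l = j + 1 →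
      |v (T.X.pt k, T.Y.pt l)| ≤ N i j) :
    |∑ P : T.Node, ∫ z in T.dualElem P, c₀ z * w z * v (T.point P)| ≤
      C * ∑ i ∈ Finset.range T.X.n, ∑ j ∈ Finset.range T.Y.n,
        N i j * ∫ z in T.elem i j, |w z| := by
  have icw : IntegrableOn (fun z => c₀ z * w z) (rect a b c d) := hw.bdd_mul hcm hc
  have hi : ∀ P : T.Node, IntegrableOn
      ((T.dualElem P).indicator fun z => c₀ z * w z * v (T.point P)) (rect a b c d) := fun P =>
    (icw.mul_const _).indicator (T.measurableSet_dualElem P)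
  have hexp : ∀ z, c₀ z * w z * T.dualInterp v z =
      ∑ P : T.Node, (T.dualElem P).indicator (fun z => c₀ z * w z * v (T.point P)) z := by
    intro z
    rw [dualInterp, Finset.mul_sum]
    refine Finset.sum_congr rfl fun P _ => ?_
    by_cases hz : z ∈ T.dualElem P <;> simp [hz]
  -- The dual elements are glued to one integral over the whole rectangle, which is then cut along
  -- the elements, where the interpolation error is known.
  have e : ∑ P : T.Node, ∫ z in T.dualElem P, c₀ z * w z * v (T.point P) =
      ∫ z in rect a b c d, c₀ z * w z * T.dualInterp v z := by
    simp only [hexp]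
    rw [integral_finsetSum _ fun P _ => hi P]
    refine Finset.sum_congr rfl fun P _ => ?_
    rw [setIntegral_indicator (T.measurableSet_dualElem P),
      inter_eq_self_of_subset_right (T.dualElem_subset P)]
  have hint : IntegrableOn (fun z => c₀ z * w z * T.dualInterp v z) (rect a b c d) := by
    simp only [hexp]
    exact integrable_finsetSum _ fun P _ => hi P
  rw [e]
  refine (abs_integral_le_integral_abs).trans ?_
  rw [T.setIntegral_eq_sum_elem hint.abs, Finset.mul_sum]
  refine Finset.sum_le_sum fun i hi => ?_
  rw [Finset.mul_sum]
  refine Finset.sum_le_sum fun j hj => ?_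
  rw [Finset.mem_range] at hi hj
  have hs := T.elem_subset hi hj
  rw [← integral_const_mul, ← integral_const_mul]
  refine integral_mono_ae (hint.mono_set hs).abs
    (((hw.mono_set hs).abs.const_mul _).const_mul _) ?_
  filter_upwards [ae_restrict_of_ae_restrict_of_subset hs hc,
    ae_restrict_mem (T.measurableSet_elem i j)] with z h1 h2
  have h3 := T.abs_dualInterp_le hi hj (hN i hi j hj) h2
  rw [abs_mul, abs_mul]
  have h4 := mul_le_mul h1 h3 (abs_nonneg _) ((abs_nonneg _).trans h1)
  have h5 := mul_le_mul_of_nonneg_right h4 (abs_nonneg (w z))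
  linarith

end Mesh

end ReactionPart

/-! ### Trial functions: weak gradient and inverse estimates. -/

noncomputable section TrialFunctions

/-! ### Weak derivatives of piecewise smooth functions -/

/-- The fundamental theorem of calculus for the product `f φ`. The countable exceptional set absorbs
the kinks of a trial function at the grid points. -/
lemma integral_mul_deriv_add_eq_zero {a b : ℝ} (hab : a ≤ b) {f f' φ φ' : ℝ → ℝ} {s : Set ℝ}
    (hs : s.Countable) (hf : ContinuousOn f (Icc a b)) (hφ : ∀ x, HasDerivAt φ (φ' x) x)
    (hd : ∀ x ∈ Ioo a b \ s, HasDerivAt f (f' x) x) (ha : φ a = 0) (hb : φ b = 0)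
    (hi : IntegrableOn (fun x => f' x * φ x + f x * φ' x) (Ioo a b)) :
    ∫ x in Ioo a b, (f' x * φ x + f x * φ' x) = 0 := by
  have hφc : Continuous φ := continuous_iff_continuousAt.2 fun x => (hφ x).continuousAt
  rw [← integral_Ioc_eq_integral_Ioo, ← intervalIntegral.integral_of_le hab,
    integral_eq_of_hasDerivAt_off_countable_of_le (fun x => f x * φ x) _ hab hs
      (hf.mul hφc.continuousOn) (fun x hx => (hd x hx).mul (hφ x))
      ((intervalIntegrable_iff_integrableOn_Ioo_of_le hab).2 hi)]
  simp [ha, hb]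

variable {a b c d : ℝ} {v g : ℝ × ℝ → ℝ}

lemma IsTestFunction.eq_zero_of_notMem {Ω : Set (ℝ × ℝ)} {φ : ℝ × ℝ → ℝ}
    (h : IsTestFunction Ω φ) {z : ℝ × ℝ} (hz : z ∉ Ω) : φ z = 0 :=
  image_eq_zero_of_notMem_tsupport fun hm => hz (h.2.2 hm)

lemma IntegrableOn.mul_isTestFunction {Ω : Set (ℝ × ℝ)} {φ f : ℝ × ℝ → ℝ}
    (hf : IntegrableOn f Ω) (h : IsTestFunction Ω φ) : IntegrableOn (fun z => f z * φ z) Ω := by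
  obtain ⟨C, hC⟩ := h.2.1.exists_bound_of_continuous h.1.continuous
  exact Integrable.mul_bdd hf h.1.continuous.aestronglyMeasurable (Eventually.of_forall hC)

/-- Fubini reduces the claim to integration by parts on almost every horizontal line, where the
boundary terms vanish with the test function. Continuity of `v` rules out jump contributions. -/
lemma isWeakDeriv_fst_of_piecewise (hab : a ≤ b)
    (hv : ContinuousOn v (Icc a b ×ˢ Icc c d)) (hg : IntegrableOn g (rect a b c d))
    (h : ∀ᵐ y : ℝ, y ∈ Ioo c d → ∃ s : Set ℝ, s.Countable ∧
      ∀ x ∈ Ioo a b \ s, HasDerivAt (fun t => v (t, y)) (g (x, y)) x) :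
    IsWeakDeriv (rect a b c d) (1, 0) v g := by
  have hvi := integrableOn_rect_of_continuousOn hv
  refine ⟨hvi.locallyIntegrableOn, hg.locallyIntegrableOn, fun φ hφ => ?_⟩
  have i1 : IntegrableOn (fun z => v z * pdx φ z) (rect a b c d) :=
    IntegrableOn.mul_isTestFunction hvi hφ.pdx
  have i2 : IntegrableOn (fun z => g z * φ z) (rect a b c d) := IntegrableOn.mul_isTestFunction hg hφ
  have hsum : ∫ z in rect a b c d, (g z * φ z + v z * pdx φ z) = 0 := by
    have i3 : IntegrableOn (fun z => g z * φ z + v z * pdx φ z) (rect a b c d) := i2.add i1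
    rw [IntegrableOn, rect, Measure.volume_eq_prod, ← Measure.prod_restrict] at i3
    rw [rect, Measure.volume_eq_prod, ← Measure.prod_restrict]
    rw [integral_prod_symm _ i3]
    refine integral_eq_zero_of_ae ?_
    filter_upwards [i3.prod_left_ae, ae_restrict_of_ae h, ae_restrict_mem measurableSet_Ioo]
      with y h1 h2 h3
    obtain ⟨s, hs, hd⟩ := h2 h3
    refine integral_mul_deriv_add_eq_zero (f := fun x => v (x, y)) (f' := fun x => g (x, y))
      (φ := fun x => φ (x, y)) (φ' := fun x => pdx φ (x, y)) hab hs ?_ (fun x => ?_) hd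
      (hφ.eq_zero_of_notMem fun hm => lt_irrefl _ hm.1.1)
      (hφ.eq_zero_of_notMem fun hm => lt_irrefl _ hm.1.2) h1
    · exact hv.comp (by fun_prop) fun x hx => ⟨hx, Ioo_subset_Icc_self h3⟩
    · rw [pdx_eq_fderiv (hφ.1.differentiable (by simp))]
      exact hasDerivAt_slice_fst (hφ.1.differentiable (by simp) _).hasFDerivAt
  rw [integral_add i2 i1] at hsum
  have e : pd (1, 0) φ = pdx φ := rfl
  rw [e]
  norm_num
  linarith

lemma isWeakDeriv_snd_of_piecewise (hcd : c ≤ d)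
    (hv : ContinuousOn v (Icc a b ×ˢ Icc c d)) (hg : IntegrableOn g (rect a b c d))
    (h : ∀ᵐ x : ℝ, x ∈ Ioo a b → ∃ s : Set ℝ, s.Countable ∧
      ∀ y ∈ Ioo c d \ s, HasDerivAt (fun t => v (x, t)) (g (x, y)) y) :
    IsWeakDeriv (rect a b c d) (0, 1) v g := by
  have hvi := integrableOn_rect_of_continuousOn hv
  refine ⟨hvi.locallyIntegrableOn, hg.locallyIntegrableOn, fun φ hφ => ?_⟩
  have i1 : IntegrableOn (fun z => v z * pdy φ z) (rect a b c d) :=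
    IntegrableOn.mul_isTestFunction hvi hφ.pdy
  have i2 : IntegrableOn (fun z => g z * φ z) (rect a b c d) := IntegrableOn.mul_isTestFunction hg hφ
  have hsum : ∫ z in rect a b c d, (g z * φ z + v z * pdy φ z) = 0 := by
    have i3 : IntegrableOn (fun z => g z * φ z + v z * pdy φ z) (rect a b c d) := i2.add i1
    rw [IntegrableOn, rect, Measure.volume_eq_prod, ← Measure.prod_restrict] at i3
    rw [rect, Measure.volume_eq_prod, ← Measure.prod_restrict]
    rw [integral_prod _ i3]
    refine integral_eq_zero_of_ae ?_
    filter_upwards [i3.prod_right_ae, ae_restrict_of_ae h, ae_restrict_mem measurableSet_Ioo]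
      with x h1 h2 h3
    obtain ⟨s, hs, hd⟩ := h2 h3
    refine integral_mul_deriv_add_eq_zero (f := fun y => v (x, y)) (f' := fun y => g (x, y))
      (φ := fun y => φ (x, y)) (φ' := fun y => pdy φ (x, y)) hcd hs ?_ (fun y => ?_) hd
      (hφ.eq_zero_of_notMem fun hm => lt_irrefl _ hm.2.1)
      (hφ.eq_zero_of_notMem fun hm => lt_irrefl _ hm.2.2) h1
    · exact hv.comp (by fun_prop) fun y hy => ⟨Ioo_subset_Icc_self h3, hy⟩
    · rw [pdy_eq_fderiv (hφ.1.differentiable (by simp))]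
      exact hasDerivAt_slice_snd (hφ.1.differentiable (by simp) _).hasFDerivAt
  rw [integral_add i2 i1] at hsum
  have e : pd (0, 1) φ = pdy φ := rfl
  rw [e]
  norm_num
  linarith

/-! ### Inverse estimates for bilinear functions -/

/-- If `I₁`, `I₂` are the integrals of an affine function over the two halves of `[s, t]`, then `t -
s` times its value at `s` is `3 I₁ - I₂`, and at `t` it is `3 I₂ - I₁`. -/
lemma abs_affine_le {p q s t : ℝ} (hst : s ≤ t) :
    (t - s) * |p + q * s| ≤ 3 * ∫ y in s..t, |p + q * y| ∧
      (t - s) * |p + q * t| ≤ 3 * ∫ y in s..t, |p + q * y| := by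
  have hc : Continuous fun y : ℝ => p + q * y := by fun_prop
  have e : ∀ s t : ℝ, ∫ y in s..t, (p + q * y) = (t - s) * p + q * ((t ^ 2 - s ^ 2) / 2) := by
    intro s t
    have i1 : IntervalIntegrable (fun _ : ℝ => p) volume s t :=
      continuous_const.intervalIntegrable _ _
    have i2 : IntervalIntegrable (fun y : ℝ => q * y) volume s t :=
      Continuous.intervalIntegrable (by fun_prop) _ _
    rw [intervalIntegral.integral_add i1 i2,
      intervalIntegral.integral_const_mul, intervalIntegral.integral_const, integral_id,
      smul_eq_mul]
  have h1 := intervalIntegral.abs_integral_le_integral_abs (μ := volume) (f := fun y => p + q * y)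
    (show s ≤ (s + t) / 2 by linarith)
  have h2 := intervalIntegral.abs_integral_le_integral_abs (μ := volume) (f := fun y => p + q * y)
    (show (s + t) / 2 ≤ t by linarith)
  have h3 := intervalIntegral.integral_add_adjacent_intervals (μ := volume)
    (hc.abs.intervalIntegrable s ((s + t) / 2)) (hc.abs.intervalIntegrable ((s + t) / 2) t)
  rw [e] at h1 h2
  set I1 := ∫ y in s..(s + t) / 2, |p + q * y|
  set I2 := ∫ y in (s + t) / 2..t, |p + q * y|
  rw [← h3]
  rw [abs_le] at h1 h2
  have hnn : 0 ≤ t - s := by linarith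
  rw [← abs_of_nonneg hnn, ← abs_mul, ← abs_mul, abs_le, abs_le]
  refine ⟨⟨?_, ?_⟩, ?_, ?_⟩ <;> nlinarith

/-- A bilinear function is affine in each variable separately, so the one-dimensional estimate
applies twice; `9 = 3 * 3`. -/
lemma abs_bilinear_corner_le {k₀ k₁ k₂ k₃ x₀ x₁ y₀ y₁ x y : ℝ} (hx : x₀ ≤ x₁) (hy : y₀ ≤ y₁)
    (hxx : x = x₀ ∨ x = x₁) (hyy : y = y₀ ∨ y = y₁) :
    (x₁ - x₀) * (y₁ - y₀) * |k₀ + k₁ * x + k₂ * y + k₃ * (x * y)| ≤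
      9 * ∫ z in rect x₀ x₁ y₀ y₁, |k₀ + k₁ * z.1 + k₂ * z.2 + k₃ * (z.1 * z.2)| := by
  have hc : Continuous fun z : ℝ × ℝ => |k₀ + k₁ * z.1 + k₂ * z.2 + k₃ * (z.1 * z.2)| := by
    fun_prop
  rw [setIntegral_rect hx hy (integrableOn_rect_of_continuousOn hc.continuousOn)]
  have h1 : ∀ s : ℝ, (y₁ - y₀) * |k₀ + k₁ * s + k₂ * y + k₃ * (s * y)| ≤
      3 * ∫ t in y₀..y₁, |k₀ + k₁ * s + k₂ * t + k₃ * (s * t)| := by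
    intro s
    have h := abs_affine_le (p := k₀ + k₁ * s) (q := k₂ + k₃ * s) hy
    have e : ∀ t, k₀ + k₁ * s + k₂ * t + k₃ * (s * t) = k₀ + k₁ * s + (k₂ + k₃ * s) * t :=
      fun t => by ring
    simp only [e]
    rcases hyy with rfl | rfl
    exacts [h.1, h.2]
  have h2 : (x₁ - x₀) * |k₀ + k₁ * x + k₂ * y + k₃ * (x * y)| ≤
      3 * ∫ s in x₀..x₁, |k₀ + k₁ * s + k₂ * y + k₃ * (s * y)| := by
    have h := abs_affine_le (p := k₀ + k₂ * y) (q := k₁ + k₃ * y) hx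
    have e : ∀ s, k₀ + k₁ * s + k₂ * y + k₃ * (s * y) = k₀ + k₂ * y + (k₁ + k₃ * y) * s :=
      fun t => by ring
    simp only [e]
    rcases hxx with rfl | rfl
    exacts [h.1, h.2]
  have h3 : (y₁ - y₀) * ∫ s in x₀..x₁, |k₀ + k₁ * s + k₂ * y + k₃ * (s * y)| ≤
      3 * ∫ s in x₀..x₁, ∫ t in y₀..y₁, |k₀ + k₁ * s + k₂ * t + k₃ * (s * t)| := by
    rw [← intervalIntegral.integral_const_mul, ← intervalIntegral.integral_const_mul]
    refine intervalIntegral.integral_mono_on hx (Continuous.intervalIntegrable (by fun_prop) _ _)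
      (Continuous.intervalIntegrable ?_ _ _) fun s _ => h1 s
    exact continuous_const.mul (intervalIntegral.continuous_parametric_intervalIntegral_of_continuous'
      (f := fun s t => |k₀ + k₁ * s + k₂ * t + k₃ * (s * t)|) hc _ _)
  have h4 := mul_le_mul_of_nonneg_left h2 (sub_nonneg.2 hy)
  linarith

namespace Mesh

variable (T : Mesh a b c d)

/-- A function given piecewise on the elements. -/
def piecewise (f : ℕ → ℕ → ℝ × ℝ → ℝ) : ℝ × ℝ → ℝ := fun z =>
  ∑ K : T.Elem, (T.elem K.1 K.2).indicator (f K.1 K.2) z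

lemma piecewise_apply (f : ℕ → ℕ → ℝ × ℝ → ℝ) {i j : ℕ} (hi : i < T.X.n) (hj : j < T.Y.n)
    {z : ℝ × ℝ} (hz : z ∈ T.elem i j) : T.piecewise f z = f i j z := by
  rw [piecewise, Finset.sum_eq_single (⟨i, hi⟩, ⟨j, hj⟩)]
  · exact indicator_of_mem hz _
  · intro L _ hL
    refine indicator_of_notMem (fun h => hL ?_) _
    exact (T.elem_eq_of_mem (K := (⟨i, hi⟩, ⟨j, hj⟩)) hz h).symm
  · simp

lemma memLp_piecewise {f : ℕ → ℕ → ℝ × ℝ → ℝ} (hf : ∀ i j, Continuous (f i j)) :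
    MemLp (T.piecewise f) ∞ (volume.restrict (rect a b c d)) := by
  refine memLp_finsetSum _ fun K _ => MemLp.indicator (T.measurableSet_elem _ _) ?_
  obtain ⟨C, hC⟩ := (isCompact_Icc.prod isCompact_Icc).exists_bound_of_continuousOn
    (hf K.1 K.2).continuousOn (s := Icc a b ×ˢ Icc c d)
  refine memLp_top_of_bound (hf _ _).aestronglyMeasurable C ?_
  filter_upwards [ae_restrict_mem measurableSet_rect] with z hz
  exact hC z (rect_subset_Icc hz)

/-- Weak gradient and nodal bounds of a trial function. -/
theorem IsTrial.exists_gradient {T : Mesh a b c d} (hab : a < b) (hcd : c < d)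
    (hv : T.IsTrial v) :
    ∃ vx vy : ℝ × ℝ → ℝ,
      IsWeakDeriv (rect a b c d) (1, 0) v vx ∧ IsWeakDeriv (rect a b c d) (0, 1) v vy ∧
      MemLp vx ∞ (volume.restrict (rect a b c d)) ∧ MemLp vy ∞ (volume.restrict (rect a b c d)) ∧
      ∀ i < T.X.n, ∀ j < T.Y.n,
        (∀ k l, k = i ∨ k = i + 1 → l = j ∨ l = j + 1 →
          T.X.len i * T.Y.len j * |v (T.X.pt k, T.Y.pt l)| ≤ 9 * ∫ z in T.elem i j, |v z|) ∧
        (∀ l, l = j ∨ l = j + 1 →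
          T.Y.len j * |v (T.X.pt (i + 1), T.Y.pt l) - v (T.X.pt i, T.Y.pt l)| ≤
            9 * ∫ z in T.elem i j, |vx z|) ∧
        ∀ k, k = i ∨ k = i + 1 →
          T.X.len i * |v (T.X.pt k, T.Y.pt (j + 1)) - v (T.X.pt k, T.Y.pt j)| ≤
            9 * ∫ z in T.elem i j, |vy z| := by
  obtain ⟨hvc, hvK, -⟩ := hv
  rw [closure_rect hab hcd] at hvc
  -- The coefficients are extended by zero to all index pairs, so that they can be chosen as
  -- functions on `ℕ × ℕ`.
  have hvK' : ∀ i j, ∃ k₀ k₁ k₂ k₃ : ℝ, i < T.X.n → j < T.Y.n →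
      ∀ x ∈ Icc (T.X.pt i) (T.X.pt (i + 1)), ∀ y ∈ Icc (T.Y.pt j) (T.Y.pt (j + 1)),
        v (x, y) = k₀ + k₁ * x + k₂ * y + k₃ * (x * y) := by
    intro i j
    by_cases h : i < T.X.n ∧ j < T.Y.n
    · obtain ⟨k₀, k₁, k₂, k₃, hk⟩ := hvK (⟨i, h.1⟩, ⟨j, h.2⟩)
      exact ⟨k₀, k₁, k₂, k₃, fun _ _ x hx y hy => hk (x, y) ⟨hx, hy⟩⟩
    · exact ⟨0, 0, 0, 0, fun hi hj => absurd ⟨hi, hj⟩ h⟩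
  choose k₀ k₁ k₂ k₃ hk using hvK'
  have hfin : IsFiniteMeasure (volume.restrict (rect a b c d)) := ⟨by simpa using volume_rect_lt_top⟩
  set vx := T.piecewise fun i j z => k₁ i j + k₃ i j * z.2 with hvx
  set vy := T.piecewise fun i j z => k₂ i j + k₃ i j * z.1 with hvy
  have mx : MemLp vx ∞ (volume.restrict (rect a b c d)) :=
    T.memLp_piecewise fun i j => by fun_prop
  have my : MemLp vy ∞ (volume.restrict (rect a b c d)) :=
    T.memLp_piecewise fun i j => by fun_prop
  refine ⟨vx, vy, ?_, ?_, mx, my, fun i hi j hj => ?_⟩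
  · refine isWeakDeriv_fst_of_piecewise hab.le hvc (mx.integrable le_top) ?_
    filter_upwards [T.Y.ae_ne_pt] with y hy hyy
    refine ⟨range T.X.pt, countable_range _, fun x hx => ?_⟩
    obtain ⟨i, hi, h1⟩ := T.X.exists_mem_Ioo hx.1 fun i _ h => hx.2 ⟨i, h.symm⟩
    obtain ⟨j, hj, h2⟩ := T.Y.exists_mem_Ioo hyy hy
    rw [hvx, T.piecewise_apply _ hi hj ⟨h1, h2⟩]
    have e : HasDerivAt (fun t => (k₀ i j + k₂ i j * y) + (k₁ i j + k₃ i j * y) * t)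
        (k₁ i j + k₃ i j * y) x := by
      simpa using ((hasDerivAt_id' x).const_mul (k₁ i j + k₃ i j * y)).const_add
        (k₀ i j + k₂ i j * y)
    refine e.congr_of_eventuallyEq ?_
    filter_upwards [isOpen_Ioo.mem_nhds h1] with t ht
    rw [hk i j hi hj t (Ioo_subset_Icc_self ht) y (Ioo_subset_Icc_self h2)]
    ring
  · refine isWeakDeriv_snd_of_piecewise hcd.le hvc (my.integrable le_top) ?_
    filter_upwards [T.X.ae_ne_pt] with x hx hxx
    refine ⟨range T.Y.pt, countable_range _, fun y hy => ?_⟩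
    obtain ⟨i, hi, h1⟩ := T.X.exists_mem_Ioo hxx hx
    obtain ⟨j, hj, h2⟩ := T.Y.exists_mem_Ioo hy.1 fun i _ h => hy.2 ⟨i, h.symm⟩
    rw [hvy, T.piecewise_apply _ hi hj ⟨h1, h2⟩]
    have e : HasDerivAt (fun t => (k₀ i j + k₁ i j * x) + (k₂ i j + k₃ i j * x) * t)
        (k₂ i j + k₃ i j * x) y := by
      simpa using ((hasDerivAt_id' y).const_mul (k₂ i j + k₃ i j * x)).const_add
        (k₀ i j + k₁ i j * x)
    refine e.congr_of_eventuallyEq ?_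
    filter_upwards [isOpen_Ioo.mem_nhds h2] with t ht
    rw [hk i j hi hj x (Ioo_subset_Icc_self h1) t (Ioo_subset_Icc_self ht)]
    ring
  have hX := T.X.pt_lt i hi
  have hY := T.Y.pt_lt j hj
  have memX : ∀ k, k = i ∨ k = i + 1 → T.X.pt k ∈ Icc (T.X.pt i) (T.X.pt (i + 1)) := by
    rintro k (rfl | rfl)
    exacts [left_mem_Icc.2 hX.le, right_mem_Icc.2 hX.le]
  have memY : ∀ l, l = j ∨ l = j + 1 → T.Y.pt l ∈ Icc (T.Y.pt j) (T.Y.pt (j + 1)) := by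
    rintro k (rfl | rfl)
    exacts [left_mem_Icc.2 hY.le, right_mem_Icc.2 hY.le]
  have orX : ∀ k, k = i ∨ k = i + 1 → T.X.pt k = T.X.pt i ∨ T.X.pt k = T.X.pt (i + 1) := by
    rintro k (rfl | rfl) <;> simp
  have orY : ∀ k, k = j ∨ k = j + 1 → T.Y.pt k = T.Y.pt j ∨ T.Y.pt k = T.Y.pt (j + 1) := by
    rintro k (rfl | rfl) <;> simp
  have hint : ∀ {f g : ℝ × ℝ → ℝ}, (∀ z ∈ T.elem i j, f z = g z) →
      ∫ z in T.elem i j, |f z| = ∫ z in T.elem i j, |g z| := fun h =>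
    setIntegral_congr_fun (T.measurableSet_elem i j) fun z hz => by simp only [h z hz]
  refine ⟨fun k l hk' hl => ?_, fun l hl => ?_, fun k hk' => ?_⟩
  · rw [hint fun z hz => hk i j hi hj z.1 (Ioo_subset_Icc_self hz.1) z.2
      (Ioo_subset_Icc_self hz.2), hk i j hi hj _ (memX k hk') _ (memY l hl)]
    exact abs_bilinear_corner_le hX.le hY.le (orX k hk') (orY l hl)
  -- The increment along a horizontal edge is its length times `∂_x v`, which depends on `y` only.
  -- The corner estimate for this derivative is applied with vanishing coefficients of `x` and `x
  -- y`.
  · have h := abs_bilinear_corner_le (k₀ := k₁ i j) (k₁ := 0) (k₂ := k₃ i j) (k₃ := 0) hX.le hY.le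
      (orX i (Or.inl rfl)) (orY l hl)
    rw [hint fun z hz => T.piecewise_apply _ hi hj hz,
      hk i j hi hj _ (memX (i + 1) (Or.inr rfl)) _ (memY l hl),
      hk i j hi hj _ (memX i (Or.inl rfl)) _ (memY l hl)]
    simp only [zero_mul, add_zero] at h
    refine le_trans (le_of_eq ?_) h
    rw [mul_comm (T.X.pt (i + 1) - T.X.pt i), mul_assoc, ← abs_of_pos (sub_pos.2 hX), ← abs_mul,
      Grid.len]
    congr 2
    ring
  · have h := abs_bilinear_corner_le (k₀ := k₂ i j) (k₁ := k₃ i j) (k₂ := 0) (k₃ := 0) hX.le hY.le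
      (orX k hk') (orY j (Or.inl rfl))
    rw [hint fun z hz => T.piecewise_apply _ hi hj hz,
      hk i j hi hj _ (memX k hk') _ (memY (j + 1) (Or.inr rfl)),
      hk i j hi hj _ (memX k hk') _ (memY j (Or.inl rfl))]
    simp only [zero_mul, add_zero] at h
    refine le_trans (le_of_eq ?_) h
    rw [mul_assoc, ← abs_of_pos (sub_pos.2 hY), ← abs_mul, Grid.len]
    congr 2
    ring

end Mesh

end TrialFunctions

/-! ### From local averages to global Lebesgue and Sobolev norms. -/

noncomputable section Holder

/-! ### A localized Hölder inequality -/

section General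

variable {ι α : Type*} [Fintype ι] [MeasurableSpace α]

/-- Hölder's inequality for products of local averages. -/
lemma sum_inv_mul_lintegral_le (ν : ι → Measure α) [∀ k, IsFiniteMeasure (ν k)]
    (h0 : ∀ k, ν k univ ≠ 0) {p q : ℝ≥0∞} (hpq : p⁻¹ + q⁻¹ = 1) {f g : α → ℝ}
    (hf : AEStronglyMeasurable f (Measure.sum ν)) (hg : AEStronglyMeasurable g (Measure.sum ν)) :
    ∑ k, (ν k univ)⁻¹ * ((∫⁻ z, ‖f z‖ₑ ∂(ν k)) * ∫⁻ z, ‖g z‖ₑ ∂(ν k)) ≤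
      eLpNorm f p (Measure.sum ν) * eLpNorm g q (Measure.sum ν) := by
  have : ENNReal.HolderTriple p q 1 := ⟨by rw [hpq, inv_one]⟩
  -- Both marginals of this measure are `∑ ν_k`, because each product is normalised by the mass of
  -- `ν_k`. The ordinary Hölder inequality for `f(z) g(w)` with respect to `μ` is therefore the
  -- claim, with constant one for every pair of exponents.
  set μ : Measure (α × α) := Measure.sum fun k => (ν k univ)⁻¹ • (ν k).prod (ν k) with hμ
  have m1 : MeasurePreserving Prod.fst μ (Measure.sum ν) := by
    refine ⟨measurable_fst, ?_⟩
    rw [hμ, Measure.map_sum measurable_fst.aemeasurable]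
    congr 1
    funext k
    rw [Measure.map_smul, Measure.map_fst_prod, smul_smul,
      ENNReal.inv_mul_cancel (h0 k) (measure_ne_top _ _), one_smul]
  have m2 : MeasurePreserving Prod.snd μ (Measure.sum ν) := by
    refine ⟨measurable_snd, ?_⟩
    rw [hμ, Measure.map_sum measurable_snd.aemeasurable]
    congr 1
    funext k
    rw [Measure.map_smul, Measure.map_snd_prod, smul_smul,
      ENNReal.inv_mul_cancel (h0 k) (measure_ne_top _ _), one_smul]
  have hF : AEStronglyMeasurable (f ∘ Prod.fst) μ := hf.comp_measurePreserving m1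
  have hG : AEStronglyMeasurable (g ∘ Prod.snd) μ := hg.comp_measurePreserving m2
  have key := eLpNorm_smul_le_mul_eLpNorm (r := 1) hG hF (p := p) (q := q)
  rw [eLpNorm_comp_measurePreserving hf m1, eLpNorm_comp_measurePreserving hg m2,
    eLpNorm_one_eq_lintegral_enorm, hμ, lintegral_sum_measure, tsum_fintype] at key
  refine le_trans (le_of_eq (Finset.sum_congr rfl fun k _ => ?_)) key
  have hle : ν k ≤ Measure.sum ν := Measure.le_sum ν k
  rw [lintegral_smul_measure, ← lintegral_prod_mul (hf.mono_measure hle).enorm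
    (hg.mono_measure hle).enorm, smul_eq_mul]
  congr 1
  refine lintegral_congr fun z => ?_
  simp [enorm_mul]

end General

/-! ### The Sobolev norm -/

section Norm

variable {Ω : Set (ℝ × ℝ)} {m : ℕ} {p : ℝ≥0∞} {u : ℝ × ℝ → ℝ}

lemma MemSobolev.memLp_weakDeriv (hΩ : IsOpen Ω) (hu : MemSobolev m p Ω u) {α : ℕ × ℕ}
    (hα : α ∈ multiIndices m) : MemLp (weakDeriv Ω α u) p (volume.restrict Ω) := by
  obtain ⟨g, hg, hgp⟩ := hu α hα
  exact hgp.ae_eq (hg.ae_eq hΩ (isWeakDeriv_weakDeriv hg))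

/-- Membership in the Sobolev space makes all the norms finite, so nothing is lost by the `toReal`
in `sobolevNorm`. -/
lemma MemSobolev.eLpNorm_weakDeriv_le (hΩ : IsOpen Ω) (hp : p ≠ 0) (hu : MemSobolev m p Ω u)
    {α : ℕ × ℕ} (hα : α ∈ multiIndices m) :
    eLpNorm (weakDeriv Ω α u) p (volume.restrict Ω) ≤ ENNReal.ofReal (sobolevNorm m p Ω u) := by
  have hfin : ∀ β ∈ multiIndices m, eLpNorm (weakDeriv Ω β u) p (volume.restrict Ω) < ∞ :=
    fun β hβ => (hu.memLp_weakDeriv hΩ hβ).2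
  rw [sobolevNorm]
  split_ifs with hpt
  · subst hpt
    rw [ENNReal.ofReal_toReal]
    · exact Finset.le_sup (f := fun α => eLpNorm (weakDeriv Ω α u) ∞ (volume.restrict Ω)) hα
    · exact ((Finset.sup_lt_iff ENNReal.zero_lt_top).2 hfin).ne
  · have hp0 : 0 < p.toReal := ENNReal.toReal_pos hp hpt
    rw [ENNReal.ofReal_toReal]
    · rw [← ENNReal.rpow_rpow_inv hp0.ne' (eLpNorm (weakDeriv Ω α u) p (volume.restrict Ω)),
        one_div]
      refine ENNReal.rpow_le_rpow ?_ (by positivity)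
      exact Finset.single_le_sum
        (f := fun α => eLpNorm (weakDeriv Ω α u) p (volume.restrict Ω) ^ p.toReal)
        (fun _ _ => bot_le) hα
    · refine ENNReal.rpow_ne_top_of_nonneg (by positivity) ?_
      exact (ENNReal.sum_lt_top.2 fun β hβ =>
        ENNReal.rpow_lt_top_of_nonneg hp0.le (hfin β hβ).ne).ne

lemma sobolevNorm_nonneg : 0 ≤ sobolevNorm m p Ω u := ENNReal.toReal_nonneg

/-- The sum of the absolute values of weak derivatives is controlled by the Sobolev norm. -/
lemma MemSobolev.eLpNorm_sum_le (hΩ : IsOpen Ω) (hp : 1 ≤ p) (hu : MemSobolev m p Ω u)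
    {G : ℕ × ℕ → ℝ × ℝ → ℝ} (hG : ∀ α ∈ multiIndices m, IsWeakDeriv Ω α u (G α)) :
    MemLp (fun z => ∑ α ∈ multiIndices m, |G α z|) p (volume.restrict Ω) ∧
      eLpNorm (fun z => ∑ α ∈ multiIndices m, |G α z|) p (volume.restrict Ω) ≤
        ENNReal.ofReal ((multiIndices m).card * sobolevNorm m p Ω u) := by
  have hae : ∀ α ∈ multiIndices m, weakDeriv Ω α u =ᵐ[volume.restrict Ω] G α := fun α hα =>
    (isWeakDeriv_weakDeriv (hG α hα)).ae_eq hΩ (hG α hα)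
  have hmem : ∀ α ∈ multiIndices m, MemLp (fun z => |G α z|) p (volume.restrict Ω) := fun α hα =>
    ((hu.memLp_weakDeriv hΩ hα).ae_eq (hae α hα)).abs
  refine ⟨memLp_finsetSum _ hmem, ?_⟩
  have e : (fun z => ∑ α ∈ multiIndices m, |G α z|) =
      ∑ α ∈ multiIndices m, fun z => |G α z| := by
    funext z
    simp
  rw [e]
  refine (MeasureTheory.eLpNorm_sum_le (fun α hα => (hmem α hα).1) hp).trans ?_
  rw [ENNReal.ofReal_mul (by positivity), ENNReal.ofReal_natCast, ← nsmul_eq_mul]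
  refine Finset.sum_le_card_nsmul _ _ _ fun α hα => ?_
  have : eLpNorm (fun z => |G α z|) p (volume.restrict Ω) =
      eLpNorm (weakDeriv Ω α u) p (volume.restrict Ω) :=
    (eLpNorm_norm (G α)).trans (eLpNorm_congr_ae (hae α hα)).symm
  rw [this]
  exact hu.eLpNorm_weakDeriv_le hΩ (one_pos.trans_le hp).ne' hα

end Norm

namespace Mesh

variable {a b c d : ℝ} (T : Mesh a b c d)

lemma volume_real_elem {i j : ℕ} (hi : i < T.X.n) (hj : j < T.Y.n) :
    volume.real (T.elem i j) = T.X.len i * T.Y.len j :=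
  volume_real_rect (T.X.pt_lt i hi).le (T.Y.pt_lt j hj).le

lemma sum_restrict_elem : Measure.sum (fun K : T.Elem => volume.restrict (T.elem K.1 K.2)) =
    volume.restrict (rect a b c d) := by
  rw [← Measure.restrict_congr_set T.iUnion_elem_ae_eq]
  simp only [Finset.mem_univ, iUnion_true]
  refine (Measure.restrict_iUnion (fun K L hne => ?_) fun K => T.measurableSet_elem _ _).symm
  exact Set.disjoint_left.2 fun z hK hL => hne (T.elem_eq_of_mem hK hL)

/-- Hölder's inequality for sums of products of element averages. -/
theorem sum_elem_mul_le {p q : ℝ≥0∞} (hpq : p⁻¹ + q⁻¹ = 1) {f g : ℝ × ℝ → ℝ}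
    (hf0 : ∀ z, 0 ≤ f z) (hg0 : ∀ z, 0 ≤ g z)
    (hf : MemLp f p (volume.restrict (rect a b c d)))
    (hg : MemLp g q (volume.restrict (rect a b c d))) {Nf Ng : ℝ} (hNf : 0 ≤ Nf) (hNg : 0 ≤ Ng)
    (hf' : eLpNorm f p (volume.restrict (rect a b c d)) ≤ ENNReal.ofReal Nf)
    (hg' : eLpNorm g q (volume.restrict (rect a b c d)) ≤ ENNReal.ofReal Ng) :
    ∑ i ∈ Finset.range T.X.n, ∑ j ∈ Finset.range T.Y.n,
      (T.X.len i * T.Y.len j)⁻¹ * ((∫ z in T.elem i j, f z) * ∫ z in T.elem i j, g z) ≤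
      Nf * Ng := by
  have hfin : IsFiniteMeasure (volume.restrict (rect a b c d)) := ⟨by simpa using volume_rect_lt_top⟩
  have hfinK : ∀ K : T.Elem, IsFiniteMeasure (volume.restrict (T.elem K.1 K.2)) := fun K =>
    ⟨by rw [Measure.restrict_apply_univ]; exact volume_rect_lt_top⟩
  have hpos : ∀ K : T.Elem, 0 < T.X.len K.1 * T.Y.len K.2 := fun K =>
    mul_pos (sub_pos.2 (T.X.pt_lt _ K.1.2)) (sub_pos.2 (T.Y.pt_lt _ K.2.2))
  have hvol : ∀ K : T.Elem, (volume.restrict (T.elem K.1 K.2)) univ =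
      ENNReal.ofReal (T.X.len K.1 * T.Y.len K.2) := by
    intro K
    rw [Measure.restrict_apply_univ, ← T.volume_real_elem K.1.2 K.2.2, measureReal_def,
      ENNReal.ofReal_toReal]
    exact volume_rect_lt_top.ne
  have key := sum_inv_mul_lintegral_le (fun K : T.Elem => volume.restrict (T.elem K.1 K.2))
    (fun K => by rw [hvol]; exact (ENNReal.ofReal_pos.2 (hpos K)).ne') hpq
    (f := f) (g := g) (by rw [sum_restrict_elem]; exact hf.1) (by rw [sum_restrict_elem]; exact hg.1)
  rw [sum_restrict_elem] at key
  have hq1 : 1 ≤ q := by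
    rw [← ENNReal.inv_le_one, ← hpq]
    exact le_add_self
  have hp1 : 1 ≤ p := by
    rw [← ENNReal.inv_le_one, ← hpq]
    exact le_self_add
  have conv : ∀ {h : ℝ × ℝ → ℝ}, (∀ z, 0 ≤ h z) → IntegrableOn h (rect a b c d) →
      ∀ K : T.Elem, ∫⁻ z in T.elem K.1 K.2, ‖h z‖ₑ =
        ENNReal.ofReal (∫ z in T.elem K.1 K.2, h z) := by
    intro h h0 hi K
    rw [ofReal_integral_eq_lintegral_ofReal (hi.mono_set (T.elem_subset K.1.2 K.2.2))
      (Eventually.of_forall h0)]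
    exact lintegral_congr fun z => Real.enorm_of_nonneg (h0 z)
  have hnn : ∀ {h : ℝ × ℝ → ℝ}, (∀ z, 0 ≤ h z) → ∀ K : T.Elem, 0 ≤ ∫ z in T.elem K.1 K.2, h z :=
    fun h0 K => integral_nonneg h0
  rw [← T.sum_elem fun i j =>
    (T.X.len i * T.Y.len j)⁻¹ * ((∫ z in T.elem i j, f z) * ∫ z in T.elem i j, g z),
    ← ENNReal.ofReal_le_ofReal_iff (by positivity), ENNReal.ofReal_mul hNf,
    ENNReal.ofReal_sum_of_nonneg fun K _ => mul_nonneg (inv_nonneg.2 (hpos K).le)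
      (mul_nonneg (hnn hf0 K) (hnn hg0 K))]
  refine le_trans (le_of_eq (Finset.sum_congr rfl fun K _ => ?_))
    (key.trans (mul_le_mul' hf' hg'))
  rw [ENNReal.ofReal_mul (inv_nonneg.2 (hpos K).le), ENNReal.ofReal_mul (hnn hf0 K),
    ENNReal.ofReal_inv_of_pos (hpos K), hvol, conv hf0 (hf.integrable hp1),
    conv hg0 (hg.integrable hq1)]

end Mesh

end Holder

/-! ### Assembly: element sizes, nodal bounds of trial functions, and the theorem. -/

noncomputable section MainEstimate

lemma continuous_of_abs_sub_le {f : ℝ × ℝ → ℝ} {L : ℝ} (hL : 0 ≤ L)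
    (h : ∀ x y x' y', |f (x, y) - f (x', y')| ≤ L * (|x - x'| + |y - y'|)) : Continuous f := by
  refine (LipschitzWith.of_dist_le_mul (K := (2 * L).toNNReal) fun z w => ?_).continuous
  rw [Real.coe_toNNReal _ (by positivity), Real.dist_eq]
  have h1 : |z.1 - w.1| ≤ dist z w := by
    rw [← Real.dist_eq, Prod.dist_eq]; exact le_max_left _ _
  have h2 : |z.2 - w.2| ≤ dist z w := by
    rw [← Real.dist_eq, Prod.dist_eq]; exact le_max_right _ _
  have := h z.1 z.2 w.1 w.2
  nlinarith

lemma ae_abs_le_of_memLp_top {α : Type*} [MeasurableSpace α] {μ : Measure α} {f : α → ℝ}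
    (hf : MemLp f ∞ μ) : ∀ᵐ z ∂μ, |f z| ≤ (eLpNorm f ∞ μ).toReal := by
  filter_upwards [ae_le_eLpNormEssSup (f := f) (μ := μ)] with z hz
  rw [← eLpNorm_exponent_top] at hz
  simpa using ENNReal.toReal_mono hf.2.ne hz

lemma memLp_rect_of_continuousOn {a b c d : ℝ} {f : ℝ × ℝ → ℝ}
    (hf : ContinuousOn f (Icc a b ×ˢ Icc c d)) : MemLp f ∞ (volume.restrict (rect a b c d)) := by
  obtain ⟨C, hC⟩ := (isCompact_Icc.prod isCompact_Icc).exists_bound_of_continuousOn hf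
  refine memLp_top_of_bound (integrableOn_rect_of_continuousOn hf).1 C ?_
  filter_upwards [ae_restrict_mem measurableSet_rect] with z hz
  exact hC z (rect_subset_Icc hz)

namespace Mesh

variable {a b c d : ℝ} (T : Mesh a b c d)

lemma len_pos_X {i : ℕ} (hi : i < T.X.n) : 0 < T.X.len i := sub_pos.2 (T.X.pt_lt i hi)

lemma len_pos_Y {j : ℕ} (hj : j < T.Y.n) : 0 < T.Y.len j := sub_pos.2 (T.Y.pt_lt j hj)

/-- Diameter of the element with the given indices. -/
def elemDiam (i j : ℕ) : ℝ := Real.sqrt (T.X.len i ^ 2 + T.Y.len j ^ 2)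

lemma elemDiam_nonneg (i j : ℕ) : 0 ≤ T.elemDiam i j := Real.sqrt_nonneg _

lemma elemDiam_le_size {i j : ℕ} (hi : i < T.X.n) (hj : j < T.Y.n) : T.elemDiam i j ≤ T.size :=
  le_ciSup (f := T.diam) (finite_range _).bddAbove (⟨i, hi⟩, ⟨j, hj⟩)

lemma elemDiam_bounds {γ : ℝ} (hT : T.IsRegular γ) (hγ : 0 ≤ γ) {i j : ℕ} (hi : i < T.X.n)
    (hj : j < T.Y.n) : T.X.len i ≤ T.elemDiam i j ∧ T.Y.len j ≤ T.elemDiam i j ∧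
      T.elemDiam i j ≤ γ * T.X.len i ∧ T.elemDiam i j ≤ γ * T.Y.len j ∧
      T.elemDiam i j ≤ (b - a) + (d - c) := by
  have hx := T.len_pos_X hi
  have hy := T.len_pos_Y hj
  have h : T.elemDiam i j ≤ γ * min (T.X.len i) (T.Y.len j) :=
    (div_le_iff₀ (lt_min hx hy)).1 (hT (⟨i, hi⟩, ⟨j, hj⟩))
  refine ⟨Real.le_sqrt_of_sq_le (by nlinarith), Real.le_sqrt_of_sq_le (by nlinarith),
    h.trans (mul_le_mul_of_nonneg_left (min_le_left _ _) hγ),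
    h.trans (mul_le_mul_of_nonneg_left (min_le_right _ _) hγ), ?_⟩
  have h1 : T.X.len i ≤ b - a := by
    have e1 := (T.X.pt_mem_Icc hi.le).1
    have e2 := (T.X.pt_mem_Icc (Nat.succ_le_of_lt hi)).2
    rw [Grid.len]
    linarith
  have h2 : T.Y.len j ≤ d - c := by
    have e1 := (T.Y.pt_mem_Icc hj.le).1
    have e2 := (T.Y.pt_mem_Icc (Nat.succ_le_of_lt hj)).2
    rw [Grid.len]
    linarith
  refine (Real.sqrt_le_left (by linarith)).2 ?_
  nlinarith

/-- Nodal bounds for a trial function in terms of the element average of the function and of its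
weak gradient. -/
lemma IsTrial.nodal_bounds {T : Mesh a b c d} (hab : a < b) (hcd : c < d) {v : ℝ × ℝ → ℝ}
    (hv : T.IsTrial v) : ∃ G : ℕ × ℕ → ℝ × ℝ → ℝ,
      (∀ α ∈ multiIndices 1, IsWeakDeriv (rect a b c d) α v (G α)) ∧
      (∀ α, MemLp (G α) ∞ (volume.restrict (rect a b c d))) ∧
      ∀ i < T.X.n, ∀ j < T.Y.n, ∀ N, N = 9 * (T.X.len i * T.Y.len j)⁻¹ *
          (∫ z in T.elem i j, ∑ α ∈ multiIndices 1, |G α z|) →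
        (∀ k l, k = i ∨ k = i + 1 → l = j ∨ l = j + 1 → |v (T.X.pt k, T.Y.pt l)| ≤ N) ∧
        (∀ l, l = j ∨ l = j + 1 →
          |v (T.X.pt (i + 1), T.Y.pt l) - v (T.X.pt i, T.Y.pt l)| ≤ T.X.len i * N) ∧
        ∀ k, k = i ∨ k = i + 1 →
          |v (T.X.pt k, T.Y.pt (j + 1)) - v (T.X.pt k, T.Y.pt j)| ≤ T.Y.len j * N := by
  obtain ⟨vx, vy, hx, hy, mx, my, hb⟩ := hv.exists_gradient hab hcd
  have hfin : IsFiniteMeasure (volume.restrict (rect a b c d)) := ⟨by simpa using volume_rect_lt_top⟩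
  have hvc := hv.1
  rw [closure_rect hab hcd] at hvc
  set G : ℕ × ℕ → ℝ × ℝ → ℝ := fun α => if α = (0, 0) then v else if α = (1, 0) then vx else vy
    with hG
  have hcases : ∀ α ∈ multiIndices 1, α = (0, 0) ∨ α = (1, 0) ∨ α = (0, 1) := by
    rintro ⟨i, j⟩ hα
    have := mem_multiIndices.1 hα
    simp only at this
    simp only [Prod.mk.injEq]
    omega
  have hmem : ∀ α, MemLp (G α) ∞ (volume.restrict (rect a b c d)) := by
    intro α
    simp only [hG]
    split_ifs
    exacts [memLp_rect_of_continuousOn hvc, mx, my]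
  refine ⟨G, fun α hα => ?_, hmem, fun i hi j hj N hN => ?_⟩
  · rcases hcases α hα with rfl | rfl | rfl
    · exact IsWeakDeriv.refl (integrableOn_rect_of_continuousOn hvc).locallyIntegrableOn
    · exact hx
    · exact hy
  obtain ⟨b1, b2, b3⟩ := hb i hi j hj
  have hXp := T.len_pos_X hi
  have hYp := T.len_pos_Y hj
  have hint : ∀ α, IntegrableOn (fun z => |G α z|) (T.elem i j) := fun α =>
    ((hmem α).integrable le_top).abs.mono_measure
      (Measure.restrict_mono (T.elem_subset hi hj) le_rfl)
  set I := ∫ z in T.elem i j, ∑ α ∈ multiIndices 1, |G α z| with hI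
  have hle : ∀ α ∈ multiIndices 1, ∫ z in T.elem i j, |G α z| ≤ I := fun α hα =>
    integral_mono (hint α) (integrable_finsetSum _ fun β _ => hint β) fun z =>
      Finset.single_le_sum (f := fun α => |G α z|) (fun _ _ => abs_nonneg _) hα
  have e0 : ∫ z in T.elem i j, |v z| ≤ I := hle (0, 0) (by simp [mem_multiIndices])
  have ex : ∫ z in T.elem i j, |vx z| ≤ I := hle (1, 0) (by simp [mem_multiIndices])
  have ey : ∫ z in T.elem i j, |vy z| ≤ I := hle (0, 1) (by simp [mem_multiIndices])
  have hNX : T.X.len i * N = 9 * I / T.Y.len j := by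
    rw [hN]
    field_simp
  have hNY : T.Y.len j * N = 9 * I / T.X.len i := by
    rw [hN]
    field_simp
  have hN' : N = 9 * I / (T.X.len i * T.Y.len j) := by
    rw [hN]
    field_simp
  refine ⟨fun k l hk hl => ?_, fun l hl => ?_, fun k hk => ?_⟩
  · rw [hN', le_div_iff₀ (by positivity)]
    linarith [b1 k l hk hl]
  · rw [hNX, le_div_iff₀ hYp]
    linarith [b2 l hl]
  · rw [hNY, le_div_iff₀ hXp]
    linarith [b3 k hk]

/-- A trial function extended by zero vanishes on the lines bounding the domain. -/
lemma IsTrial.indicator_eq_zero {T : Mesh a b c d} (hab : a < b) (hcd : c < d) {v : ℝ × ℝ → ℝ}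
    (hv : T.IsTrial v) {z : ℝ × ℝ} (hz : z ∉ rect a b c d) :
    (Icc a b ×ˢ Icc c d).indicator v z = 0 := by
  by_cases h : z ∈ Icc a b ×ˢ Icc c d
  · rw [indicator_of_mem h]
    refine hv.2.2 z ?_
    rw [isOpen_rect.frontier_eq, closure_rect hab hcd]
    exact ⟨h, hz⟩
  · exact indicator_of_notMem h _

end Mesh

end MainEstimate

end FVE

/-- Superclose weak estimate for the finite volume element bilinear form. The coefficient matrix
and `u` stand for their continuous representatives. -/
theorem theorem3p1 (a b c d : ℝ) (hab : a < b) (hcd : c < d)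
    (A : ℝ × ℝ → Matrix (Fin 2) (Fin 2) ℝ) (c₀ : ℝ × ℝ → ℝ)
    (hA : ∀ i j, FVE.MemSobolev 1 ∞ (FVE.rect a b c d) (fun z => A z i j))
    (hAc : ∀ i j, ContinuousOn (fun z => A z i j) (FVE.rect a b c d))
    (hell : ∃ C₁ > 0, ∃ C₂ > 0, ∀ z ∈ FVE.rect a b c d, ∀ ξ : Fin 2 → ℝ,
      C₁ * (ξ ⬝ᵥ ξ) ≤ ξ ⬝ᵥ (A z).mulVec ξ ∧ ξ ⬝ᵥ (A z).mulVec ξ ≤ C₂ * (ξ ⬝ᵥ ξ))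
    (hc : MemLp c₀ ∞ (volume.restrict (FVE.rect a b c d)))
    (hc_nonneg : ∀ᵐ z ∂(volume.restrict (FVE.rect a b c d)), 0 ≤ c₀ z)
    (γ : ℝ) (hγ : 0 < γ) :
    ∃ C > 0, ∀ T : FVE.Mesh a b c d, T.IsRegular γ →
      ∀ p q : ℝ≥0∞, 2 ≤ p → p⁻¹ + q⁻¹ = 1 →
      ∀ u : ℝ × ℝ → ℝ, FVE.MemSobolev 3 p (FVE.rect a b c d) u →
        ContinuousOn u (closure (FVE.rect a b c d)) →
      ∀ v : ℝ × ℝ → ℝ, T.IsTrial v →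
        |FVE.fveForm T A c₀ (u - T.interp u) (T.dualInterp v)| ≤
          C * T.size ^ 2 * FVE.sobolevNorm 3 p (FVE.rect a b c d) u *
            FVE.sobolevNorm 1 q (FVE.rect a b c d) v := by
  have hBex := fun k l => FVE.exists_lipschitz_extension hab hcd (hA k l) (hAc k l)
  choose B M L hL0 hAB hBM hBL using hBex
  have hfin : IsFiniteMeasure (volume.restrict (FVE.rect a b c d)) :=
    ⟨by simpa using FVE.volume_rect_lt_top⟩
  have hBc : ∀ k l, Continuous (B k l) := fun k l =>
    FVE.continuous_of_abs_sub_le (hL0 k l) (hBL k l)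
  set M' := ∑ k, ∑ l, |M k l| with hM'
  set L' := ∑ k, ∑ l, L k l with hL'
  have hM'0 : 0 ≤ M' := by positivity
  have hL'0 : 0 ≤ L' := Finset.sum_nonneg fun k _ => Finset.sum_nonneg fun l _ => hL0 k l
  have hMle : ∀ k l, M k l ≤ M' := fun k l => (le_abs_self _).trans
    ((Finset.single_le_sum (f := fun l => |M k l|) (fun _ _ => abs_nonneg _)
      (Finset.mem_univ l)).trans
        (Finset.single_le_sum (f := fun k => ∑ l, |M k l|)
          (fun _ _ => Finset.sum_nonneg fun _ _ => abs_nonneg _) (Finset.mem_univ k)))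
  have hLle : ∀ k l, L k l ≤ L' := fun k l =>
    (Finset.single_le_sum (f := fun l => L k l) (fun l _ => hL0 k l) (Finset.mem_univ l)).trans
      (Finset.single_le_sum (f := fun k => ∑ l, L k l)
        (fun k _ => Finset.sum_nonneg fun l _ => hL0 k l) (Finset.mem_univ k))
  set R := (b - a) + (d - c) with hR
  have hR0 : 0 < R := by linarith
  set Cc := (eLpNorm c₀ ∞ (volume.restrict (FVE.rect a b c d))).toReal with hCc
  have hCc0 : 0 ≤ Cc := ENNReal.toReal_nonneg
  -- The first summand is the diffusion constant, with one copy for each direction of mid lines; the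
  -- second is the reaction constant, where `2 + R` comes from the L¹ interpolation error.
  set K := 2 * (M' * (4 + γ) + L' * (2 + 4 * R + γ)) + Cc * (2 + R) with hK
  have hK0 : 0 ≤ K := by positivity
  set n₃ : ℝ := ((FVE.multiIndices 3).card : ℝ) with hn3
  set n₁ : ℝ := ((FVE.multiIndices 1).card : ℝ) with hn1
  -- The `9` is the inverse estimate, and `n₃`, `n₁` count the derivatives when sums of L^p and L^q
  -- norms are bounded by Sobolev norms. The `+ 1` only makes the constant positive.
  refine ⟨K * 9 * (n₃ * n₁) + 1, by positivity, ?_⟩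
  intro T hT p q hp hpq u hu huc v hv
  have hp1 : 1 ≤ p := le_trans (by norm_num) hp
  have hq1 : 1 ≤ q := by
    rw [← ENNReal.inv_le_one, ← hpq]
    exact le_add_self
  have huc' := huc
  rw [FVE.closure_rect hab hcd] at huc'
  have hui := FVE.integrableOn_rect_of_continuousOn huc'
  -- weak derivatives of `u`
  set G : ℕ → ℕ → ℝ × ℝ → ℝ := fun i j =>
    if (i, j) = (0, 0) then u else FVE.weakDeriv (FVE.rect a b c d) (i, j) u with hGdef
  have hG : ∀ i j, i + j ≤ 3 → FVE.IsWeakDeriv (FVE.rect a b c d) (i, j) u (G i j) := by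
    intro i j hij
    simp only [hGdef]
    split_ifs with h
    · rw [h]
      exact FVE.IsWeakDeriv.refl hui.locallyIntegrableOn
    · obtain ⟨g, hg, -⟩ := hu (i, j) (FVE.mem_multiIndices.2 hij)
      exact FVE.isWeakDeriv_weakDeriv hg
  have hGi : ∀ i j, i + j ≤ 3 → IntegrableOn (G i j) (FVE.rect a b c d) := by
    intro i j hij
    simp only [hGdef]
    split_ifs with h
    · exact hui
    · exact (hu.memLp_weakDeriv FVE.isOpen_rect (FVE.mem_multiIndices.2 hij)).integrable hp1
  obtain ⟨ux, uy, cux, cuy, hux, huy, hjet⟩ :=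
    FVE.exists_gradient_and_jetLimit (u := u) hab hcd rfl hG hGi huc
  obtain ⟨huF, huFle⟩ := hu.eLpNorm_sum_le FVE.isOpen_rect hp1 (G := fun α => G α.1 α.2)
    fun α hα => hG α.1 α.2 (FVE.mem_multiIndices.1 hα)
  -- weak derivatives of `v`
  obtain ⟨Gv, hGv, hGvm, hvN⟩ := hv.nodal_bounds hab hcd
  have hvS : FVE.MemSobolev 1 q (FVE.rect a b c d) v := fun α hα =>
    ⟨Gv α, hGv α hα, (hGvm α).mono_exponent le_top⟩
  obtain ⟨hvF, hvFle⟩ := hvS.eLpNorm_sum_le FVE.isOpen_rect hq1 hGv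
  have holder := T.sum_elem_mul_le hpq
    (fun z => Finset.sum_nonneg fun α _ => abs_nonneg (G α.1 α.2 z))
    (fun z => Finset.sum_nonneg fun α _ => abs_nonneg (Gv α z)) huF hvF
    (mul_nonneg (Nat.cast_nonneg _) FVE.sobolevNorm_nonneg)
    (mul_nonneg (Nat.cast_nonneg _) FVE.sobolevNorm_nonneg) huFle hvFle
  set I : ℕ → ℕ → ℝ := fun i j =>
    ∫ z in T.elem i j, ∑ α ∈ FVE.multiIndices 1, |Gv α z| with hI
  set N : ℕ → ℕ → ℝ := fun i j => 9 * (T.X.len i * T.Y.len j)⁻¹ * I i j with hN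
  set S : ℕ → ℕ → ℝ := fun i j => ∑ α ∈ FVE.multiIndices 3, ∫ z in FVE.rect (T.X.pt i)
    (T.X.pt (i + 1)) (T.Y.pt j) (T.Y.pt (j + 1)), |G α.1 α.2 z| with hS
  have hSeq : ∀ i < T.X.n, ∀ j < T.Y.n,
      S i j = ∫ z in T.elem i j, ∑ α ∈ FVE.multiIndices 3, |G α.1 α.2 z| := by
    intro i hi j hj
    refine (integral_finsetSum _ fun α hα => ?_).symm
    exact ((hGi α.1 α.2 (FVE.mem_multiIndices.1 hα)).mono_set (T.elem_subset hi hj)).abs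
  have hS0 : ∀ i j, 0 ≤ S i j := fun i j =>
    Finset.sum_nonneg fun α _ => integral_nonneg fun z => abs_nonneg _
  have hI0 : ∀ i j, 0 ≤ I i j := fun i j =>
    integral_nonneg fun z => Finset.sum_nonneg fun α _ => abs_nonneg _
  have hN0 : ∀ i < T.X.n, ∀ j < T.Y.n, 0 ≤ N i j := fun i hi j hj => by
    have h1 := T.len_pos_X hi
    have h2 := T.len_pos_Y hj
    have h3 := hI0 i j
    simp only [hN]
    positivity
  have hjets : ∀ i < T.X.n, ∀ j < T.Y.n, ∃ D s, FVE.JetLimit (T.X.pt i) (T.X.pt (i + 1))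
      (T.Y.pt j) (T.Y.pt (j + 1)) (fun x y => u (x, y)) (fun x y => ux (x, y))
      (fun x y => uy (x, y)) (S i j) D s := fun i hi j hj =>
    hjet _ _ _ _ (T.X.pt_lt i hi).le (T.Y.pt_lt j hj).le (T.X.Icc_subset hi) (T.Y.Icc_subset hj)
  have hH := fun i (hi : i < T.X.n) j (hj : j < T.Y.n) => T.elemDiam_bounds hT hγ.le hi hj
  -- diffusion part
  set v' := (Icc a b ×ˢ Icc c d).indicator v with hv'
  -- The flux estimate asks for zeros on the full lines `x = a`, `x = b`, `y = c`, `y = d`, beyond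
  -- the rectangle as well. Extension by zero provides them without changing any nodal value.
  have hv'eq : ∀ i ≤ T.X.n, ∀ j ≤ T.Y.n,
      v' (T.X.pt i, T.Y.pt j) = v (T.X.pt i, T.Y.pt j) := fun i hi j hj =>
    indicator_of_mem (show (T.X.pt i, T.Y.pt j) ∈ Icc a b ×ˢ Icc c d from
      ⟨T.X.pt_mem_Icc hi, T.Y.pt_mem_Icc hj⟩) _
  have hflux := T.abs_sum_boundaryFlux_le (A := A) (B := B) (v := v') (γ := γ) (R := R) (M := M')
    (L := L') (H := T.elemDiam) (N := N) (S := S) (fun z hz k l => hAB k l hz) hBc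
    (fun k l z hz => (hBM k l z hz).trans (hMle k l))
    (fun k l x y x' y' => (hBL k l x y x' y').trans
      (mul_le_mul_of_nonneg_right (hLle k l) (by positivity))) hL'0 hγ.le cux cuy hux huy
    (fun y => ⟨hv.indicator_eq_zero hab hcd fun h => lt_irrefl _ h.1.1,
      hv.indicator_eq_zero hab hcd fun h => lt_irrefl _ h.1.2⟩)
    (fun x => ⟨hv.indicator_eq_zero hab hcd fun h => lt_irrefl _ h.2.1,
      hv.indicator_eq_zero hab hcd fun h => lt_irrefl _ h.2.2⟩) hjets hH
    (by
      intro i hi j hj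
      rw [hv'eq i hi.le j hj.le, hv'eq (i + 1) hi j hj.le, hv'eq i hi.le (j + 1) hj,
        hv'eq (i + 1) hi (j + 1) hj]
      obtain ⟨-, b2, b3⟩ := hvN i hi j hj (N i j) rfl
      obtain ⟨h1, h2, -⟩ := hH i hi j hj
      have e1 := mul_le_mul_of_nonneg_right h1 (hN0 i hi j hj)
      have e2 := mul_le_mul_of_nonneg_right h2 (hN0 i hi j hj)
      exact ⟨(b2 j (Or.inl rfl)).trans e1, (b2 (j + 1) (Or.inr rfl)).trans e1,
        (b3 i (Or.inl rfl)).trans e2, (b3 (i + 1) (Or.inr rfl)).trans e2⟩)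
  have hpt : ∀ P : T.Node, v' (T.point P) = v (T.point P) := fun P =>
    hv'eq _ (Nat.lt_succ_iff.1 P.1.2) _ (Nat.lt_succ_iff.1 P.2.2)
  simp only [hpt] at hflux
  -- reaction part
  have hreact := T.abs_sum_reaction_le (w := u - T.interp u) hc.1 (FVE.ae_abs_le_of_memLp_top hc)
    (hui.sub (FVE.integrableOn_rect_of_continuousOn (T.continuous_interp u).continuousOn))
    fun i hi j hj => (hvN i hi j hj (N i j) rfl).1
  have hw : ∀ i < T.X.n, ∀ j < T.Y.n, ∫ z in T.elem i j, |(u - T.interp u) z| ≤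
      (2 + R) * (T.elemDiam i j ^ 2 * S i j) := by
    intro i hi j hj
    obtain ⟨D, s, h⟩ := hjets i hi j hj
    obtain ⟨h1, h2, -, -, h5⟩ := hH i hi j hj
    refine le_trans (le_of_eq ?_) (h.integral_abs_sub_bilin_le (T.X.pt_lt i hi) (T.Y.pt_lt j hj)
      (huc'.mono (prod_mono (T.X.Icc_subset hi) (T.Y.Icc_subset hj))) h1 h2 h5)
    refine setIntegral_congr_fun (T.measurableSet_elem i j) fun z hz => ?_
    have := T.interp_eq_bilin u hi hj (Ioo_subset_Icc_self hz.1) (Ioo_subset_Icc_self hz.2)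
    simp only [Pi.sub_apply, ← this]
  -- conclusion
  rw [T.fveForm_dualInterp hab hcd]
  set Q := ∑ i ∈ Finset.range T.X.n, ∑ j ∈ Finset.range T.Y.n,
    T.elemDiam i j ^ 2 * N i j * S i j with hQ
  have hreact' : ∑ i ∈ Finset.range T.X.n, ∑ j ∈ Finset.range T.Y.n,
      N i j * ∫ z in T.elem i j, |(u - T.interp u) z| ≤ (2 + R) * Q := by
    rw [hQ, Finset.mul_sum]
    refine Finset.sum_le_sum fun i hi => ?_
    rw [Finset.mul_sum]
    refine Finset.sum_le_sum fun j hj => ?_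
    rw [Finset.mem_range] at hi hj
    have := mul_le_mul_of_nonneg_left (hw i hi j hj) (hN0 i hi j hj)
    linarith
  -- Element diameters are replaced by the global mesh size only here. Then `N i j * S i j` is `9
  -- |K|⁻¹` times a product of two element integrals, which is what the localized Hölder inequality
  -- sums.
  have hsum : Q ≤ T.size ^ 2 * (9 * ((n₃ * FVE.sobolevNorm 3 p (FVE.rect a b c d) u) *
      (n₁ * FVE.sobolevNorm 1 q (FVE.rect a b c d) v))) := by
    refine le_trans ?_ (mul_le_mul_of_nonneg_left (mul_le_mul_of_nonneg_left holder
      (by norm_num : (0 : ℝ) ≤ 9)) (sq_nonneg _))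
    rw [hQ, Finset.mul_sum, Finset.mul_sum]
    refine Finset.sum_le_sum fun i hi => ?_
    rw [Finset.mul_sum, Finset.mul_sum]
    refine Finset.sum_le_sum fun j hj => ?_
    rw [Finset.mem_range] at hi hj
    rw [← hSeq i hi j hj]
    have h1 : T.elemDiam i j ^ 2 ≤ T.size ^ 2 :=
      pow_le_pow_left₀ (T.elemDiam_nonneg i j) (T.elemDiam_le_size hi hj) 2
    have h2 := mul_le_mul_of_nonneg_right h1 (mul_nonneg (hN0 i hi j hj) (hS0 i j))
    refine le_trans (le_of_eq (mul_assoc _ _ _)) (h2.trans (le_of_eq ?_))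
    simp only [hN, hI]
    ring
  have hrest : 0 ≤ T.size ^ 2 * (FVE.sobolevNorm 3 p (FVE.rect a b c d) u *
      FVE.sobolevNorm 1 q (FVE.rect a b c d) v) :=
    mul_nonneg (sq_nonneg _) (mul_nonneg FVE.sobolevNorm_nonneg FVE.sobolevNorm_nonneg)
  calc _ ≤ 2 * (M' * (4 + γ) + L' * (2 + 4 * R + γ)) * Q + Cc * ((2 + R) * Q) :=
        (abs_add_le _ _).trans (add_le_add hflux
          (hreact.trans (mul_le_mul_of_nonneg_left hreact' hCc0)))
    _ = K * Q := by rw [hK]; ring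
    _ ≤ _ := mul_le_mul_of_nonneg_left hsum hK0
    _ ≤ _ := by linarith
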